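/- Let $p$ be an odd prime, let $k=\mathbb{F}_{p^2}$, let $d\ge 0$ be an integer, and let $V$ be an $\mathbb{F}_p$-vector space of dimension $2(d+1)$ with a nondegenerate symmetric bilinear form that is nonsplit (that is, $V$ has no totally isotropic subspace of dimension $d+1$). For a $k$-scheme $S$ let $\mathrm{Frob}\colon S\to S$ be the absolute $p$-power Frobenius; since $\mathrm{Frob}^*(V\otimes\mathcal{O}_S)=V\otimes\mathcal{O}_S$, it pulls a local direct summand of $V\otimes\mathcal{O}_S$ back to a local direct summand of $V\otimes\mathcal{O}_S$. Let $\mathrm{OGr}(d,d+1)$ be the $k$-scheme representing the functor that sends $S$ to the set of flags $\mathcal{L}_d\subset\mathcal{L}_{d+1}\subset V\otimes\mathcal{O}_S$ of totally isotropic local direct summands of ranks $d$ and $d+1$. Let $\mathscr{Y}_V$ be the $k$-scheme representing the functor that sends $S$ to the set of those flags for which $\mathcal{L}_d\subset\mathrm{Frob}^*\mathcal{L}_{d+1}$ and $\mathcal{L}_{d+1}+\mathrm{Frob}^*\mathcal{L}_{d+1}$ is locally a direct summand of $V\otimes\mathcal{O}_S$. Let $Y_V\subset\mathscr{Y}_V$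 be the inverse image, under the forgetful morphism $\mathscr{Y}_V\to\mathrm{OGr}(d,d+1)$, of either one of the two connected components $\mathrm{OGr}^{\pm}(d,d+1)$ of $\mathrm{OGr}(d,d+1)$. Let $(\mathcal{U}_d,\mathcal{U}_{d+1})$ be the universal object over $Y_V$ and put $\mathcal{L}_{Y_V}=\mathcal{U}_{d+1}/\mathcal{U}_d$. Then there is an isomorphism of $\mathcal{O}_{Y_V}$-modules $$T_{Y_V/\mathbb{F}_{p^2}}\;\simeq\;\underline{\mathrm{Hom}}\bigl(\mathcal{L}_{Y_V},\,V\otimes\mathcal{O}_{Y_V}/(\mathcal{U}_{d+1}+\mathrm{Frob}^*\mathcal{U}_{d+1})\bigr),$$ where $T_{Y_V/\mathbb{F}_{p^2}}$ is the tangent bundle of $Y_V$ over $\mathbb{F}_{p^2}$, i.e. the sheaf of $\mathbb{F}_{p^2}$-derivations of $\mathcal{O}_{Y_V}$. -/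

import Mathlib

open CategoryTheory AlgebraicGeometry TopologicalSpace Opposite TensorProduct

universe u

noncomputable section

namespace DLTangent

/-! ### Extension of scalars of an `𝔽_p`-vector space -/

section Scalars

variable {p : ℕ} [Fact p.Prime] (V : Type u) [AddCommGroup V] [Module (ZMod p) V]
variable {A A' A'' : Type u} [CommRing A] [CommRing A'] [CommRing A'']
  [Algebra (ZMod p) A] [Algebra (ZMod p) A'] [Algebra (ZMod p) A'']

/-- The map `A ⊗ V → A' ⊗ V` induced by a ring homomorphism `A → A'` of `𝔽_p`-algebras. -/
def secMap (φ : A →+* A') : A ⊗[ZMod p] V →ₗ[ZMod p] A' ⊗[ZMod p] V :=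
  LinearMap.rTensor V (φ.toAddMonoidHom.toZModLinearMap p)

@[simp] lemma secMap_tmul (φ : A →+* A') (a : A) (v : V) :
    secMap (p := p) V φ (a ⊗ₜ v) = φ a ⊗ₜ v := rfl

lemma secMap_smul (φ : A →+* A') (a : A) (s : A ⊗[ZMod p] V) :
    secMap V φ (a • s) = φ a • secMap V φ s := by
  induction s with
  | zero => simp
  | tmul b v => simp [TensorProduct.smul_tmul']
  | add x y hx hy => simp [smul_add, hx, hy]

lemma secMap_id (s : A ⊗[ZMod p] V) : secMap V (RingHom.id A) s = s := by
  induction s with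
  | zero => simp
  | tmul b v => simp
  | add x y hx hy => simp [hx, hy]

lemma secMap_comp (φ : A →+* A') (ψ : A' →+* A'') (s : A ⊗[ZMod p] V) :
    secMap V ψ (secMap V φ s) = secMap V (ψ.comp φ) s := by
  induction s with
  | zero => simp
  | tmul b v => simp
  | add x y hx hy => simp [hx, hy]

variable {V}

lemma secMap_baseChange (B : LinearMap.BilinForm (ZMod p) V) (φ : A →+* A')
    (s t : A ⊗[ZMod p] V) :
    B.baseChange A' (secMap V φ s) (secMap V φ t) = φ (B.baseChange A s t) := by
  have hφ : ∀ c : ZMod p, φ (algebraMap (ZMod p) A c) = algebraMap (ZMod p) A' c := fun c =>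
    RingHom.congr_fun (RingHom.ext_zmod (φ.comp (algebraMap (ZMod p) A))
      (algebraMap (ZMod p) A')) c
  induction s with
  | zero => simp
  | add x y hx hy => simp [hx, hy]
  | tmul a v =>
    induction t with
    | zero => simp
    | add x y hx hy => rw [map_add, map_add, map_add, hx, hy, map_add]
    | tmul b w => simp [Algebra.smul_def, hφ]

/-- A basis of `A ⊗ V` induces a basis of `A' ⊗ V`. -/
lemma exists_basis_secMap (φ : A →+* A') {ι : Type} (b : Module.Basis ι A (A ⊗[ZMod p] V)) :
    ∃ b' : Module.Basis ι A' (A' ⊗[ZMod p] V), (∀ i, b' i = secMap V φ (b i)) ∧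
      ∀ s i, b'.repr (secMap V φ s) i = φ (b.repr s i) := by
  let := φ.toAlgebra
  have : IsScalarTower (ZMod p) A A' := IsScalarTower.of_algebraMap_eq' (RingHom.ext_zmod _ _)
  have key : ∀ s : A ⊗[ZMod p] V,
      TensorProduct.AlgebraTensorModule.cancelBaseChange (ZMod p) A A' A' V (1 ⊗ₜ[A] s) =
        secMap V φ s := by
    intro s
    induction s with
    | zero => simp
    | add x y hx hy => rw [TensorProduct.tmul_add, map_add, map_add, hx, hy]
    | tmul a v =>
      rw [TensorProduct.AlgebraTensorModule.cancelBaseChange_tmul, secMap_tmul]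
      congr 1
      rw [Algebra.smul_def, mul_one]
      rfl
  refine ⟨(b.baseChange A').map
    (TensorProduct.AlgebraTensorModule.cancelBaseChange (ZMod p) A A' A' V), ?_, ?_⟩
  · intro i
    rw [Module.Basis.map_apply, Module.Basis.baseChange_apply, key]
  · intro s i
    rw [← key]
    rw [Module.Basis.map_repr, LinearEquiv.trans_apply, LinearEquiv.symm_apply_apply,
      Module.Basis.baseChange_repr_tmul, Algebra.smul_def, mul_one]
    rfl

lemma mem_span_inl_iff {m n : ℕ} (b : Module.Basis (Fin m ⊕ Fin n) A (A ⊗[ZMod p] V))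
    (s : A ⊗[ZMod p] V) :
    s ∈ Submodule.span A (Set.range fun i => b (Sum.inl i)) ↔ ∀ j, b.repr s (Sum.inr j) = 0 := by
  have : (Set.range fun i => b (Sum.inl i)) = b '' Set.range Sum.inl := by
    rw [← Set.range_comp]; rfl
  rw [this, Module.Basis.mem_span_image]
  constructor
  · intro h j
    by_contra hj
    obtain ⟨i, hi⟩ := h (Finsupp.mem_support_iff.2 hj)
    cases hi
  · rintro h (i | j) hx
    · exact ⟨i, rfl⟩
    · exact absurd (h j) (Finsupp.mem_support_iff.1 hx)

/-- The `p`-power map of an `𝔽_p`-algebra. -/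
def frobHom (p : ℕ) [Fact p.Prime] (A : Type u) [CommRing A] [Algebra (ZMod p) A] : A →+* A where
  toFun a := a ^ p
  map_one' := one_pow p
  map_mul' a b := mul_pow a b p
  map_zero' := zero_pow (Fact.out : p.Prime).ne_zero
  map_add' a b := by
    obtain _ | _ := subsingleton_or_nontrivial A
    · exact Subsingleton.elim _ _
    · have : CharP A p := charP_of_injective_algebraMap (algebraMap (ZMod p) A).injective p
      exact add_pow_char a b p

@[simp] lemma frobHom_apply (a : A) : frobHom p A a = a ^ p := rfl

end Scalars

/-! ### Schemes over a field `k` of characteristic `p` -/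

section Schemes

variable {p : ℕ} [Fact p.Prime] {k : Type u} [Field k] [Algebra (ZMod p) k]

/-- The category of `k`-schemes. -/
abbrev SchemeOver (k : Type u) [Field k] : Type (u + 1) := Over (Spec (CommRingCat.of k))

/-- The structure map `k → Γ(X, U)`. -/
def structMap (X : SchemeOver k) (U : X.left.Opens) : k →+* Γ(X.left, U) :=
  ((Scheme.ΓSpecIso (CommRingCat.of k)).inv ≫ X.hom.appTop ≫
    X.left.presheaf.map (homOfLE (le_top : U ≤ ⊤)).op).hom

instance algebraSections (X : SchemeOver k) (U : X.left.Opens) : Algebra k Γ(X.left, U) :=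
  (structMap X U).toAlgebra

instance zmodAlgebraSections (X : SchemeOver k) (U : X.left.Opens) :
    Algebra (ZMod p) Γ(X.left, U) :=
  ((structMap X U).comp (algebraMap (ZMod p) k)).toAlgebra

lemma structMap_res (X : SchemeOver k) {U W : X.left.Opens} (h : W ≤ U) (c : k) :
    (X.left.presheaf.map (homOfLE h).op).hom (algebraMap k Γ(X.left, U) c) =
      algebraMap k Γ(X.left, W) c := by
  change (X.left.presheaf.map (homOfLE h).op).hom (structMap X U c) = structMap X W c
  simp only [structMap]
  rw [← CommRingCat.comp_apply]
  simp only [Category.assoc, ← Functor.map_comp]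
  rfl

variable (p) in
/-- The absolute Frobenius, as a morphism of presheafed spaces: the identity on the underlying
space and `a ↦ a ^ p` on functions. -/
def frobAux (X : SchemeOver k) : X.left.toPresheafedSpace.Hom X.left.toPresheafedSpace where
  base := 𝟙 _
  c := { app := fun U => CommRingCat.ofHom (frobHom p Γ(X.left, U.unop))
         naturality := by
          intro U W i
          ext a
          change (X.left.presheaf.map i a) ^ p = X.left.presheaf.map i (a ^ p)
          rw [map_pow] }

variable (p) in
/-- The absolute `p`-power Frobenius `X → X`: the identity on the underlying space and
`a ↦ a ^ p` on functions. -/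
def frob (X : SchemeOver k) : X.left ⟶ X.left where
  toHom := frobAux p X
  prop x := by
    refine ⟨fun a ha => ?_⟩
    obtain ⟨U, hx, s, rfl⟩ := TopCat.Presheaf.exists_germ_eq _ a
    have key : ((frobAux p X).stalkMap x).hom
        (TopCat.Presheaf.germ X.left.presheaf U x hx s) =
        (TopCat.Presheaf.germ X.left.presheaf U x hx s) ^ p := by
      refine (PresheafedSpace.stalkMap_germ_apply _ U x hx s).trans ?_
      exact map_pow (TopCat.Presheaf.germ X.left.presheaf U x hx).hom s p
    have ha' : IsUnit ((TopCat.Presheaf.germ X.left.presheaf U x hx s) ^ p) := key ▸ ha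
    exact (isUnit_pow_iff (Fact.out : p.Prime).ne_zero).1 ha'

lemma frob_app (X : SchemeOver k) (U : X.left.Opens) (a : Γ(X.left, U)) :
    ((frob p X).app U).hom a = a ^ p := rfl

/-- The absolute Frobenius commutes with all morphisms of schemes. -/
lemma frob_comp {X Y : SchemeOver k} (f : X.left ⟶ Y.left) :
    frob p X ≫ f = f ≫ frob p Y := by
  refine Scheme.Hom.ext ?_ ?_
  · rfl
  · intro U
    ext a
    have h : X.left.presheaf.map (eqToHom (rfl : f ⁻¹ᵁ U = f ⁻¹ᵁ U)).op = 𝟙 _ :=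
      X.left.presheaf.map_id _
    change (X.left.presheaf.map (eqToHom (rfl : f ⁻¹ᵁ U = f ⁻¹ᵁ U)).op).hom
      ((f.app U).hom a ^ p) = (f.app U).hom (a ^ p)
    rw [h, map_pow, map_pow]
    rfl

end Schemes

/-- A function that vanishes locally vanishes. -/
lemma eq_zero_of_local {X : Scheme.{u}} {U : X.Opens} (a : Γ(X, U))
    (h : ∀ x ∈ U, ∃ (W : X.Opens) (hW : W ≤ U), x ∈ W ∧
      (X.presheaf.map (homOfLE hW).op).hom a = 0) : a = 0 := by
  choose! W hW hx hz using h
  refine X.sheaf.eq_of_locally_eq' (fun x : U => W x.1) U (fun x => homOfLE (hW x.1 x.2))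
    (fun x hxU => ?_) a 0 fun x => ?_
  · exact Opens.mem_iSup.2 ⟨⟨x, hxU⟩, hx x hxU⟩
  · rw [map_zero]
    exact hz x.1 x.2

/-! ### Subsheaves of `V ⊗ 𝒪_X` -/

section Subsheaves

variable {p : ℕ} [Fact p.Prime] {k : Type u} [Field k] [Algebra (ZMod p) k]
variable (V : Type u) [AddCommGroup V] [Module (ZMod p) V]

variable (p) in
/-- The sections over `U` of the vector bundle `V ⊗ 𝒪_X`. -/
abbrev Sec (X : SchemeOver k) (U : X.left.Opens) : Type u := Γ(X.left, U) ⊗[ZMod p] V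

/-- Restriction of sections of `V ⊗ 𝒪_X`. -/
def res (X : SchemeOver k) {U W : X.left.Opens} (h : W ≤ U) : Sec p V X U →ₗ[ZMod p] Sec p V X W :=
  secMap V (X.left.presheaf.map (homOfLE h).op).hom

variable {V}

@[simp] lemma res_self (X : SchemeOver k) {U : X.left.Opens} (h : U ≤ U) (s : Sec p V X U) :
    res V X h s = s := by
  have : X.left.presheaf.map (homOfLE h).op = 𝟙 _ := X.left.presheaf.map_id _
  rw [res, this]
  exact secMap_id V s

@[simp] lemma res_res (X : SchemeOver k) {U W Z : X.left.Opens} (h : W ≤ U) (h' : Z ≤ W)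
    (s : Sec p V X U) : res V X h' (res V X h s) = res V X (h'.trans h) s := by
  rw [res, res, secMap_comp, ← CommRingCat.hom_comp, ← Functor.map_comp]
  rfl

lemma res_smul (X : SchemeOver k) {U W : X.left.Opens} (h : W ≤ U) (a : Γ(X.left, U))
    (s : Sec p V X U) :
    res V X h (a • s) = (X.left.presheaf.map (homOfLE h).op).hom a • res V X h s :=
  secMap_smul V _ a s

/-- Pull-back of sections of `V ⊗ 𝒪` along a morphism of schemes. -/
def pb {X Y : SchemeOver k} (f : X.left ⟶ Y.left) (U : Y.left.Opens) :
    Sec p V Y U →ₗ[ZMod p] Sec p V X (f ⁻¹ᵁ U) :=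
  secMap V (f.app U).hom

lemma pb_smul {X Y : SchemeOver k} (f : X.left ⟶ Y.left) (U : Y.left.Opens) (a : Γ(Y.left, U))
    (s : Sec p V Y U) : pb f U (a • s) = (f.app U).hom a • pb f U s :=
  secMap_smul V _ a s

lemma pb_res {X Y : SchemeOver k} (f : X.left ⟶ Y.left) {U W : Y.left.Opens} (h : W ≤ U)
    (s : Sec p V Y U) :
    pb f W (res V Y h s) = res V X (f.preimage_mono h) (pb f U s) := by
  rw [res, res, pb, pb, secMap_comp, secMap_comp, ← CommRingCat.hom_comp, ← CommRingCat.hom_comp,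
    f.naturality]
  rfl

variable (p V) in
/-- A subsheaf of `𝒪_X`-modules of `V ⊗ 𝒪_X`. -/
@[ext] structure Subsheaf (X : SchemeOver k) where
  /-- the sections over an open subset -/
  obj : ∀ U : X.left.Opens, Submodule Γ(X.left, U) (Sec p V X U)
  res_mem : ∀ {U W : X.left.Opens} (h : W ≤ U) {s : Sec p V X U}, s ∈ obj U → res V X h s ∈ obj W
  local_mem : ∀ {U : X.left.Opens} (s : Sec p V X U),
    (∀ x ∈ U, ∃ (W : X.left.Opens) (h : W ≤ U), x ∈ W ∧ res V X h s ∈ obj W) → s ∈ obj U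

namespace Subsheaf

variable {X Y Z : SchemeOver k}

instance : PartialOrder (Subsheaf p V X) :=
  PartialOrder.lift Subsheaf.obj fun _ _ h => Subsheaf.ext h

lemma le_iff {L M : Subsheaf p V X} : L ≤ M ↔ ∀ U, L.obj U ≤ M.obj U := Iff.rfl

instance : InfSet (Subsheaf p V X) where
  sInf S :=
    { obj := fun U => ⨅ L ∈ S, L.obj U
      res_mem := by
        intro U W h s hs
        simp only [Submodule.mem_iInf] at hs ⊢
        exact fun L hL => L.res_mem h (hs L hL)
      local_mem := by
        intro U s hs
        simp only [Submodule.mem_iInf] at hs ⊢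
        intro L hL
        refine L.local_mem s fun x hx => ?_
        obtain ⟨W, h, hxW, hW⟩ := hs x hx
        exact ⟨W, h, hxW, hW L hL⟩ }

/-- The subsheaves of `V ⊗ 𝒪_X` form a complete lattice. The largest element `⊤` is `V ⊗ 𝒪_X`,
and `L ⊔ M` is the sum `L + M` of subsheaves, the smallest subsheaf that contains both. -/
instance : CompleteLattice (Subsheaf p V X) :=
  completeLatticeOfInf _ fun S => by
    refine ⟨fun L hL U => iInf₂_le L hL, fun L hL U => le_iInf₂ fun M hM => hL hM U⟩

/-- The sections of `V ⊗ 𝒪_Y` whose pull-back along `f : X → Y` lies in `M`. -/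
def push (f : X.left ⟶ Y.left) (M : Subsheaf p V X) : Subsheaf p V Y where
  obj U :=
    { carrier := {s | pb f U s ∈ M.obj (f ⁻¹ᵁ U)}
      add_mem' := by
        intro a b ha hb
        simp only [Set.mem_ofPred_eq, map_add] at ha hb ⊢
        exact add_mem ha hb
      zero_mem' := by simp
      smul_mem' := by
        intro c s hs
        simp only [Set.mem_ofPred_eq, pb_smul] at hs ⊢
        exact Submodule.smul_mem _ _ hs }
  res_mem := by
    intro U W h s hs
    change pb f W _ ∈ M.obj _
    rw [pb_res]
    exact M.res_mem _ hs
  local_mem := by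
    intro U s hs
    refine M.local_mem _ fun x hx => ?_
    obtain ⟨W, h, hxW, hW⟩ := hs (f x) hx
    refine ⟨f ⁻¹ᵁ W, f.preimage_mono h, hxW, ?_⟩
    rw [← pb_res]
    exact hW

lemma mem_push (f : X.left ⟶ Y.left) (M : Subsheaf p V X) {U : Y.left.Opens} (s : Sec p V Y U) :
    s ∈ (M.push f).obj U ↔ pb f U s ∈ M.obj (f ⁻¹ᵁ U) := Iff.rfl

/-- The pull-back `f^* L ⊆ V ⊗ 𝒪_X` of a subsheaf `L ⊆ V ⊗ 𝒪_Y` along `f : X → Y` (more precisely,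
the image of `f^* L` in `f^* (V ⊗ 𝒪_Y) = V ⊗ 𝒪_X`): the subsheaf of `𝒪_X`-modules generated by the
pull-backs of the sections of `L`. -/
def pull (f : X.left ⟶ Y.left) (L : Subsheaf p V Y) : Subsheaf p V X :=
  sInf {M | ∀ (U : Y.left.Opens) (s : Sec p V Y U), s ∈ L.obj U → pb f U s ∈ M.obj (f ⁻¹ᵁ U)}

lemma gc (f : X.left ⟶ Y.left) :
    GaloisConnection (pull (p := p) (V := V) f) (push f) := by
  intro L M
  refine ⟨fun h U s hs => ?_, fun h => sInf_le h⟩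
  refine h _ ?_
  simp only [pull, sInf, Submodule.mem_iInf]
  exact fun N hN => hN U s hs

lemma pb_mem_pull (f : X.left ⟶ Y.left) (L : Subsheaf p V Y) {U : Y.left.Opens}
    {s : Sec p V Y U} (hs : s ∈ L.obj U) : pb f U s ∈ (L.pull f).obj (f ⁻¹ᵁ U) :=
  (gc f).le_u_l L U hs

lemma push_id (M : Subsheaf p V X) : M.push (𝟙 X.left) = M := by
  ext U s
  rw [mem_push]
  have : pb (𝟙 X.left) U s = s := secMap_id V s
  rw [this]
  rfl

lemma push_comp (f : X.left ⟶ Y.left) (g : Y.left ⟶ Z.left) (M : Subsheaf p V X) :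
    M.push (f ≫ g) = (M.push f).push g := by
  ext U s
  rw [mem_push, mem_push, mem_push]
  have : pb f _ (pb g U s) = pb (f ≫ g) U s := by
    rw [pb, pb, pb, secMap_comp, ← CommRingCat.hom_comp, Scheme.Hom.comp_app]
    rfl
  rw [this]
  rfl

lemma pull_id (L : Subsheaf p V X) : L.pull (𝟙 X.left) = L := by
  refine le_antisymm ((gc _).l_le ?_) ?_
  · rw [push_id]
  · have := (gc (𝟙 X.left)).le_u_l L
    rwa [push_id] at this

lemma pull_comp (f : X.left ⟶ Y.left) (g : Y.left ⟶ Z.left) (L : Subsheaf p V Z) :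
    L.pull (f ≫ g) = (L.pull g).pull f := by
  refine eq_of_forall_ge_iff fun M => ?_
  rw [(gc _) _ _, (gc _) _ _, (gc _) _ _, push_comp]

lemma pull_mono (f : X.left ⟶ Y.left) {L M : Subsheaf p V Y} (h : L ≤ M) :
    L.pull f ≤ M.pull f := (gc f).monotone_l h

lemma pull_sup (f : X.left ⟶ Y.left) (L M : Subsheaf p V Y) :
    (L ⊔ M).pull f = L.pull f ⊔ M.pull f := (gc f).l_sup

/-- The pull-back `Frob^* L ⊆ V ⊗ 𝒪_X` of `L ⊆ V ⊗ 𝒪_X` by the absolute Frobenius of `X`. -/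
def frobPull (L : Subsheaf p V X) : Subsheaf p V X := L.pull (frob p X)

lemma frobPull_pull (f : X.left ⟶ Y.left) (L : Subsheaf p V Y) :
    (L.pull f).frobPull = L.frobPull.pull f := by
  rw [frobPull, frobPull, ← pull_comp, ← pull_comp, frob_comp]

/-- Over the open subset `U`, the subsheaf `L` is spanned by the first `r` members of a basis of
`V ⊗ 𝒪_X`: it is a direct summand, free of rank `r`, with a free complement. -/
def SplitOn (L : Subsheaf p V X) (U : X.left.Opens) (r : ℕ) : Prop :=
  ∃ (m : ℕ) (b : Module.Basis (Fin r ⊕ Fin m) Γ(X.left, U) (Sec p V X U)),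
    ∀ (W : X.left.Opens) (h : W ≤ U),
      L.obj W = Submodule.span Γ(X.left, W) (Set.range fun i => res V X h (b (Sum.inl i)))

/-- `L` is locally a direct summand of `V ⊗ 𝒪_X`, of rank `r`. -/
def IsSummandOfRank (L : Subsheaf p V X) (r : ℕ) : Prop :=
  ∀ x : X.left, ∃ U : X.left.Opens, x ∈ U ∧ L.SplitOn U r

/-- `L` is locally a direct summand of `V ⊗ 𝒪_X` (of a locally constant rank). -/
def IsSummand (L : Subsheaf p V X) : Prop :=
  ∀ x : X.left, ∃ U : X.left.Opens, x ∈ U ∧ ∃ r : ℕ, L.SplitOn U r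

/-- `L` is totally isotropic for the `𝒪_X`-bilinear extension of `B` to `V ⊗ 𝒪_X`. -/
def IsIsotropic (B : LinearMap.BilinForm (ZMod p) V) (L : Subsheaf p V X) : Prop :=
  ∀ (U : X.left.Opens), ∀ s ∈ L.obj U, ∀ t ∈ L.obj U, B.baseChange Γ(X.left, U) s t = 0

/-- An auxiliary subsheaf: the sections that are orthogonal to a given family of sections. -/
def orth (B : LinearMap.BilinForm (ZMod p) V) (P : ∀ U : X.left.Opens, Sec p V X U → Prop) :
    Subsheaf p V X where
  obj U :=
    { carrier := {s | ∀ (U' : X.left.Opens) (t : Sec p V X U'), P U' t →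
        ∀ (W : X.left.Opens) (h : W ≤ U) (h' : W ≤ U'),
          B.baseChange Γ(X.left, W) (res V X h s) (res V X h' t) = 0 ∧
          B.baseChange Γ(X.left, W) (res V X h' t) (res V X h s) = 0}
      add_mem' := by
        intro a b ha hb U' t ht W h h'
        simp [(ha U' t ht W h h').1, (ha U' t ht W h h').2, (hb U' t ht W h h').1,
          (hb U' t ht W h h').2]
      zero_mem' := by
        intro U' t ht W h h'
        simp
      smul_mem' := by
        intro c s hs U' t ht W h h'
        simp [res_smul, (hs U' t ht W h h').1, (hs U' t ht W h h').2] }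
  res_mem := by
    intro U W h s hs U' t ht W' h₁ h₂
    rw [res_res]
    exact hs U' t ht W' _ h₂
  local_mem := by
    intro U s hs U' t ht W h h'
    have key : ∀ x ∈ W, ∃ (Z : X.left.Opens) (hZ : Z ≤ W), x ∈ Z ∧
        B.baseChange Γ(X.left, Z) (res V X hZ (res V X h s)) (res V X hZ (res V X h' t)) = 0 ∧
        B.baseChange Γ(X.left, Z) (res V X hZ (res V X h' t)) (res V X hZ (res V X h s)) = 0 := by
      intro x hx
      obtain ⟨Z, hZ, hxZ, hsZ⟩ := hs x (h hx)
      refine ⟨W ⊓ Z, inf_le_left, ⟨hx, hxZ⟩, ?_⟩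
      have := hsZ U' t ht (W ⊓ Z) inf_le_right (inf_le_left.trans h')
      simpa using this
    constructor
    · refine eq_zero_of_local _ fun x hx => ?_
      obtain ⟨Z, hZ, hxZ, h₁, h₂⟩ := key x hx
      refine ⟨Z, hZ, hxZ, ?_⟩
      rw [← h₁]
      exact (secMap_baseChange B _ _ _).symm
    · refine eq_zero_of_local _ fun x hx => ?_
      obtain ⟨Z, hZ, hxZ, h₁, h₂⟩ := key x hx
      refine ⟨Z, hZ, hxZ, ?_⟩
      rw [← h₂]
      exact (secMap_baseChange B _ _ _).symm

lemma res_pb_pairing {B : LinearMap.BilinForm (ZMod p) V} {L : Subsheaf p V Y}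
    (hL : L.IsIsotropic B) (f : X.left ⟶ Y.left) {U U' : Y.left.Opens} {s : Sec p V Y U}
    {t : Sec p V Y U'} (hs : s ∈ L.obj U) (ht : t ∈ L.obj U') {W : X.left.Opens}
    (h : W ≤ f ⁻¹ᵁ U) (h' : W ≤ f ⁻¹ᵁ U') :
    B.baseChange Γ(X.left, W) (res V X h (pb f U s)) (res V X h' (pb f U' t)) = 0 := by
  have hW : W ≤ f ⁻¹ᵁ (U ⊓ U') := le_inf h h'
  have h₁ : res V X h (pb f U s) = res V X hW (pb f _ (res V Y inf_le_left s)) := by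
    rw [pb_res, res_res]
  have h₂ : res V X h' (pb f U' t) = res V X hW (pb f _ (res V Y inf_le_right t)) := by
    rw [pb_res, res_res]
  rw [h₁, h₂, res, secMap_baseChange, pb, secMap_baseChange,
    hL _ _ (L.res_mem _ hs) _ (L.res_mem _ ht), map_zero, map_zero]

lemma IsIsotropic.pull {B : LinearMap.BilinForm (ZMod p) V} {L : Subsheaf p V Y}
    (hL : L.IsIsotropic B) (f : X.left ⟶ Y.left) : (L.pull f).IsIsotropic B := by
  have h₁ : L.pull f ≤ orth B fun U' t =>
      ∃ (U : Y.left.Opens) (hU : U' = f ⁻¹ᵁ U), ∃ l ∈ L.obj U, t = res V X hU.le (pb f U l) := by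
    refine (gc f _ _).2 ?_
    rintro U s hs U' t ⟨U₁, rfl, l, hl, rfl⟩ W h h'
    rw [res_res]
    exact ⟨res_pb_pairing hL f hs hl _ _, res_pb_pairing hL f hl hs _ _⟩
  have h₂ : L.pull f ≤ orth B fun U' t => t ∈ (L.pull f).obj U' := by
    refine (gc f _ _).2 ?_
    intro U s hs U' t ht W h h'
    have := h₁ U' ht (f ⁻¹ᵁ U) (pb f U s) ⟨U, rfl, s, hs, by simp⟩ W h' h
    exact this.symm
  intro U s hs t ht
  simpa using (h₂ U hs U t ht U le_rfl le_rfl).1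

/-- An auxiliary subsheaf: the sections whose restriction to the open subset `D` lies in the span
of the first members of a basis over `D`. -/
def spanOn {D : X.left.Opens} {m n : ℕ}
    (b : Module.Basis (Fin m ⊕ Fin n) Γ(X.left, D) (Sec p V X D)) : Subsheaf p V X where
  obj U :=
    { carrier := {s | ∀ (W : X.left.Opens) (h : W ≤ U) (h' : W ≤ D),
        res V X h s ∈ Submodule.span Γ(X.left, W) (Set.range fun i => res V X h' (b (Sum.inl i)))}
      add_mem' := by
        intro a c ha hc W h h'
        rw [map_add]
        exact add_mem (ha W h h') (hc W h h')
      zero_mem' := by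
        intro W h h'
        simp
      smul_mem' := by
        intro c s hs W h h'
        rw [res_smul]
        exact Submodule.smul_mem _ _ (hs W h h') }
  res_mem := by
    intro U W h s hs W' h₁ h₂
    rw [res_res]
    exact hs W' _ h₂
  local_mem := by
    intro U s hs W h h'
    obtain ⟨b', hb', hr⟩ := exists_basis_secMap (X.left.presheaf.map (homOfLE h').op).hom b
    have e : (fun i => res V X h' (b (Sum.inl i))) = fun i => b' (Sum.inl i) := by
      funext i; rw [hb']; rfl
    rw [e, mem_span_inl_iff]
    intro j
    refine eq_zero_of_local _ fun x hx => ?_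
    obtain ⟨Z, hZ, hxZ, hsZ⟩ := hs x (h hx)
    refine ⟨W ⊓ Z, inf_le_left, ⟨hx, hxZ⟩, ?_⟩
    have h₁ := hsZ (W ⊓ Z) inf_le_right (inf_le_left.trans h')
    obtain ⟨b'', hb'', hr'⟩ := exists_basis_secMap
      (X.left.presheaf.map (homOfLE (inf_le_left : W ⊓ Z ≤ W)).op).hom b'
    have e' : (fun i => res V X (inf_le_left.trans h' : W ⊓ Z ≤ D) (b (Sum.inl i))) =
        fun i => b'' (Sum.inl i) := by
      funext i
      rw [hb'', hb', ← res_res X h' inf_le_left]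
      rfl
    rw [e', mem_span_inl_iff] at h₁
    rw [← hr', ← h₁ j, res_res, ← res_res X h inf_le_left]
    rfl

lemma SplitOn.pull {L : Subsheaf p V Y} {U : Y.left.Opens} {r : ℕ} (hL : L.SplitOn U r)
    (f : X.left ⟶ Y.left) : (L.pull f).SplitOn (f ⁻¹ᵁ U) r := by
  obtain ⟨m, b, hb⟩ := hL
  obtain ⟨b', hb', -⟩ := exists_basis_secMap (f.app U).hom b
  have hb'' : ∀ i, b' i = pb f U (b i) := hb'
  refine ⟨m, b', fun W h => le_antisymm ?_ ?_⟩
  · have : L.pull f ≤ spanOn b' := by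
      refine (gc f _ _).2 ?_
      intro U' s hs W h h'
      have h₁ := L.res_mem (inf_le_right : U ⊓ U' ≤ U') hs
      rw [hb _ inf_le_left] at h₁
      have hW : W ≤ f ⁻¹ᵁ (U ⊓ U') := le_inf h' h
      have e : res V X h (pb f U' s) = res V X hW (pb f _ (res V Y inf_le_right s)) := by
        rw [pb_res, res_res]
      rw [e]
      generalize res V Y inf_le_right s = s' at h₁
      induction h₁ using Submodule.span_induction with
      | mem x hx =>
        obtain ⟨i, rfl⟩ := hx
        refine Submodule.subset_span ⟨i, ?_⟩
        simp only [hb'']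
        rw [pb_res, res_res]
      | zero => simp
      | add x y _ _ hx hy =>
        rw [map_add, map_add]
        exact add_mem hx hy
      | smul a x _ hx =>
        rw [pb_smul, res_smul]
        exact Submodule.smul_mem _ _ hx
    intro s hs
    have := this W hs W le_rfl h
    rwa [res_self] at this
  · rw [Submodule.span_le]
    rintro _ ⟨i, rfl⟩
    refine (L.pull f).res_mem h ?_
    rw [hb'']
    refine pb_mem_pull f L ?_
    rw [hb U le_rfl]
    exact Submodule.subset_span ⟨i, by simp⟩

lemma IsSummandOfRank.pull {L : Subsheaf p V Y} {r : ℕ} (hL : L.IsSummandOfRank r)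
    (f : X.left ⟶ Y.left) : (L.pull f).IsSummandOfRank r := by
  intro x
  obtain ⟨U, hU, h⟩ := hL (f x)
  exact ⟨f ⁻¹ᵁ U, hU, h.pull f⟩

lemma IsSummand.pull {L : Subsheaf p V Y} (hL : L.IsSummand)
    (f : X.left ⟶ Y.left) : (L.pull f).IsSummand := by
  intro x
  obtain ⟨U, hU, r, h⟩ := hL (f x)
  exact ⟨f ⁻¹ᵁ U, hU, r, h.pull f⟩

end Subsheaf

end Subsheaves

/-! ### Sheaves of modules from explicit data -/

section ModData

/-- A sheaf of `𝒪_X`-modules, given by its sections, its restriction maps, and the sheaf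
condition. -/
structure ModData (X : Scheme.{u}) where
  /-- the sections over an open subset -/
  obj : X.Opens → Type u
  [grp : ∀ U, AddCommGroup (obj U)]
  [mod : ∀ U, Module Γ(X, U) (obj U)]
  /-- the restriction maps -/
  res : ∀ {U W : X.Opens}, W ≤ U → (obj U →+ obj W)
  res_self : ∀ {U : X.Opens} (h : U ≤ U) (s : obj U), res h s = s
  res_res : ∀ {U W Z : X.Opens} (h : W ≤ U) (h' : Z ≤ W) (s : obj U),
    res h' (res h s) = res (h'.trans h) s
  res_smul : ∀ {U W : X.Opens} (h : W ≤ U) (a : Γ(X, U)) (s : obj U),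
    res h (a • s) = (X.presheaf.map (homOfLE h).op).hom a • res h s
  sep : ∀ {U : X.Opens} (s : obj U),
    (∀ x ∈ U, ∃ (W : X.Opens) (h : W ≤ U), x ∈ W ∧ res h s = 0) → s = 0
  glue : ∀ {ι : Type u} (U : ι → X.Opens) (s : ∀ i, obj (U i)),
    (∀ i j, res (inf_le_left : U i ⊓ U j ≤ U i) (s i) = res (inf_le_right : U i ⊓ U j ≤ U j) (s j)) →
    ∃ t : obj (iSup U), ∀ i, res (le_iSup U i) t = s i

attribute [instance] ModData.grp ModData.mod

namespace ModData

variable {X : Scheme.{u}} (M N : ModData X)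

instance (U : X.Opensᵒᵖ) : Module (X.ringCatSheaf.obj.obj U) (M.obj U.unop) := M.mod U.unop

/-- The presheaf of modules underlying `ModData`. -/
def toPresheafOfModules : X.PresheafOfModules where
  obj U := ModuleCat.of (X.ringCatSheaf.obj.obj U) (M.obj U.unop)
  map {U W} i := ModuleCat.semilinearMapAddEquiv _ _ _
    { toFun := M.res i.unop.le
      map_add' := map_add _
      map_smul' := fun a s => M.res_smul i.unop.le a s }
  map_id U := by
    ext s
    exact M.res_self _ s
  map_comp {U W Z} i j := by
    ext s
    exact (M.res_res _ _ s).symm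

/-- The sheaf of `𝒪_X`-modules given by `ModData`. -/
def toModules : X.Modules where
  val := M.toPresheafOfModules
  isSheaf := by
    change TopCat.Presheaf.IsSheaf (X := X.toTopCat) M.toPresheafOfModules.presheaf
    rw [TopCat.Presheaf.isSheaf_iff_isSheafUniqueGluing]
    intro ι U s hs
    obtain ⟨t, ht⟩ := M.glue U s hs
    refine ⟨t, ht, fun t' ht' => ?_⟩
    let t₁ : M.obj (iSup U) := t'
    have : t₁ - t = 0 := by
      refine M.sep _ fun x hx => ?_
      obtain ⟨i, hi⟩ := Opens.mem_iSup.1 hx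
      refine ⟨U i, le_iSup U i, hi, ?_⟩
      rw [map_sub, sub_eq_zero]
      exact (ht' i).trans (ht i).symm
    exact sub_eq_zero.1 this

variable {M N} in
/-- A morphism of sheaves of modules from explicit data. -/
def homMk (φ : ∀ U : X.Opens, M.obj U →ₗ[Γ(X, U)] N.obj U)
    (hφ : ∀ {U W : X.Opens} (h : W ≤ U) (s : M.obj U), φ W (M.res h s) = N.res h (φ U s)) :
    M.toModules ⟶ N.toModules :=
  SheafOfModules.Hom.mk
    { app := fun U => ModuleCat.ofHom (X := M.obj U.unop) (Y := N.obj U.unop) (φ U.unop)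
      naturality := fun {U W} i => by
        ext s
        exact hφ i.unop.le s }

end ModData

/-! ### The sheaf of homomorphisms and the tangent sheaf -/

section SheafHom

variable {X : Scheme.{u}}

/-- Restriction of sections of a sheaf of modules. -/
def mres (M : X.Modules) {U W : X.Opens} (h : W ≤ U) : Γ(M, U) →+ Γ(M, W) :=
  (M.presheaf.map (homOfLE h).op).hom

lemma mres_self (M : X.Modules) {U : X.Opens} (h : U ≤ U) (s : Γ(M, U)) : mres M h s = s := by
  have : M.presheaf.map (homOfLE h).op = 𝟙 _ := M.presheaf.map_id _
  rw [mres, this]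
  rfl

lemma mres_res (M : X.Modules) {U W Z : X.Opens} (h : W ≤ U) (h' : Z ≤ W) (s : Γ(M, U)) :
    mres M h' (mres M h s) = mres M (h'.trans h) s := by
  change (M.presheaf.map (homOfLE h).op ≫ M.presheaf.map (homOfLE h').op).hom s = _
  rw [← Functor.map_comp]
  rfl

lemma mres_smul (M : X.Modules) {U W : X.Opens} (h : W ≤ U) (a : Γ(X, U)) (s : Γ(M, U)) :
    mres M h (a • s) = (X.presheaf.map (homOfLE h).op).hom a • mres M h s :=
  Scheme.Modules.map_smul M (homOfLE h) a s

lemma mres_sep (M : X.Modules) {U : X.Opens} (s t : Γ(M, U))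
    (h : ∀ x ∈ U, ∃ (W : X.Opens) (hW : W ≤ U), x ∈ W ∧ mres M hW s = mres M hW t) : s = t := by
  choose! W hW hx hz using h
  refine TopCat.Sheaf.eq_of_locally_eq' ⟨M.presheaf, M.isSheaf⟩ (fun x : U => W x.1) U
    (fun x => homOfLE (hW x.1 x.2)) (fun x hxU => ?_) s t fun x => ?_
  · exact Opens.mem_iSup.2 ⟨⟨x, hxU⟩, hx x hxU⟩
  · exact hz x.1 x.2

lemma mres_glue (M : X.Modules) {ι : Type u} (U : ι → X.Opens) (s : ∀ i, Γ(M, U i))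
    (hs : ∀ i j, mres M (inf_le_left : U i ⊓ U j ≤ U i) (s i) =
      mres M (inf_le_right : U i ⊓ U j ≤ U j) (s j)) :
    ∃ t : Γ(M, iSup U), ∀ i, mres M (le_iSup U i) t = s i := by
  obtain ⟨t, ht, -⟩ := TopCat.Sheaf.existsUnique_gluing ⟨M.presheaf, M.isSheaf⟩ U s hs
  exact ⟨t, ht⟩

/-- Restriction of functions. -/
def ores (X : Scheme.{u}) {U W : X.Opens} (h : W ≤ U) : Γ(X, U) →+* Γ(X, W) :=
  (X.presheaf.map (homOfLE h).op).hom

lemma ores_self {U : X.Opens} (h : U ≤ U) (s : Γ(X, U)) : ores X h s = s := by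
  have : X.presheaf.map (homOfLE h).op = 𝟙 _ := X.presheaf.map_id _
  rw [ores, this]
  rfl

lemma ores_res {U W Z : X.Opens} (h : W ≤ U) (h' : Z ≤ W) (s : Γ(X, U)) :
    ores X h' (ores X h s) = ores X (h'.trans h) s := by
  change (X.presheaf.map (homOfLE h).op ≫ X.presheaf.map (homOfLE h').op).hom s = _
  rw [← Functor.map_comp]
  rfl

lemma ores_sep {U : X.Opens} (s t : Γ(X, U))
    (h : ∀ x ∈ U, ∃ (W : X.Opens) (hW : W ≤ U), x ∈ W ∧ ores X hW s = ores X hW t) : s = t := by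
  choose! W hW hx hz using h
  refine X.sheaf.eq_of_locally_eq' (fun x : U => W x.1) U
    (fun x => homOfLE (hW x.1 x.2)) (fun x hxU => ?_) s t fun x => ?_
  · exact Opens.mem_iSup.2 ⟨⟨x, hxU⟩, hx x hxU⟩
  · exact hz x.1 x.2

lemma ores_glue {ι : Type u} (U : ι → X.Opens) (s : ∀ i, Γ(X, U i))
    (hs : ∀ i j, ores X (inf_le_left : U i ⊓ U j ≤ U i) (s i) =
      ores X (inf_le_right : U i ⊓ U j ≤ U j) (s j)) :
    ∃ t : Γ(X, iSup U), ∀ i, ores X (le_iSup U i) t = s i := by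
  obtain ⟨t, ht, -⟩ := X.sheaf.existsUnique_gluing U s hs
  exact ⟨t, ht⟩

/-- Gluing of compatible families of maps into a sheaf. -/
lemma glue_maps {A N : X.Opens → Type u}
    (rA : ∀ {U W : X.Opens}, W ≤ U → A U → A W)
    (rA_res : ∀ {U W Z : X.Opens} (h : W ≤ U) (h' : Z ≤ W) (s : A U),
      rA h' (rA h s) = rA (h'.trans h) s)
    (rN : ∀ {U W : X.Opens}, W ≤ U → N U → N W)
    (rN_res : ∀ {U W Z : X.Opens} (h : W ≤ U) (h' : Z ≤ W) (s : N U),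
      rN h' (rN h s) = rN (h'.trans h) s)
    (sepN : ∀ {U : X.Opens} (s t : N U),
      (∀ x ∈ U, ∃ (W : X.Opens) (hW : W ≤ U), x ∈ W ∧ rN hW s = rN hW t) → s = t)
    (glueN : ∀ {ι : Type u} (U : ι → X.Opens) (s : ∀ i, N (U i)),
      (∀ i j, rN (inf_le_left : U i ⊓ U j ≤ U i) (s i) =
        rN (inf_le_right : U i ⊓ U j ≤ U j) (s j)) →
      ∃ t : N (iSup U), ∀ i, rN (le_iSup U i) t = s i)
    {ι : Type u} (U : ι → X.Opens) (φ : ∀ i, ∀ W : {W : X.Opens // W ≤ U i}, A W.1 → N W.1)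
    (hφ : ∀ i (W W' : {W : X.Opens // W ≤ U i}) (h : W'.1 ≤ W.1) (a : A W.1),
      φ i W' (rA h a) = rN h (φ i W a))
    (hφ' : ∀ i j (W : X.Opens) (h : W ≤ U i) (h' : W ≤ U j) (a : A W),
      φ i ⟨W, h⟩ a = φ j ⟨W, h'⟩ a) :
    ∃ ψ : ∀ W : {W : X.Opens // W ≤ iSup U}, A W.1 → N W.1,
      (∀ (W W' : {W : X.Opens // W ≤ iSup U}) (h : W'.1 ≤ W.1) (a : A W.1),
        ψ W' (rA h a) = rN h (ψ W a)) ∧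
      (∀ (W : {W : X.Opens // W ≤ iSup U}) (a : A W.1) (i : ι),
        rN inf_le_left (ψ W a) =
          φ i ⟨W.1 ⊓ U i, inf_le_right⟩ (rA (inf_le_left : W.1 ⊓ U i ≤ W.1) a)) ∧
      (∀ i (W : X.Opens) (h : W ≤ U i) (a : A W), ψ ⟨W, h.trans (le_iSup U i)⟩ a = φ i ⟨W, h⟩ a) := by
  have glue' : ∀ (W : X.Opens) (Z : ι → X.Opens) (hZ : ∀ i, Z i ≤ W) (_ : W ≤ iSup Z)
      (s : ∀ i, N (Z i)), (∀ i j, rN (inf_le_left : Z i ⊓ Z j ≤ Z i) (s i) =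
        rN (inf_le_right : Z i ⊓ Z j ≤ Z j) (s j)) → ∃ t : N W, ∀ i, rN (hZ i) t = s i := by
    intro W Z hZ hW s hs
    obtain rfl : W = iSup Z := le_antisymm hW (iSup_le hZ)
    exact glueN Z s hs
  have ex : ∀ (W : {W : X.Opens // W ≤ iSup U}) (a : A W.1), ∃ t : N W.1, ∀ i,
      rN (inf_le_left : W.1 ⊓ U i ≤ W.1) t =
        φ i ⟨W.1 ⊓ U i, inf_le_right⟩ (rA (inf_le_left : W.1 ⊓ U i ≤ W.1) a) := by
    intro W a
    refine glue' W.1 (fun i => W.1 ⊓ U i) (fun i => inf_le_left) ?_ _ fun i j => ?_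
    · intro x hx
      obtain ⟨i, hi⟩ := Opens.mem_iSup.1 (W.2 hx)
      exact Opens.mem_iSup.2 ⟨i, hx, hi⟩
    · rw [← hφ i ⟨_, inf_le_right⟩ ⟨_, inf_le_left.trans inf_le_right⟩ inf_le_left,
        ← hφ j ⟨_, inf_le_right⟩ ⟨_, inf_le_right.trans inf_le_right⟩ inf_le_right,
        rA_res, rA_res]
      exact hφ' _ _ _ _ _ _
  choose ψ hψ using ex
  have cov : ∀ (W : {W : X.Opens // W ≤ iSup U}) (x : X), x ∈ W.1 →
      ∃ i, x ∈ W.1 ⊓ U i := by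
    intro W x hx
    obtain ⟨i, hi⟩ := Opens.mem_iSup.1 (W.2 hx)
    exact ⟨i, hx, hi⟩
  refine ⟨ψ, ?_, hψ, ?_⟩
  · intro W W' h a
    refine sepN _ _ fun x hx => ?_
    obtain ⟨i, hi⟩ := cov W' x hx
    refine ⟨_, inf_le_left, hi, ?_⟩
    rw [hψ, rN_res, rA_res,
      ← rN_res (inf_le_left : W.1 ⊓ U i ≤ W.1) (inf_le_inf_right (U i) h), hψ,
      ← hφ i ⟨_, inf_le_right⟩ ⟨_, inf_le_right⟩ (inf_le_inf_right (U i) h), rA_res]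
  · intro i W h a
    refine sepN _ _ fun x hx => ?_
    refine ⟨W ⊓ U i, inf_le_left, ⟨hx, h hx⟩, ?_⟩
    rw [hψ, hφ i ⟨W, h⟩ ⟨_, inf_le_right⟩]

/-- The homomorphisms `M|_U → N|_U` of sheaves of `𝒪_U`-modules: the families of
`Γ(X, W)`-linear maps `Γ(M, W) → Γ(N, W)`, for `W ⊆ U` open, that commute with restriction. -/
def homOn (M N : X.Modules) (U : X.Opens) :
    AddSubgroup (∀ W : {W : X.Opens // W ≤ U}, Γ(M, W.1) →ₗ[Γ(X, W.1)] Γ(N, W.1)) where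
  carrier := {φ | ∀ (W W' : {W : X.Opens // W ≤ U}) (h : W'.1 ≤ W.1) (s : Γ(M, W.1)),
    φ W' (mres M h s) = mres N h (φ W s)}
  add_mem' := by
    intro φ ψ hφ hψ W W' h s
    simp [hφ W W' h s, hψ W W' h s]
  zero_mem' := by
    intro W W' h s
    simp
  neg_mem' := by
    intro φ hφ W W' h s
    simp [hφ W W' h s]

instance (M N : X.Modules) (U : X.Opens) : Module Γ(X, U) (homOn M N U) where
  smul a φ := ⟨fun W => ores X W.2 a • φ.1 W, by
    intro W W' h s
    simp only [LinearMap.smul_apply]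
    rw [φ.2 W W' h s, ← ores_res W.2 h]
    exact (mres_smul N h _ _).symm⟩
  one_smul φ := by
    ext W s
    change ores X W.2 1 • φ.1 W s = _
    rw [map_one, one_smul]
  mul_smul a b φ := by
    ext W s
    change ores X W.2 (a * b) • φ.1 W s = ores X W.2 a • ores X W.2 b • φ.1 W s
    rw [map_mul, mul_smul]
  smul_zero a := by
    ext W s
    exact smul_zero (ores X W.2 a)
  smul_add a φ ψ := by
    ext W s
    exact smul_add (ores X W.2 a) (φ.1 W s) (ψ.1 W s)
  add_smul a b φ := by
    ext W s
    change ores X W.2 (a + b) • φ.1 W s = ores X W.2 a • φ.1 W s + ores X W.2 b • φ.1 W s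
    rw [map_add, add_smul]
  zero_smul φ := by
    ext W s
    change ores X W.2 0 • φ.1 W s = 0
    rw [map_zero, zero_smul]

/-- Restriction of homomorphisms. -/
def homRes (M N : X.Modules) {U W : X.Opens} (h : W ≤ U) : homOn M N U →+ homOn M N W where
  toFun φ := ⟨fun Z => φ.1 ⟨Z.1, Z.2.trans h⟩,
    fun Z Z' hZ s => φ.2 ⟨Z.1, Z.2.trans h⟩ ⟨Z'.1, Z'.2.trans h⟩ hZ s⟩
  map_zero' := rfl
  map_add' _ _ := rfl

lemma homRes_smul (M N : X.Modules) {U W : X.Opens} (h : W ≤ U) (a : Γ(X, U))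
    (φ : homOn M N U) : homRes M N h (a • φ) = ores X h a • homRes M N h φ := by
  ext Z s
  change ores X (Z.2.trans h) a • φ.1 ⟨Z.1, Z.2.trans h⟩ s =
    ores X Z.2 (ores X h a) • φ.1 ⟨Z.1, Z.2.trans h⟩ s
  rw [ores_res]

lemma hom_sep (M N : X.Modules) {U : X.Opens} (φ : homOn M N U)
    (h : ∀ x ∈ U, ∃ (W : X.Opens) (h : W ≤ U), x ∈ W ∧ homRes M N h φ = 0) : φ = 0 := by
  ext W s
  refine mres_sep N _ _ fun x hx => ?_
  obtain ⟨Z, hZ, hxZ, h0⟩ := h x (W.2 hx)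
  refine ⟨W.1 ⊓ Z, inf_le_left, ⟨hx, hxZ⟩, ?_⟩
  have := LinearMap.congr_fun (congr_fun (congrArg Subtype.val h0) ⟨W.1 ⊓ Z, inf_le_right⟩)
    (mres M inf_le_left s)
  change φ.1 ⟨W.1 ⊓ Z, _⟩ (mres M inf_le_left s) = 0 at this
  rw [← φ.2 W ⟨W.1 ⊓ Z, inf_le_left.trans W.2⟩ inf_le_left s, this]
  exact (map_zero _).symm

lemma hom_glue (M N : X.Modules) {ι : Type u} (U : ι → X.Opens) (φ : ∀ i, homOn M N (U i))
    (hφ : ∀ i j, homRes M N (inf_le_left : U i ⊓ U j ≤ U i) (φ i) =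
      homRes M N (inf_le_right : U i ⊓ U j ≤ U j) (φ j)) :
    ∃ t : homOn M N (iSup U), ∀ i, homRes M N (le_iSup U i) t = φ i := by
  obtain ⟨ψ, h₁, h₂, h₃⟩ := glue_maps (X := X) (A := fun U => Γ(M, U)) (N := fun U => Γ(N, U))
    (fun h => mres M h) (mres_res M) (fun h => mres N h) (mres_res N)
    (mres_sep N) (mres_glue N) U (fun i W s => (φ i).1 W s) (fun i => (φ i).2)
    (fun i j W h h' a => LinearMap.congr_fun
      (congr_fun (congrArg Subtype.val (hφ i j)) ⟨W, le_inf h h'⟩) a)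
  have cov : ∀ (W : {W : X.Opens // W ≤ iSup U}) (x : X), x ∈ W.1 →
      ∃ i, x ∈ W.1 ⊓ U i := by
    intro W x hx
    obtain ⟨i, hi⟩ := Opens.mem_iSup.1 (W.2 hx)
    exact ⟨i, hx, hi⟩
  refine ⟨⟨fun W =>
    { toFun := ψ W
      map_add' := fun a b => ?_
      map_smul' := fun c a => ?_ }, h₁⟩, fun i => ?_⟩
  · refine mres_sep N _ _ fun x hx => ?_
    obtain ⟨i, hi⟩ := cov W x hx
    refine ⟨_, inf_le_left, hi, ?_⟩
    rw [map_add, h₂, h₂, h₂, map_add, map_add]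
  · refine mres_sep N _ _ fun x hx => ?_
    obtain ⟨i, hi⟩ := cov W x hx
    refine ⟨_, inf_le_left, hi, ?_⟩
    rw [RingHom.id_apply, h₂, mres_smul, mres_smul, map_smul, h₂]
  · ext W s
    exact h₃ i W.1 W.2 s


/-- The sheaf `ℋom(M, N)` of homomorphisms, whose sections over `U` are the homomorphisms
`M|_U → N|_U` of sheaves of `𝒪_U`-modules. -/
def homData (M N : X.Modules) : ModData X where
  obj U := homOn M N U
  res h := homRes M N h
  res_self _ _ := rfl
  res_res _ _ _ := rfl
  res_smul h a φ := homRes_smul M N h a φ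
  sep φ h := hom_sep M N φ h
  glue U φ h := hom_glue M N U φ h

/-- The sheaf `ℋom(M, N)` of homomorphisms between two sheaves of `𝒪_X`-modules. -/
def sheafHom (M N : X.Modules) : X.Modules := (homData M N).toModules

end SheafHom

end ModData
/-! ### The tangent sheaf -/

section Tangent

variable {k : Type u} [Field k]

/-- The `k`-derivations of the sheaf `𝒪_U`: the families of `k`-derivations
`Γ(X, W) → Γ(X, W)`, for `W ⊆ U` open, that commute with restriction. -/
def derOn (X : SchemeOver k) (U : X.left.Opens) :
    AddSubgroup (∀ W : {W : X.left.Opens // W ≤ U},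
      Derivation k Γ(X.left, W.1) Γ(X.left, W.1)) where
  carrier := {D | ∀ (W W' : {W : X.left.Opens // W ≤ U}) (h : W'.1 ≤ W.1) (s : Γ(X.left, W.1)),
    D W' (ores X.left h s) = ores X.left h (D W s)}
  add_mem' := by
    intro φ ψ hφ hψ W W' h s
    simp [hφ W W' h s, hψ W W' h s]
  zero_mem' := by
    intro W W' h s
    simp
  neg_mem' := by
    intro φ hφ W W' h s
    simp [hφ W W' h s]

instance (X : SchemeOver k) (U : X.left.Opens) : Module Γ(X.left, U) (derOn X U) where
  smul a D := ⟨fun W => ores X.left W.2 a • D.1 W, by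
    intro W W' h s
    simp only [Derivation.smul_apply, smul_eq_mul, map_mul]
    rw [D.2 W W' h s, ← ores_res W.2 h]⟩
  one_smul D := by
    ext W s
    change ores X.left W.2 1 • D.1 W s = _
    rw [map_one, one_smul]
  mul_smul a b D := by
    ext W s
    change ores X.left W.2 (a * b) • D.1 W s = ores X.left W.2 a • ores X.left W.2 b • D.1 W s
    rw [map_mul, mul_smul]
  smul_zero a := by
    ext W s
    exact smul_zero (ores X.left W.2 a)
  smul_add a D E := by
    ext W s
    exact smul_add (ores X.left W.2 a) (D.1 W s) (E.1 W s)
  add_smul a b D := by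
    ext W s
    change ores X.left W.2 (a + b) • D.1 W s = ores X.left W.2 a • D.1 W s + ores X.left W.2 b • D.1 W s
    rw [map_add, add_smul]
  zero_smul D := by
    ext W s
    change ores X.left W.2 0 • D.1 W s = 0
    rw [map_zero, zero_smul]

/-- Restriction of derivations. -/
def derRes (X : SchemeOver k) {U W : X.left.Opens} (h : W ≤ U) : derOn X U →+ derOn X W where
  toFun D := ⟨fun Z => D.1 ⟨Z.1, Z.2.trans h⟩,
    fun Z Z' hZ s => D.2 ⟨Z.1, Z.2.trans h⟩ ⟨Z'.1, Z'.2.trans h⟩ hZ s⟩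
  map_zero' := rfl
  map_add' _ _ := rfl

lemma derRes_smul (X : SchemeOver k) {U W : X.left.Opens} (h : W ≤ U) (a : Γ(X.left, U))
    (D : derOn X U) : derRes X h (a • D) = ores X.left h a • derRes X h D := by
  ext Z s
  change ores X.left (Z.2.trans h) a • D.1 ⟨Z.1, Z.2.trans h⟩ s =
    ores X.left Z.2 (ores X.left h a) • D.1 ⟨Z.1, Z.2.trans h⟩ s
  rw [ores_res]

lemma der_sep (X : SchemeOver k) {U : X.left.Opens} (D : derOn X U)
    (h : ∀ x ∈ U, ∃ (W : X.left.Opens) (h : W ≤ U), x ∈ W ∧ derRes X h D = 0) : D = 0 := by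
  ext W s
  refine ores_sep _ _ fun x hx => ?_
  obtain ⟨Z, hZ, hxZ, h0⟩ := h x (W.2 hx)
  refine ⟨W.1 ⊓ Z, inf_le_left, ⟨hx, hxZ⟩, ?_⟩
  have := Derivation.congr_fun (congr_fun (congrArg Subtype.val h0) ⟨W.1 ⊓ Z, inf_le_right⟩)
    (ores X.left inf_le_left s)
  change D.1 ⟨W.1 ⊓ Z, _⟩ (ores X.left inf_le_left s) = 0 at this
  rw [← D.2 W ⟨W.1 ⊓ Z, inf_le_left.trans W.2⟩ inf_le_left s, this]
  exact (map_zero _).symm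

lemma der_glue (X : SchemeOver k) {ι : Type u} (U : ι → X.left.Opens) (D : ∀ i, derOn X (U i))
    (hD : ∀ i j, derRes X (inf_le_left : U i ⊓ U j ≤ U i) (D i) =
      derRes X (inf_le_right : U i ⊓ U j ≤ U j) (D j)) :
    ∃ t : derOn X (iSup U), ∀ i, derRes X (le_iSup U i) t = D i := by
  obtain ⟨ψ, h₁, h₂, h₃⟩ := glue_maps (X := X.left) (A := fun U => Γ(X.left, U))
    (N := fun U => Γ(X.left, U))
    (fun h => ores X.left h) ores_res (fun h => ores X.left h) ores_res
    ores_sep ores_glue U (fun i W s => (D i).1 W s) (fun i => (D i).2)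
    (fun i j W h h' a => Derivation.congr_fun
      (congr_fun (congrArg Subtype.val (hD i j)) ⟨W, le_inf h h'⟩) a)
  have cov : ∀ (W : {W : X.left.Opens // W ≤ iSup U}) (x : X.left), x ∈ W.1 →
      ∃ i, x ∈ W.1 ⊓ U i := by
    intro W x hx
    obtain ⟨i, hi⟩ := Opens.mem_iSup.1 (W.2 hx)
    exact ⟨i, hx, hi⟩
  have hadd : ∀ W a b, ψ W (a + b) = ψ W a + ψ W b := by
    intro W a b
    refine ores_sep _ _ fun x hx => ?_
    obtain ⟨i, hi⟩ := cov W x hx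
    refine ⟨_, inf_le_left, hi, ?_⟩
    rw [map_add, h₂, h₂, h₂, map_add, map_add]
  have hmul : ∀ W a b, ψ W (a * b) = a * ψ W b + b * ψ W a := by
    intro W a b
    refine ores_sep _ _ fun x hx => ?_
    obtain ⟨i, hi⟩ := cov W x hx
    refine ⟨_, inf_le_left, hi, ?_⟩
    rw [map_add, map_mul, map_mul, h₂, h₂, h₂, map_mul, Derivation.leibniz]
    rfl
  have halg : ∀ W (c : k), ψ W (algebraMap k _ c) = 0 := by
    intro W c
    refine ores_sep _ _ fun x hx => ?_
    obtain ⟨i, hi⟩ := cov W x hx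
    refine ⟨_, inf_le_left, hi, ?_⟩
    rw [h₂, ores, structMap_res, Derivation.map_algebraMap, map_zero]
  refine ⟨⟨fun W => Derivation.mk'
    { toFun := ψ W
      map_add' := hadd W
      map_smul' := fun c a => ?_ } (hmul W), h₁⟩, fun i => ?_⟩
  · rw [Algebra.smul_def, hmul, halg, mul_zero, add_zero, RingHom.id_apply, Algebra.smul_def]
  · ext W s
    exact h₃ i W.1 W.2 s

/-- The tangent sheaf `T_{X/k} = Der_k(𝒪_X, 𝒪_X) = ℋom(Ω_{X/k}, 𝒪_X)`, whose sections over `U` are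
the `k`-derivations of `𝒪_U`. -/
def tangentData (X : SchemeOver k) : ModData X.left where
  obj U := derOn X U
  res h := derRes X h
  res_self _ _ := rfl
  res_res _ _ _ := rfl
  res_smul h a D := derRes_smul X h a D
  sep D h := der_sep X D h
  glue U D h := der_glue X U D h

/-- The tangent sheaf `T_{X/k}` of a `k`-scheme `X`. -/
def tangentSheaf (X : SchemeOver k) : X.left.Modules := (tangentData X).toModules

end Tangent

/-! ### Subsheaves of `V ⊗ 𝒪_X` and their quotients as sheaves of modules -/

namespace Subsheaf

variable {p : ℕ} [Fact p.Prime] {k : Type u} [Field k] [Algebra (ZMod p) k]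
variable {V : Type u} [AddCommGroup V] [Module (ZMod p) V]

lemma repr_secMap {A A' : Type u} [CommRing A] [CommRing A'] [Algebra (ZMod p) A]
    [Algebra (ZMod p) A'] {ι : Type} (b : Module.Basis ι (ZMod p) V) (φ : A →+* A')
    (s : A ⊗[ZMod p] V) (i : ι) :
    (b.baseChange A').repr (secMap V φ s) i = φ ((b.baseChange A).repr s i) := by
  have hφ : ∀ c : ZMod p, φ (algebraMap (ZMod p) A c) = algebraMap (ZMod p) A' c := fun c =>
    RingHom.congr_fun (RingHom.ext_zmod (φ.comp (algebraMap (ZMod p) A))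
      (algebraMap (ZMod p) A')) c
  induction s with
  | zero => simp
  | add x y hx hy => simp [hx, hy]
  | tmul a v => simp [Algebra.smul_def, hφ]

variable [Module.Finite (ZMod p) V] {X : SchemeOver k}

lemma sec_sep {U : X.left.Opens} (s t : Sec p V X U)
    (h : ∀ x ∈ U, ∃ (W : X.left.Opens) (h : W ≤ U), x ∈ W ∧
      DLTangent.res V X h s = DLTangent.res V X h t) : s = t := by
  let b := Module.finBasis (ZMod p) V
  refine (b.baseChange Γ(X.left, U)).repr.injective ?_
  ext i
  refine ores_sep _ _ fun x hx => ?_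
  obtain ⟨W, hW, hxW, e⟩ := h x hx
  refine ⟨W, hW, hxW, ?_⟩
  rw [ores, ← repr_secMap, ← repr_secMap]
  exact congrArg (fun z => (b.baseChange Γ(X.left, W)).repr z i) e

lemma sec_glue {ι : Type u} (U : ι → X.left.Opens) (s : ∀ i, Sec p V X (U i))
    (hs : ∀ i j, DLTangent.res V X (inf_le_left : U i ⊓ U j ≤ U i) (s i) =
      DLTangent.res V X (inf_le_right : U i ⊓ U j ≤ U j) (s j)) :
    ∃ t : Sec p V X (iSup U), ∀ i, DLTangent.res V X (le_iSup U i) t = s i := by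
  let b := Module.finBasis (ZMod p) V
  have : ∀ n, ∃ t : Γ(X.left, iSup U), ∀ i, ores X.left (le_iSup U i) t =
      (b.baseChange Γ(X.left, U i)).repr (s i) n := by
    intro n
    refine ores_glue U _ fun i j => ?_
    rw [ores, ores, ← repr_secMap, ← repr_secMap]
    exact congrArg (fun z => (b.baseChange Γ(X.left, U i ⊓ U j)).repr z n) (hs i j)
  choose t ht using this
  refine ⟨(b.baseChange Γ(X.left, iSup U)).equivFun.symm t, fun i => ?_⟩
  refine (b.baseChange Γ(X.left, U i)).repr.injective ?_
  ext n
  rw [← ht n i, DLTangent.res, repr_secMap]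
  congr 1
  exact congr_fun ((b.baseChange Γ(X.left, iSup U)).equivFun.apply_symm_apply t) n

/-- The explicit data of a subsheaf of `V ⊗ 𝒪_X`, as a sheaf of modules. -/
def modData (L : Subsheaf p V X) : ModData X.left where
  obj U := L.obj U
  res {U W} h :=
    { toFun := fun s => ⟨DLTangent.res V X h s.1, L.res_mem h s.2⟩
      map_zero' := Subtype.ext (map_zero _)
      map_add' := fun s t => Subtype.ext (map_add _ s.1 t.1) }
  res_self h s := Subtype.ext (DLTangent.res_self X h s.1)
  res_res h h' s := Subtype.ext (DLTangent.res_res X h h' s.1)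
  res_smul h a s := Subtype.ext (DLTangent.res_smul X h a s.1)
  sep {U} s hs := by
    refine Subtype.ext (sec_sep s.1 0 fun x hx => ?_)
    obtain ⟨W, h, hxW, e⟩ := hs x hx
    exact ⟨W, h, hxW, (congrArg Subtype.val e).trans (map_zero _).symm⟩
  glue {ι} U s hs := by
    obtain ⟨t, ht⟩ := sec_glue U (fun i => (s i).1) fun i j => congrArg Subtype.val (hs i j)
    refine ⟨⟨t, L.local_mem t fun x hx => ?_⟩, fun i => Subtype.ext (ht i)⟩
    obtain ⟨i, hi⟩ := Opens.mem_iSup.1 hx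
    refine ⟨U i, le_iSup U i, hi, ?_⟩
    rw [ht i]
    exact (s i).2

/-- A subsheaf of `V ⊗ 𝒪_X` as a sheaf of `𝒪_X`-modules. -/
def toModules (L : Subsheaf p V X) : X.left.Modules := L.modData.toModules

/-- The inclusion between two subsheaves of `V ⊗ 𝒪_X`. -/
def incl {L M : Subsheaf p V X} (h : L ≤ M) : L.toModules ⟶ M.toModules :=
  ModData.homMk (M := L.modData) (N := M.modData)
    (fun U => Submodule.inclusion (h U)) (fun _ _ => rfl)

/-- The quotient sheaf `M / L` of two subsheaves `L ⊆ M` of `V ⊗ 𝒪_X`. -/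
def quotient {L M : Subsheaf p V X} (h : L ≤ M) : X.left.Modules := Limits.cokernel (incl h)

end Subsheaf

/-! ### The moduli problems -/

section Moduli

variable {p : ℕ} [Fact p.Prime] {k : Type u} [Field k] [Algebra (ZMod p) k]
variable {V : Type u} [AddCommGroup V] [Module (ZMod p) V]
variable (B : LinearMap.BilinForm (ZMod p) V) (d : ℕ)

/-- The points of `OGr(d, d + 1)` with values in a `k`-scheme `S`: the flags `L_d ⊆ L_{d+1}` of
totally isotropic local direct summands of `V ⊗ 𝒪_S` of ranks `d` and `d + 1`. -/
@[ext] structure OGr (S : SchemeOver k) where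
  /-- the subsheaf `L_d` -/
  L₀ : Subsheaf p V S
  /-- the subsheaf `L_{d+1}` -/
  L₁ : Subsheaf p V S
  le : L₀ ≤ L₁
  summand₀ : L₀.IsSummandOfRank d
  summand₁ : L₁.IsSummandOfRank (d + 1)
  isotropic₀ : L₀.IsIsotropic B
  isotropic₁ : L₁.IsIsotropic B

variable {B d} in
/-- Pull-back of points of `OGr(d, d + 1)`. -/
@[simps] def OGr.pull {S T : SchemeOver k} (f : T ⟶ S) (x : OGr B d S) : OGr B d T where
  L₀ := x.L₀.pull f.left
  L₁ := x.L₁.pull f.left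
  le := Subsheaf.pull_mono _ x.le
  summand₀ := x.summand₀.pull _
  summand₁ := x.summand₁.pull _
  isotropic₀ := x.isotropic₀.pull _
  isotropic₁ := x.isotropic₁.pull _

/-- The functor `OGr(d, d + 1)` on `k`-schemes. -/
def OGrFunctor (k : Type u) [Field k] [Algebra (ZMod p) k] : (SchemeOver k)ᵒᵖ ⥤ Type u where
  obj S := OGr (k := k) B d S.unop
  map f := ↾(OGr.pull f.unop)
  map_id S := by
    refine ConcreteCategory.hom_ext _ _ fun x => ?_
    refine OGr.ext ?_ ?_
    · exact Subsheaf.pull_id x.L₀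
    · exact Subsheaf.pull_id x.L₁
  map_comp f g := by
    refine ConcreteCategory.hom_ext _ _ fun x => ?_
    refine OGr.ext ?_ ?_
    · exact Subsheaf.pull_comp _ _ x.L₀
    · exact Subsheaf.pull_comp _ _ x.L₁

/-- The points of the moduli problem `𝒴_V` with values in a `k`-scheme `S`: the points
`(L_d, L_{d+1})` of `OGr(d, d + 1)` such that `L_d ⊆ Frob^* L_{d+1}` and such that
`L_{d+1} + Frob^* L_{d+1}` is locally a direct summand of `V ⊗ 𝒪_S`. -/
@[ext] structure DL (S : SchemeOver k) extends OGr B d S where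
  le_frob : L₀ ≤ L₁.frobPull
  summand_sup : (L₁ ⊔ L₁.frobPull).IsSummand

variable {B d} in
/-- Pull-back of points of `𝒴_V`. -/
@[simps toOGr] def DL.pull {S T : SchemeOver k} (f : T ⟶ S) (x : DL B d S) : DL B d T where
  toOGr := x.toOGr.pull f
  le_frob := by
    simp only [OGr.pull_L₀, OGr.pull_L₁, Subsheaf.frobPull_pull]
    exact Subsheaf.pull_mono _ x.le_frob
  summand_sup := by
    simp only [OGr.pull_L₁, Subsheaf.frobPull_pull, ← Subsheaf.pull_sup]
    exact x.summand_sup.pull _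

/-- The functor `𝒴_V` on `k`-schemes. -/
def DLFunctor (k : Type u) [Field k] [Algebra (ZMod p) k] : (SchemeOver k)ᵒᵖ ⥤ Type u where
  obj S := DL (k := k) B d S.unop
  map f := ↾(DL.pull f.unop)
  map_id S := by
    refine ConcreteCategory.hom_ext _ _ fun x => ?_
    refine DL.ext ?_ ?_
    · exact Subsheaf.pull_id x.L₀
    · exact Subsheaf.pull_id x.L₁
  map_comp f g := by
    refine ConcreteCategory.hom_ext _ _ fun x => ?_
    refine DL.ext ?_ ?_
    · exact Subsheaf.pull_comp _ _ x.L₀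
    · exact Subsheaf.pull_comp _ _ x.L₁

variable {B d}

/-- The sheaf of modules `L_{d+1} / L_d` of a point of `𝒴_V`; for the universal point over `Y_V`
this is `ℒ_{Y_V}`. -/
def DL.lineBundle [Module.Finite (ZMod p) V] {S : SchemeOver k} (x : DL B d S) : S.left.Modules :=
  Subsheaf.quotient x.le

/-- The sheaf of modules `V ⊗ 𝒪_S / (L_{d+1} + Frob^* L_{d+1})` of a point of `𝒴_V`. -/
def DL.cokernelBundle [Module.Finite (ZMod p) V] {S : SchemeOver k} (x : DL B d S) :
    S.left.Modules :=
  Subsheaf.quotient (le_top : x.L₁ ⊔ x.L₁.frobPull ≤ ⊤)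

/-- An open subscheme of a `k`-scheme. -/
def openSub (S : SchemeOver k) (U : S.left.Opens) : SchemeOver k := Over.mk (U.ι ≫ S.hom)

/-- The inclusion of an open subscheme. -/
def openSubInclusion (S : SchemeOver k) (U : S.left.Opens) : openSub S U ⟶ S := Over.homMk U.ι

variable {O Y : SchemeOver k}

/-- The forgetful morphism `𝒴_V → OGr(d, d + 1)` between the representing schemes. -/
def forgetMor (hO : (OGrFunctor B d k).RepresentableBy O)
    (hY : (DLFunctor B d k).RepresentableBy Y) : Y ⟶ O :=
  hO.homEquiv.symm (DL.toOGr (hY.homEquiv (𝟙 Y)))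

/-- The open subscheme of `𝒴_V` that is the inverse image of an open subscheme `C` of
`OGr(d, d + 1)`; for the two connected components `C = OGr^±(d, d + 1)` this is `Y_V^±`. -/
def DLVariety (hO : (OGrFunctor B d k).RepresentableBy O)
    (hY : (DLFunctor B d k).RepresentableBy Y) (C : O.left.Opens) : SchemeOver k :=
  openSub Y ((forgetMor hO hY).left ⁻¹ᵁ C)

/-- The universal object `(𝒰_d, 𝒰_{d+1})` over `Y_V`: the point of the moduli problem `𝒴_V` that
corresponds to the inclusion `Y_V → 𝒴_V`. -/
def DLVariety.univ (hO : (OGrFunctor B d k).RepresentableBy O)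
    (hY : (DLFunctor B d k).RepresentableBy Y) (C : O.left.Opens) : DL B d (DLVariety hO hY C) :=
  hY.homEquiv (openSubInclusion Y ((forgetMor hO hY).left ⁻¹ᵁ C))

end Moduli

end DLTangent

end

/-! Let `D` be a derivation of `𝒪` and let it act on `V ⊗ 𝒪` through coefficients. Modulo `L_{d+1}`
this action is `𝒪`-linear on `L_{d+1}`, because the Leibniz term `D(a) s` stays in `L_{d+1}`. It
also preserves `Frob^* L_{d+1}`, because that subsheaf is generated by vectors with `p`-th power
coefficients and `D(a ^ p) = 0`. Since `L_d ⊆ Frob^* L_{d+1}`, the map `s ↦ D s` modulo `L_{d+1} +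
Frob^* L_{d+1}` kills `L_d`. This gives the Kodaira–Spencer map from `T` to `ℋom(L_{d+1} / L_d, V ⊗
𝒪 / (L_{d+1} + Frob^* L_{d+1}))`, and the theorem says that it is bijective.

Locally there are vectors `a i`, `e`, `f`, part of a basis of `V ⊗ 𝒪`, such that `L_d`, `L_{d+1}`
and `Frob^* L_{d+1}` are spanned by the `a i`, by the `a i` and `e`, and by the `a i` and `f`, with
`⟨e, f⟩` a unit (`exists_adaptedOn`). This is where nonsplitness enters: at a point, a
Frobenius-stable Lagrangian would be spanned by rational vectors and would give an isotropic
subspace of `V` of dimension `d + 1` (`exists_frob_notMem`). Two distinct Lagrangians that share the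
hyperplane `L_d` pair nontrivially.

Injectivity (`derivation_eq_zero`): if `D e` lies in the span of the `a i`, `e`, `f`, then
differentiating `⟨e, e⟩ = 0` and `⟨a i, e⟩ = 0` removes the `f`-components of `D e` and `D (a i)`;
here `p` is odd. So `D` preserves the flag, the points `a ↦ a` and `a ↦ a + ε D a` over the dual
numbers induce the same flag, and representability makes them equal.

Surjectivity (`exists_derivation`): given `v`, isotropy to first order can be restored by adding
multiples of `ε f` to `e + ε v` and to the `a i` (`Frame.exists_deformation`). Frobenius kills `ε`,
so `Frob^*` of the deformed module is the constant one and the incidence conditions persist.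
Representability turns this point over the dual numbers into a derivation with `D e ≡ v`. By
injectivity such derivations are unique, so the local ones glue.

Only two properties of the universal flag are needed, `IsSeparating` and `IsLiftable`. Both follow
from representability of `𝒴_V`, and they pass to open subschemes. -/

noncomputable section

namespace DLTangent

/-! ### Linear algebra over extension fields of `𝔽_p` -/

section FieldAlgebra

/-- A linearly independent family can be completed to a basis by members of a spanning set. -/
lemma exists_basis_sumElim {K : Type*} [Field K] {M : Type*} [AddCommGroup M]
    [Module K M] [FiniteDimensional K M]
    {κ : Type} {w : κ → M} (hw : LinearIndependent K w) {T : Set M}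
    (hT : Submodule.span K T = ⊤) :
    ∃ (m : ℕ) (g : Fin m → M) (b : Module.Basis (κ ⊕ Fin m) K M), (∀ j, g j ∈ T) ∧
      ⇑b = Sum.elim w g := by
  obtain ⟨c, hcT, hwc, hTc, hc⟩ := exists_linearIndepOn_id_extension
    (LinearIndependent.linearIndepOn_id hw) (Set.subset_union_left (t := T))
  have hfin : Finite c := hc.finite
  have : Finite ↥(c \ Set.range w) := Set.Finite.subset (Set.toFinite c) Set.sdiff_subset
  let := Fintype.ofFinite ↥(c \ Set.range w)
  let e := (Fintype.equivFin ↥(c \ Set.range w)).symm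
  let g : Fin (Fintype.card ↥(c \ Set.range w)) → M := fun j => (e j).1
  let f : κ ⊕ Fin (Fintype.card ↥(c \ Set.range w)) → c :=
    Sum.elim (fun i => ⟨w i, hwc ⟨i, rfl⟩⟩) (fun j => ⟨g j, (e j).2.1⟩)
  have hf : Function.Injective f := by
    rintro (i | i) (j | j) h
    · exact congrArg _ (hw.injective (congrArg Subtype.val h))
    · exact absurd ⟨i, congrArg Subtype.val h⟩ (e j).2.2
    · exact absurd ⟨j, (congrArg Subtype.val h).symm⟩ (e i).2.2
    · exact congrArg _ (e.injective (Subtype.ext (show (e i).1 = (e j).1 from congrArg (fun z : c => (z : M)) h)))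
  have hfs : (fun i => (f i : M)) = Sum.elim w g := by
    funext i
    rcases i with i | i <;> rfl
  have hli : LinearIndependent K (Sum.elim w g) := by
    rw [← hfs]
    exact LinearIndependent.comp (v := fun x : c => (x : M)) hc f hf
  have hsp : ⊤ ≤ Submodule.span K (Set.range (Sum.elim w g)) := by
    rw [← hT, Submodule.span_le]
    refine (Set.subset_union_right.trans hTc).trans (Submodule.span_mono ?_)
    intro x hx
    by_cases h : x ∈ Set.range w
    · obtain ⟨i, rfl⟩ := h
      exact ⟨Sum.inl i, rfl⟩
    · exact ⟨Sum.inr (e.symm ⟨x, hx, h⟩), by simp [g]⟩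
  refine ⟨_, g, Module.Basis.mk hli hsp, fun j => ?_, Module.Basis.coe_mk _ _⟩
  rcases hcT (e j).2.1 with h | h
  · exact absurd h (e j).2.2
  · exact h

variable {p : ℕ} [Fact p.Prime] {V : Type u} [AddCommGroup V] [Module (ZMod p) V]
variable {K : Type u} [Field K] [Algebra (ZMod p) K]

/-- The fixed field of Frobenius is the prime field, which is the image of `ZMod p`. -/
lemma exists_algebraMap_eq_of_pow_eq {x : K} (h : x ^ p = x) :
    ∃ c : ZMod p, algebraMap (ZMod p) K c = x := by
  have : CharP K p := charP_of_injective_algebraMap (algebraMap (ZMod p) K).injective p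
  have hx : x ∈ (⊥ : Subfield K) := (Subfield.mem_bot_iff_pow_eq_self K p).2 h
  exact (bot_le : (⊥ : Subfield K) ≤ (algebraMap (ZMod p) K).fieldRange) hx

variable [Module.Finite (ZMod p) V]

/-- A Frobenius-stable subspace of `K ⊗ V` is spanned by its rational vectors. -/
lemma mem_span_rational (E : Submodule K (K ⊗[ZMod p] V))
    (hE : ∀ s ∈ E, secMap V (frobHom p K) s ∈ E) {s : K ⊗[ZMod p] V} (hs : s ∈ E) :
    s ∈ Submodule.span K {t | ∃ v : V, t = 1 ⊗ₜ v ∧ t ∈ E} := by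
  classical
  let β := (Module.finBasis (ZMod p) V).baseChange K
  -- Descent by minimal support: a nonzero vector of `E` with smallest support inside that of `s` is
  -- rational after scaling, and subtracting a multiple of it from `s` shrinks the support.
  induction hn : (β.repr s).support.card using Nat.strong_induction_on generalizing s with
  | _ n ih =>
  by_cases hs0 : s = 0
  · rw [hs0]; exact zero_mem _
  let P : ℕ → Prop := fun m => ∃ t ∈ E, t ≠ 0 ∧ (β.repr t).support ⊆ (β.repr s).support ∧
    (β.repr t).support.card = m
  have hP : ∃ m, P m := ⟨_, s, hs, hs0, subset_rfl, rfl⟩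
  obtain ⟨t, htE, ht0, hts, htc⟩ := Nat.find_spec hP
  have hmin : ∀ r ∈ E, (β.repr r).support ⊂ (β.repr t).support → r = 0 := by
    intro r hr hsub
    by_contra hr0
    exact Nat.find_min hP (htc ▸ Finset.card_lt_card hsub)
      ⟨r, hr, hr0, hsub.subset.trans hts, rfl⟩
  have hne : (β.repr t).support.Nonempty := by
    rw [Finsupp.support_nonempty_iff]
    simpa using ht0
  obtain ⟨i, hi⟩ := hne
  have hti : β.repr t i ≠ 0 := Finsupp.mem_support_iff.1 hi
  let w := (β.repr t i)⁻¹ • t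
  have hwE : w ∈ E := E.smul_mem _ htE
  have hw : ∀ j, β.repr w j = (β.repr t i)⁻¹ * β.repr t j := fun j => by simp [w]
  have hwi : β.repr w i = 1 := by rw [hw, inv_mul_cancel₀ hti]
  -- The coordinate `i` of `w` is `1`, so it cancels here and no new coordinate appears. The
  -- difference lies in `E` with strictly smaller support, hence vanishes by minimality.
  have hfw : secMap V (frobHom p K) w - w = 0 := by
    have hc : ∀ j, β.repr (secMap V (frobHom p K) w - w) j = (β.repr w j) ^ p - β.repr w j := by
      intro j
      rw [map_sub, Finsupp.sub_apply, Subsheaf.repr_secMap]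
      rfl
    refine hmin _ (sub_mem (hE _ hwE) hwE) (Finset.ssubset_iff_of_subset ?_ |>.2 ⟨i, hi, ?_⟩)
    · intro j hj
      rw [Finsupp.mem_support_iff, hc] at hj
      rw [Finsupp.mem_support_iff]
      intro h0
      rw [hw, h0, mul_zero, zero_pow (Fact.out : p.Prime).ne_zero, sub_zero] at hj
      exact hj rfl
    · rw [Finsupp.notMem_support_iff, hc, hwi, one_pow, sub_self]
  have hrat : ∀ j, ∃ c : ZMod p, algebraMap (ZMod p) K c = β.repr w j := by
    intro j
    refine exists_algebraMap_eq_of_pow_eq ?_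
    have := congrArg (fun z => β.repr z j) (sub_eq_zero.1 hfw)
    simp only [β, Subsheaf.repr_secMap] at this
    exact this
  choose c hc using hrat
  have hwv : w = 1 ⊗ₜ (∑ j, c j • Module.finBasis (ZMod p) V j) := by
    rw [← β.sum_repr w, TensorProduct.tmul_sum]
    refine Finset.sum_congr rfl fun j _ => ?_
    rw [← hc j, TensorProduct.tmul_smul, ← algebraMap_smul K (c j) (1 ⊗ₜ[ZMod p] _),
      Module.Basis.baseChange_apply]
  have hwspan : w ∈ Submodule.span K {t | ∃ v : V, t = 1 ⊗ₜ v ∧ t ∈ E} :=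
    Submodule.subset_span ⟨_, hwv, hwE⟩
  -- The support of `w` is contained in that of `s`, and `w` has coordinate `1` at `i`, so the first
  -- summand loses `i` from its support and gains nothing.
  have hsplit : s = (s - β.repr s i • w) + β.repr s i • w := by abel
  rw [hsplit]
  refine add_mem (ih _ ?_ (sub_mem hs (E.smul_mem _ hwE)) rfl) (Submodule.smul_mem _ _ hwspan)
  rw [← hn]
  refine Finset.card_lt_card (Finset.ssubset_iff_of_subset ?_ |>.2 ⟨i, hts hi, ?_⟩)
  · intro j hj
    rw [Finsupp.mem_support_iff, map_sub, Finsupp.sub_apply, map_smul, Finsupp.smul_apply,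
      smul_eq_mul] at hj
    by_contra h0
    have h1 := Finsupp.notMem_support_iff.1 h0
    have h2 := Finsupp.notMem_support_iff.1 (fun h => h0 (hts h))
    rw [h1, hw, h2] at hj
    simp at hj
  · rw [Finsupp.notMem_support_iff, map_sub, Finsupp.sub_apply, map_smul, Finsupp.smul_apply, hwi]
    simp

/-- If `B` has no rational totally isotropic subspace of dimension `r`, then no totally isotropic
subspace of `K ⊗ V` of dimension `r` is stable under Frobenius. -/
lemma exists_frob_notMem {B : LinearMap.BilinForm (ZMod p) V} {r : ℕ}
    (hB : ∀ W : Submodule (ZMod p) V,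
      (∀ x ∈ W, ∀ y ∈ W, B x y = 0) → Module.finrank (ZMod p) W ≠ r)
    (E : Submodule K (K ⊗[ZMod p] V)) (hE : ∀ s ∈ E, ∀ t ∈ E, B.baseChange K s t = 0)
    (hr : Module.finrank K E = r) : ∃ s ∈ E, secMap V (frobHom p K) s ∉ E := by
  by_contra! hst
  -- If `E` were Frobenius-stable, its rational vectors `W` would form an isotropic subspace with `K
  -- ⊗ W = E`, hence of the forbidden dimension `r`.
  let W : Submodule (ZMod p) V :=
    { carrier := {v | (1 : K) ⊗ₜ[ZMod p] v ∈ E}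
      add_mem' := fun {a b} ha hb => by
        change (1 : K) ⊗ₜ[ZMod p] (a + b) ∈ E
        rw [TensorProduct.tmul_add]
        exact add_mem ha hb
      zero_mem' := by simp
      smul_mem' := fun c v hv => by
        change (1 : K) ⊗ₜ[ZMod p] (c • v) ∈ E
        rw [TensorProduct.tmul_smul, ← algebraMap_smul K c]
        exact E.smul_mem _ hv }
  refine hB W ?_ ?_
  · intro x hx y hy
    have := hE _ hx _ hy
    rw [LinearMap.BilinForm.baseChange_tmul, one_mul, Algebra.smul_def, mul_one] at this
    exact (algebraMap (ZMod p) K).injective (this.trans (map_zero _).symm)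
  · let w := Module.finBasis (ZMod p) W
    have hw : LinearIndependent (ZMod p) fun i => (w i : V) :=
      w.linearIndependent.map' W.subtype W.ker_subtype
    have hw' : LinearIndependent K fun i => (1 : K) ⊗ₜ[ZMod p] (w i : V) := by
      obtain ⟨m, g, b, -, hb⟩ := exists_basis_sumElim hw Submodule.span_univ
      have := (b.baseChange K).linearIndependent.comp Sum.inl Sum.inl_injective
      convert this using 2 with i
      rw [Function.comp_apply, Module.Basis.baseChange_apply, hb]
      rfl
    have hspan : Submodule.span K (Set.range fun i => (1 : K) ⊗ₜ[ZMod p] (w i : V)) = E := by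
      refine le_antisymm ?_ fun s hs => ?_
      · rw [Submodule.span_le]
        rintro _ ⟨i, rfl⟩
        exact (w i).2
      · refine Submodule.span_le.2 ?_ (mem_span_rational E hst hs)
        rintro _ ⟨v, rfl, hv⟩
        have hvw : v = ∑ i, w.repr ⟨v, hv⟩ i • (w i : V) := by
          conv_lhs => rw [show v = W.subtype ⟨v, hv⟩ from rfl, ← w.sum_repr ⟨v, hv⟩, map_sum]
          rfl
        rw [hvw, TensorProduct.tmul_sum]
        refine Submodule.sum_mem _ fun i _ => ?_
        rw [TensorProduct.tmul_smul, ← algebraMap_smul K (w.repr ⟨v, hv⟩ i)]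
        exact Submodule.smul_mem _ _ (Submodule.subset_span ⟨i, rfl⟩)
    rw [← hr, ← hspan, finrank_span_eq_card hw', Fintype.card_fin]

/-- The Gram determinant in a rational basis is the image of the Gram determinant over `ZMod p`, and
a homomorphism of fields is injective. -/
lemma nondegenerate_baseChange {B : LinearMap.BilinForm (ZMod p) V} (hB : B.Nondegenerate) :
    (B.baseChange K).Nondegenerate := by
  let b := Module.finBasis (ZMod p) V
  rw [LinearMap.BilinForm.nondegenerate_iff_det_ne_zero (b.baseChange K)]
  have : LinearMap.BilinForm.toMatrix (b.baseChange K) (B.baseChange K) =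
      (LinearMap.BilinForm.toMatrix b B).map (algebraMap (ZMod p) K) := by
    ext i j
    simp [LinearMap.BilinForm.toMatrix_apply, Algebra.smul_def]
  rw [this, ← RingHom.mapMatrix_apply, ← RingHom.map_det]
  exact fun h => (LinearMap.BilinForm.nondegenerate_iff_det_ne_zero b).1 hB
    ((algebraMap (ZMod p) K).injective (h.trans (map_zero _).symm))

/-- A totally isotropic subspace of half the dimension is its own orthogonal. -/
lemma mem_of_orthogonal {B : LinearMap.BilinForm (ZMod p) V} (hB : B.Nondegenerate) {r : ℕ}
    (hV : Module.finrank (ZMod p) V = 2 * r)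
    (E : Submodule K (K ⊗[ZMod p] V)) (hE : ∀ s ∈ E, ∀ t ∈ E, B.baseChange K s t = 0)
    (hr : Module.finrank K E = r) {s : K ⊗[ZMod p] V} (hs : ∀ t ∈ E, B.baseChange K t s = 0) :
    s ∈ E := by
  have h₁ := LinearMap.BilinForm.finrank_orthogonal (nondegenerate_baseChange (K := K) hB) E
  rw [Module.finrank_baseChange, hV, hr] at h₁
  have h₂ : E ≤ (B.baseChange K).orthogonal E := fun s hs t ht => hE t ht s hs
  have h₃ : E = (B.baseChange K).orthogonal E :=
    Submodule.eq_of_le_of_finrank_eq h₂ (by rw [h₁, hr]; omega)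
  rw [h₃]
  exact hs

end FieldAlgebra

/-! ### Bases and spans over commutative rings -/

section Bases

lemma basis_mem_span_inl_iff {R M ι κ : Type*} [CommRing R] [AddCommGroup M] [Module R M]
    (b : Module.Basis (ι ⊕ κ) R M) (s : M) :
    s ∈ Submodule.span R (Set.range fun i => b (Sum.inl i)) ↔ ∀ j, b.repr s (Sum.inr j) = 0 := by
  have : (Set.range fun i => b (Sum.inl i)) = b '' Set.range Sum.inl := by
    rw [← Set.range_comp]; rfl
  rw [this, Module.Basis.mem_span_image]
  constructor
  · intro h j
    by_contra hj
    obtain ⟨i, hi⟩ := h (Finsupp.mem_support_iff.2 hj)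
    cases hi
  · rintro h (i | j) hx
    · exact ⟨i, rfl⟩
    · exact absurd (h j) (Finsupp.mem_support_iff.1 hx)

/-- If two free submodules with free complements are contained in each other and have the same
corank, then they agree. -/
lemma span_inl_eq_of_le {R M ι ι' κ κ' : Type*} [CommRing R] [AddCommGroup M] [Module R M]
    [Fintype ι'] [Fintype κ] [Fintype κ'] (γ : Module.Basis (ι ⊕ ι') R M)
    (β : Module.Basis (κ ⊕ κ') R M) (hc : Fintype.card ι' = Fintype.card κ')
    (h : ∀ i, β (Sum.inl i) ∈ Submodule.span R (Set.range fun i => γ (Sum.inl i))) :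
    Submodule.span R (Set.range fun i => γ (Sum.inl i)) =
      Submodule.span R (Set.range fun i => β (Sum.inl i)) := by
  -- In coordinates on the complements, this is the surjection from the quotient by the `β`-span to
  -- the quotient by the larger `γ`-span.
  let T : (κ' → R) →ₗ[R] (ι' → R) :=
    { toFun := fun c j => γ.repr (∑ k, c k • β (Sum.inr k)) (Sum.inr j)
      map_add' := fun c c' => by
        ext j
        simp [add_smul, Finset.sum_add_distrib]
      map_smul' := fun r c => by
        ext j
        simp [mul_smul, Finset.mul_sum] }
  have key : ∀ s j, γ.repr s (Sum.inr j) = T (fun k => β.repr s (Sum.inr k)) j := by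
    intro s j
    have hs := β.sum_repr s
    rw [Fintype.sum_sum_type] at hs
    have h0 : γ.repr (∑ i, β.repr s (Sum.inl i) • β (Sum.inl i)) (Sum.inr j) = 0 :=
      (basis_mem_span_inl_iff γ _).1
        (Submodule.sum_mem _ fun i _ => Submodule.smul_mem _ _ (h i)) j
    conv_lhs => rw [← hs, map_add, Finsupp.add_apply, h0, zero_add]
    rfl
  have hsurj : Function.Surjective T := by
    classical
    intro t
    refine ⟨fun k => β.repr (∑ j, t j • γ (Sum.inr j)) (Sum.inr k), ?_⟩
    ext j
    rw [← key]
    simp [Finsupp.single_apply]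
  let e : (κ' → R) ≃ₗ[R] (ι' → R) := LinearEquiv.funCongrLeft R R (Fintype.equivOfCardEq hc)
  -- The two quotients are free of the same finite rank, and a surjective endomorphism of a finitely
  -- generated module is injective.
  have hinj : Function.Injective T := by
    have : Function.Injective (e.symm.toLinearMap ∘ₗ T) := by
      refine OrzechProperty.injective_of_surjective_endomorphism _ ?_
      exact e.symm.surjective.comp hsurj
    exact Function.Injective.of_comp (f := e.symm) this
  refine le_antisymm (fun s hs => ?_) (Submodule.span_le.2 ?_)
  · rw [basis_mem_span_inl_iff] at hs ⊢
    have h0 : T (fun k => β.repr s (Sum.inr k)) = 0 := by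
      ext j
      rw [← key, hs j]
      rfl
    intro j
    exact congr_fun (hinj (h0.trans (map_zero T).symm)) j
  · rintro _ ⟨i, rfl⟩
    exact h i

lemma exists_basis_of_isUnit_det {R M ι : Type*} [CommRing R] [AddCommGroup M] [Module R M]
    [Fintype ι] [DecidableEq ι] (b : Module.Basis ι R M) (v : ι → M) (h : IsUnit (b.det v)) :
    ∃ b' : Module.Basis ι R M, ⇑b' = v := by
  obtain ⟨h₁, h₂⟩ := (Module.Basis.is_basis_iff_det b).2 h
  exact ⟨Module.Basis.mk h₁ h₂.ge, Module.Basis.coe_mk _ _⟩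

end Bases

/-! ### Additive maps of coefficients and dual numbers -/

section Dual

variable {p : ℕ} [Fact p.Prime] (V : Type u) [AddCommGroup V] [Module (ZMod p) V]
variable {A R R' : Type u} [CommRing A] [CommRing R] [CommRing R']
  [Algebra (ZMod p) A] [Algebra (ZMod p) R] [Algebra (ZMod p) R']

/-- The map `A ⊗ V → R ⊗ V` induced by an additive map `A → R`. -/
def addSec (f : A →+ R) : A ⊗[ZMod p] V →ₗ[ZMod p] R ⊗[ZMod p] V :=
  LinearMap.rTensor V (f.toZModLinearMap p)

@[simp] lemma addSec_tmul (f : A →+ R) (a : A) (v : V) :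
    addSec (p := p) V f (a ⊗ₜ v) = f a ⊗ₜ v := rfl

lemma secMap_eq_addSec (φ : A →+* R) (s : A ⊗[ZMod p] V) :
    secMap V φ s = addSec V φ.toAddMonoidHom s := rfl

lemma addSec_comp (f : A →+ R) (g : R →+ R') (s : A ⊗[ZMod p] V) :
    addSec V g (addSec V f s) = addSec V (g.comp f) s := by
  induction s with
  | zero => simp
  | tmul b v => rfl
  | add x y hx hy => simp only [map_add, hx, hy]

lemma addSec_add (f g : A →+ R) (s : A ⊗[ZMod p] V) :
    addSec V (f + g) s = addSec V f s + addSec V g s := by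
  induction s with
  | zero => simp
  | tmul b v => simp [TensorProduct.add_tmul]
  | add x y hx hy => simp only [map_add, hx, hy]; abel

variable {V}

/-- `D` is a derivation along the ring homomorphism `ρ`. -/
def IsDerivationAlong (ρ : A →+* R) (D : A →+ R) : Prop :=
  ∀ a b, D (a * b) = ρ a * D b + ρ b * D a

section Derivations

variable {ρ : A →+* R} {D : A →+ R} (hD : IsDerivationAlong ρ D)

include hD

lemma IsDerivationAlong.map_one : D 1 = 0 := by
  simpa using hD 1 1

lemma IsDerivationAlong.map_zmod (c : ZMod p) : D (algebraMap (ZMod p) A c) = 0 := by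
  rw [← ZMod.natCast_zmod_val c, map_natCast, ← nsmul_one, map_nsmul, hD.map_one, nsmul_zero]

lemma IsDerivationAlong.map_pow (a : A) (n : ℕ) : D (a ^ n) = n * ρ a ^ (n - 1) * D a := by
  induction n with
  | zero => simpa using hD.map_one
  | succ n ih =>
    rw [pow_succ, hD, ih]
    rcases n with _ | n
    · simp
    · simp only [Nat.cast_add, Nat.cast_one, Nat.add_sub_cancel, _root_.map_pow]
      ring

lemma IsDerivationAlong.addSec_smul (a : A) (s : A ⊗[ZMod p] V) :
    addSec V D (a • s) = ρ a • addSec V D s + D a • secMap V ρ s := by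
  induction s with
  | zero => simp
  | tmul b v =>
    simp only [TensorProduct.smul_tmul', smul_eq_mul, addSec_tmul, secMap_tmul]
    rw [hD, TensorProduct.add_tmul, mul_comm (ρ b)]
  | add x y hx hy => simp only [smul_add, map_add, hx, hy]; abel

/-- `D (a ^ p) = p a ^ (p - 1) D a = 0` in characteristic `p`. This is why derivations respect
Frobenius pull-backs. -/
lemma IsDerivationAlong.addSec_frob (s : A ⊗[ZMod p] V) :
    addSec V D (secMap V (frobHom p A) s) = 0 := by
  induction s with
  | zero => simp
  | tmul b v =>
    have hp0 : (p : R) = 0 := by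
      rw [← map_natCast (algebraMap (ZMod p) R), CharP.cast_eq_zero, map_zero]
    rw [secMap_tmul, addSec_tmul, frobHom_apply, hD.map_pow, hp0]
    simp
  | add x y hx hy => rw [map_add, map_add, hx, hy, add_zero]

/-- Leibniz rule for the pairing: the values of `B` on `V` lie in `ZMod p`, where `D` vanishes, so
only the coefficients are differentiated. -/
lemma IsDerivationAlong.baseChange (B : LinearMap.BilinForm (ZMod p) V) (s t : A ⊗[ZMod p] V) :
    D (B.baseChange A s t) = B.baseChange R (addSec V D s) (secMap V ρ t) +
      B.baseChange R (secMap V ρ s) (addSec V D t) := by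
  have hρ : ∀ c : ZMod p, ρ (algebraMap (ZMod p) A c) = algebraMap (ZMod p) R c := fun c =>
    RingHom.congr_fun (RingHom.ext_zmod (ρ.comp (algebraMap (ZMod p) A))
      (algebraMap (ZMod p) R)) c
  induction s with
  | zero => simp
  | add x y hx hy =>
    simp only [map_add, LinearMap.add_apply, hx, hy]
    ring
  | tmul a v =>
    induction t with
    | zero => simp
    | add x y hx hy =>
      simp only [map_add, hx, hy]
      ring
    | tmul b w =>
      simp only [LinearMap.BilinForm.baseChange_tmul, addSec_tmul, secMap_tmul, Algebra.smul_def]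
      rw [hD, hD, hD.map_zmod, hρ]
      ring

/-- Images of members of a span under a derivation that kills the generators. -/
lemma IsDerivationAlong.addSec_mem_of_frob {κ : Type*} (b : κ → A ⊗[ZMod p] V)
    {s : A ⊗[ZMod p] V}
    (hs : s ∈ Submodule.span A (Set.range fun i => secMap V (frobHom p A) (b i))) :
    addSec V D s ∈
      Submodule.span R (Set.range fun i => secMap V ρ (secMap V (frobHom p A) (b i))) := by
  induction hs using Submodule.span_induction with
  | mem x hx =>
    obtain ⟨i, rfl⟩ := hx
    rw [hD.addSec_frob]
    exact zero_mem _
  | zero => simp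
  | add x y _ _ hx hy => rw [map_add]; exact add_mem hx hy
  | smul a x hx hx' =>
    rw [hD.addSec_smul]
    refine add_mem (Submodule.smul_mem _ _ hx') (Submodule.smul_mem _ _ ?_)
    clear hx'
    induction hx using Submodule.span_induction with
    | mem x hx =>
      obtain ⟨i, rfl⟩ := hx
      exact Submodule.subset_span ⟨i, rfl⟩
    | zero => simp
    | add x y _ _ hx hy => rw [map_add]; exact add_mem hx hy
    | smul a x _ hx => rw [secMap_smul]; exact Submodule.smul_mem _ _ hx

end Derivations

lemma secMap_mem_span {κ : Type*} (φ : A →+* R) (b : κ → A ⊗[ZMod p] V) {s : A ⊗[ZMod p] V}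
    (hs : s ∈ Submodule.span A (Set.range b)) :
    secMap V φ s ∈ Submodule.span R (Set.range fun i => secMap V φ (b i)) := by
  induction hs using Submodule.span_induction with
  | mem x hx =>
    obtain ⟨i, rfl⟩ := hx
    exact Submodule.subset_span ⟨i, rfl⟩
  | zero => simp
  | add x y _ _ hx hy => rw [map_add]; exact add_mem hx hy
  | smul a x _ hx => rw [secMap_smul]; exact Submodule.smul_mem _ _ hx

lemma secMap_span_le {κ κ' : Type*} (φ : A →+* R) {b : κ → A ⊗[ZMod p] V}
    {c : κ' → A ⊗[ZMod p] V} (h : Submodule.span A (Set.range b) ≤ Submodule.span A (Set.range c)) :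
    Submodule.span R (Set.range fun i => secMap V φ (b i)) ≤
      Submodule.span R (Set.range fun i => secMap V φ (c i)) := by
  rw [Submodule.span_le]
  rintro _ ⟨i, rfl⟩
  exact secMap_mem_span φ c (h (Submodule.subset_span ⟨i, rfl⟩))

lemma secMap_span_eq {κ κ' : Type*} (φ : A →+* R) {b : κ → A ⊗[ZMod p] V}
    {c : κ' → A ⊗[ZMod p] V} (h : Submodule.span A (Set.range b) = Submodule.span A (Set.range c)) :
    Submodule.span R (Set.range fun i => secMap V φ (b i)) =
      Submodule.span R (Set.range fun i => secMap V φ (c i)) :=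
  le_antisymm (secMap_span_le φ h.le) (secMap_span_le φ h.ge)

/-! Sections with coefficients in the dual numbers. -/

open TrivSqZeroExt

/-- The projection `R[ε] → R`. -/
def fstSec (s : TrivSqZeroExt R R ⊗[ZMod p] V) : R ⊗[ZMod p] V :=
  secMap V (fstHom R R R).toRingHom s

/-- The coefficient of `ε`. -/
def sndSec (s : TrivSqZeroExt R R ⊗[ZMod p] V) : R ⊗[ZMod p] V :=
  addSec V (sndHom R R).toAddMonoidHom s

/-- The element `s + ε t`. -/
def mkSec (s t : R ⊗[ZMod p] V) : TrivSqZeroExt R R ⊗[ZMod p] V :=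
  secMap V (inlHom R R) s + addSec V (inrHom R R).toAddMonoidHom t

@[simp] lemma fstSec_add (s t : TrivSqZeroExt R R ⊗[ZMod p] V) :
    fstSec (s + t) = fstSec s + fstSec t := map_add _ _ _

@[simp] lemma sndSec_add (s t : TrivSqZeroExt R R ⊗[ZMod p] V) :
    sndSec (s + t) = sndSec s + sndSec t := map_add _ _ _

@[simp] lemma fstSec_zero : fstSec (0 : TrivSqZeroExt R R ⊗[ZMod p] V) = 0 := map_zero _

@[simp] lemma sndSec_zero : sndSec (0 : TrivSqZeroExt R R ⊗[ZMod p] V) = 0 := map_zero _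

@[simp] lemma fstSec_smul (q : TrivSqZeroExt R R) (s : TrivSqZeroExt R R ⊗[ZMod p] V) :
    fstSec (q • s) = q.fst • fstSec s := secMap_smul V _ q s

@[simp] lemma sndSec_smul (q : TrivSqZeroExt R R) (s : TrivSqZeroExt R R ⊗[ZMod p] V) :
    sndSec (q • s) = q.fst • sndSec s + q.snd • fstSec s := by
  have : IsDerivationAlong (fstHom R R R).toRingHom (sndHom R R).toAddMonoidHom := by
    intro a b
    change (a * b).snd = a.fst * b.snd + b.fst * a.snd
    simp [mul_comm]
  exact this.addSec_smul q s

@[simp] lemma fstSec_mkSec (s t : R ⊗[ZMod p] V) : fstSec (mkSec s t) = s := by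
  rw [mkSec, fstSec_add, fstSec, fstSec, secMap_comp, secMap_eq_addSec _ _ (addSec _ _ _),
    addSec_comp]
  have h₁ : (fstHom R R R).toRingHom.comp (inlHom R R) = RingHom.id R := rfl
  have h₂ : (fstHom R R R).toRingHom.toAddMonoidHom.comp (inrHom R R).toAddMonoidHom = 0 := rfl
  rw [h₁, h₂, secMap_id]
  have : addSec (p := p) V (0 : R →+ R) t = 0 := by
    induction t with
    | zero => simp
    | tmul b v => simp
    | add x y hx hy => rw [map_add, hx, hy, add_zero]
  rw [this, add_zero]

@[simp] lemma sndSec_mkSec (s t : R ⊗[ZMod p] V) : sndSec (mkSec s t) = t := by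
  rw [mkSec, sndSec_add, sndSec, sndSec, secMap_eq_addSec, addSec_comp, addSec_comp]
  have h₁ : (sndHom R R).toAddMonoidHom.comp (inlHom R R).toAddMonoidHom = 0 := rfl
  have h₂ : (sndHom R R).toAddMonoidHom.comp (inrHom R R).toAddMonoidHom =
    (RingHom.id R).toAddMonoidHom := rfl
  rw [h₁, h₂, ← secMap_eq_addSec, secMap_id]
  have : addSec (p := p) V (0 : R →+ R) s = 0 := by
    induction s with
    | zero => simp
    | tmul b v => simp
    | add x y hx hy => rw [map_add, hx, hy, add_zero]
  rw [this, zero_add]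

lemma mkSec_fst_snd (s : TrivSqZeroExt R R ⊗[ZMod p] V) : mkSec (fstSec s) (sndSec s) = s := by
  rw [mkSec, fstSec, sndSec, secMap_comp, addSec_comp, secMap_eq_addSec, ← addSec_add]
  have : ((inlHom R R).comp (fstHom R R R).toRingHom).toAddMonoidHom +
      (inrHom R R).toAddMonoidHom.comp (sndHom R R).toAddMonoidHom =
      (RingHom.id (TrivSqZeroExt R R)).toAddMonoidHom := by
    exact AddMonoidHom.ext fun x => inl_fst_add_inr_snd_eq x
  rw [this, ← secMap_eq_addSec, secMap_id]

lemma dualSec_ext {s t : TrivSqZeroExt R R ⊗[ZMod p] V} (h₁ : fstSec s = fstSec t)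
    (h₂ : sndSec s = sndSec t) : s = t := by
  rw [← mkSec_fst_snd s, h₁, h₂, mkSec_fst_snd]

lemma fstSec_secMap (σ : A →+* TrivSqZeroExt R R) (s : A ⊗[ZMod p] V) :
    fstSec (secMap V σ s) = secMap V ((fstHom R R R).toRingHom.comp σ) s := secMap_comp V _ _ _

lemma sndSec_secMap (σ : A →+* TrivSqZeroExt R R) (s : A ⊗[ZMod p] V) :
    sndSec (secMap V σ s) =
      addSec V ((sndHom R R).toAddMonoidHom.comp σ.toAddMonoidHom) s := addSec_comp V _ _ _

/-- Multiplication by `ε` sees only the reduction, so `ε` times the reduction of `y i` equals `ε • y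
i`. -/
lemma inr_smul_mem {κ : Type*} (y : κ → TrivSqZeroExt R R ⊗[ZMod p] V) {m : R ⊗[ZMod p] V}
    (hm : m ∈ Submodule.span R (Set.range fun i => fstSec (y i))) :
    mkSec 0 m ∈ Submodule.span (TrivSqZeroExt R R) (Set.range y) := by
  induction hm using Submodule.span_induction with
  | mem x hx =>
    obtain ⟨i, rfl⟩ := hx
    have : mkSec 0 (fstSec (y i)) = (inr 1 : TrivSqZeroExt R R) • y i :=
      dualSec_ext (by simp) (by simp)
    dsimp only
    rw [this]
    exact Submodule.smul_mem _ _ (Submodule.subset_span ⟨i, rfl⟩)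
  | zero =>
    have : mkSec 0 0 = (0 : TrivSqZeroExt R R ⊗[ZMod p] V) := dualSec_ext (by simp) (by simp)
    rw [this]
    exact zero_mem _
  | add x z _ _ hx hz =>
    have : mkSec 0 (x + z) = (mkSec 0 x + mkSec 0 z : TrivSqZeroExt R R ⊗[ZMod p] V) :=
      dualSec_ext (by simp) (by simp)
    rw [this]
    exact add_mem hx hz
  | smul a x _ hx =>
    have : mkSec 0 (a • x) = (inl a : TrivSqZeroExt R R) • (mkSec 0 x) :=
      dualSec_ext (by simp) (by simp)
    rw [this]
    exact Submodule.smul_mem _ _ hx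

lemma dual_span_le {κ : Type*} {x y : κ → TrivSqZeroExt R R ⊗[ZMod p] V}
    (h₁ : ∀ i, fstSec (x i) = fstSec (y i))
    (h₂ : ∀ i, sndSec (x i) - sndSec (y i) ∈
      Submodule.span R (Set.range fun i => fstSec (y i))) :
    Submodule.span (TrivSqZeroExt R R) (Set.range x) ≤
      Submodule.span (TrivSqZeroExt R R) (Set.range y) := by
  rw [Submodule.span_le]
  rintro _ ⟨i, rfl⟩
  have : x i = y i + mkSec 0 (sndSec (x i) - sndSec (y i)) :=
    dualSec_ext (by simp [h₁]) (by simp)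
  rw [SetLike.mem_coe, this]
  exact add_mem (Submodule.subset_span ⟨i, rfl⟩) (inr_smul_mem y (h₂ i))

/-- Two families over the dual numbers with the same reduction span the same submodule if the
difference of their `ε`-parts lies in the span of the reductions. -/
lemma dual_span_eq {κ : Type*} {x y : κ → TrivSqZeroExt R R ⊗[ZMod p] V}
    (h₁ : ∀ i, fstSec (x i) = fstSec (y i))
    (h₂ : ∀ i, sndSec (x i) - sndSec (y i) ∈
      Submodule.span R (Set.range fun i => fstSec (y i))) :
    Submodule.span (TrivSqZeroExt R R) (Set.range x) =
      Submodule.span (TrivSqZeroExt R R) (Set.range y) := by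
  refine le_antisymm (dual_span_le h₁ h₂) (dual_span_le (fun i => (h₁ i).symm) fun i => ?_)
  rw [← neg_sub]
  simp only [h₁]
  exact neg_mem (h₂ i)

/-- A lift of a basis to the dual numbers is a basis. -/
lemma exists_basis_mkSec {ι : Type} [Fintype ι] (β : Module.Basis ι R (R ⊗[ZMod p] V))
    (y : ι → R ⊗[ZMod p] V) :
    ∃ b : Module.Basis ι (TrivSqZeroExt R R) (TrivSqZeroExt R R ⊗[ZMod p] V),
      ∀ i, b i = mkSec (β i) (y i) := by
  classical
  obtain ⟨b₀, hb₀, hr₀⟩ := exists_basis_secMap (inlHom R R) β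
  obtain ⟨b, hb⟩ := exists_basis_of_isUnit_det b₀ (fun i => mkSec (β i) (y i)) (by
    rw [TrivSqZeroExt.isUnit_iff_isUnit_fst]
    -- Units of the dual numbers are detected modulo `ε`, where the lifted family becomes `β`
    -- itself, with determinant `1` relative to `β`.
    have h : (b₀.det fun i => mkSec (β i) (y i)).fst = 1 := by
      change (fstHom R R R).toRingHom _ = 1
      rw [Module.Basis.det_apply, RingHom.map_det]
      convert Matrix.det_one (R := R) (n := ι) using 2
      ext i j
      obtain ⟨b₁, hb₁, hr₁⟩ := exists_basis_secMap (fstHom R R R).toRingHom b₀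
      rw [RingHom.mapMatrix_apply, Matrix.map_apply, Module.Basis.toMatrix_apply, ← hr₁]
      have e : secMap V (fstHom R R R).toRingHom (mkSec (β j) (y j)) = b₁ j := by
        have h₂ : b₁ j = fstSec (mkSec (β j) 0) := by
          rw [hb₁, hb₀, mkSec, map_zero, add_zero]
          rfl
        rw [h₂, fstSec_mkSec]
        exact fstSec_mkSec _ _
      rw [e, Module.Basis.repr_self, Finsupp.single_apply, Matrix.one_apply]
      simp [eq_comm]
    rw [h]
    exact isUnit_one)
  exact ⟨b, fun i => congr_fun hb i⟩

/-- Frobenius of the dual numbers factors through the reduction, since `(x + ε y) ^ p = x ^ p + p x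
^ (p - 1) y ε` and `p = 0`. Hence `Frob^*` of a first-order deformation does not depend on the
deformation. -/
lemma frob_mkSec (s t : R ⊗[ZMod p] V) :
    secMap V (frobHom p (TrivSqZeroExt R R)) (mkSec s t) =
      mkSec (secMap V (frobHom p R) s) 0 := by
  have h : frobHom p (TrivSqZeroExt R R) =
      ((inlHom R R).comp (frobHom p R)).comp (fstHom R R R).toRingHom := by
    refine RingHom.ext fun x => TrivSqZeroExt.ext ?_ ?_
    · simp
    · have hp0 : (p : R) = 0 := by
        rw [← map_natCast (algebraMap (ZMod p) R), CharP.cast_eq_zero, map_zero]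
      simp [hp0]
  rw [h, ← secMap_comp]
  have : secMap V (fstHom R R R).toRingHom (mkSec s t) = s := fstSec_mkSec s t
  rw [this, mkSec, map_zero, add_zero, secMap_comp]

lemma baseChange_mkSec (B : LinearMap.BilinForm (ZMod p) V) (s t s' t' : R ⊗[ZMod p] V) :
    B.baseChange (TrivSqZeroExt R R) (mkSec s t) (mkSec s' t') =
      inl (B.baseChange R s s') + inr (B.baseChange R t s' + B.baseChange R s t') := by
  refine TrivSqZeroExt.ext ?_ ?_
  · have := secMap_baseChange B (fstHom R R R).toRingHom (mkSec s t) (mkSec s' t')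
    have h : ∀ s t : R ⊗[ZMod p] V, secMap V (fstHom R R R).toRingHom (mkSec s t) = s :=
      fstSec_mkSec
    rw [h, h] at this
    rw [fst_add, fst_inl, fst_inr, add_zero]
    exact this.symm
  · have hd : IsDerivationAlong (fstHom R R R).toRingHom (sndHom R R).toAddMonoidHom := by
      intro a b
      change (a * b).snd = a.fst * b.snd + b.fst * a.snd
      simp [mul_comm]
    have := hd.baseChange B (mkSec s t) (mkSec s' t')
    have h : ∀ s t : R ⊗[ZMod p] V, secMap V (fstHom R R R).toRingHom (mkSec s t) = s :=
      fstSec_mkSec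
    have h' : ∀ s t : R ⊗[ZMod p] V, addSec V (sndHom R R).toAddMonoidHom (mkSec s t) = t :=
      sndSec_mkSec
    rw [h, h, h', h'] at this
    rw [snd_add, snd_inl, snd_inr, zero_add]
    exact this

end Dual

/-! ### Adapted frames -/

section Frames

variable {p : ℕ} [Fact p.Prime] {V : Type u} [AddCommGroup V] [Module (ZMod p) V]
variable {B : LinearMap.BilinForm (ZMod p) V} {d : ℕ}
variable {A R : Type u} [CommRing A] [CommRing R] [Algebra (ZMod p) A] [Algebra (ZMod p) R]

lemma secMap_frob (φ : A →+* R) (s : A ⊗[ZMod p] V) :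
    secMap V φ (secMap V (frobHom p A) s) = secMap V (frobHom p R) (secMap V φ s) := by
  rw [secMap_comp, secMap_comp]
  congr 1
  ext x
  simp

/-- A family together with one more member. -/
abbrev snocFam {M : Type*} {κ : Type} (a : κ → M) (e : M) : κ ⊕ Unit → M :=
  Sum.elim a fun _ => e

lemma comp_snocFam {M N : Type*} {κ : Type} (φ : M → N) (a : κ → M) (e : M) :
    (fun i => φ (snocFam a e i)) = snocFam (fun i => φ (a i)) (φ e) := by
  funext i
  rcases i with i | i <;> rfl

variable (p V B d A) in
/-- A basis of `A ⊗ V` adapted to a flag `L_d ⊆ L_{d+1}` of isotropic submodules such that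
`L_d ⊆ Frob^* L_{d+1}`: here `L_d` is spanned by the `a i`, `L_{d+1}` by the `a i` and `e`, and
`Frob^* L_{d+1}` by the `a i` and `f`. -/
structure Frame where
  /-- the number of members outside `L_{d+1} + Frob^* L_{d+1}` -/
  m : ℕ
  /-- the basis of `L_d` -/
  a : Fin d → A ⊗[ZMod p] V
  /-- the last basis element of `L_{d+1}` -/
  e : A ⊗[ZMod p] V
  /-- the last basis element of `Frob^* L_{d+1}` -/
  f : A ⊗[ZMod p] V
  /-- the other members of the basis -/
  g : Fin m → A ⊗[ZMod p] V
  /-- the basis -/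
  basis : Module.Basis (((Fin d ⊕ Unit) ⊕ Unit) ⊕ Fin m) A (A ⊗[ZMod p] V)
  basis_eq : ⇑basis = Sum.elim (snocFam (snocFam a e) f) g
  form_aa : ∀ i j, B.baseChange A (a i) (a j) = 0
  form_ae : ∀ i, B.baseChange A (a i) e = 0
  form_af : ∀ i, B.baseChange A (a i) f = 0
  form_ee : B.baseChange A e e = 0
  form_ef : IsUnit (B.baseChange A e f)
  span_frob : Submodule.span A (Set.range fun i => secMap V (frobHom p A) (snocFam a e i)) =
    Submodule.span A (Set.range (snocFam a f))

namespace Frame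

/-- Change of rings for frames. -/
def map (F : Frame p V B d A) (φ : A →+* R) : Frame p V B d R where
  m := F.m
  a i := secMap V φ (F.a i)
  e := secMap V φ F.e
  f := secMap V φ F.f
  g i := secMap V φ (F.g i)
  basis := (exists_basis_secMap φ F.basis).choose
  basis_eq := by
    funext i
    rw [(exists_basis_secMap φ F.basis).choose_spec.1, F.basis_eq]
    rcases i with ((i | i) | i) | i <;> rfl
  form_aa i j := by rw [secMap_baseChange, F.form_aa, map_zero]
  form_ae i := by rw [secMap_baseChange, F.form_ae, map_zero]
  form_af i := by rw [secMap_baseChange, F.form_af, map_zero]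
  form_ee := by rw [secMap_baseChange, F.form_ee, map_zero]
  form_ef := by rw [secMap_baseChange]; exact F.form_ef.map φ
  span_frob := by
    have := secMap_span_eq φ F.span_frob
    simp only [secMap_frob, comp_snocFam (secMap V φ)] at this
    rw [← comp_snocFam]
    simpa only [← comp_snocFam (secMap V φ)] using this

variable (F : Frame p V B d A)

lemma linearIndependent_snocFam : LinearIndependent A (snocFam F.a F.e) := by
  have := F.basis.linearIndependent.comp (fun i => Sum.inl (Sum.inl i))
    (Sum.inl_injective.comp Sum.inl_injective)
  convert this using 1
  rw [F.basis_eq]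
  rfl

lemma mem_snocFam {M : Type*} [AddCommGroup M] [Module A M] {κ : Type} {a : κ → M} {e s : M} :
    s ∈ Submodule.span A (Set.range (snocFam a e)) ↔
      ∃ t ∈ Submodule.span A (Set.range a), ∃ c : A, s = t + c • e := by
  rw [Set.Sum.elim_range, Submodule.span_union, Submodule.mem_sup]
  simp only [Set.range_const, Submodule.mem_span_singleton]
  constructor
  · rintro ⟨t, ht, _, ⟨c, rfl⟩, rfl⟩
    exact ⟨t, ht, c, rfl⟩
  · rintro ⟨t, ht, c, rfl⟩
    exact ⟨t, ht, _, ⟨c, rfl⟩, rfl⟩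

lemma form_span_left {κ : Type*} {x : κ → A ⊗[ZMod p] V} {t : A ⊗[ZMod p] V}
    (h : ∀ i, B.baseChange A (x i) t = 0) {s : A ⊗[ZMod p] V}
    (hs : s ∈ Submodule.span A (Set.range x)) : B.baseChange A s t = 0 := by
  have : Submodule.span A (Set.range x) ≤ LinearMap.ker ((B.baseChange A).flip t) := by
    rw [Submodule.span_le]
    rintro _ ⟨i, rfl⟩
    exact h i
  exact this hs

lemma isSymm_baseChange (hB : B.IsSymm) (s t : A ⊗[ZMod p] V) :
    B.baseChange A s t = B.baseChange A t s := by
  induction s with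
  | zero => simp
  | add x y hx hy => simp [hx, hy]
  | tmul a v =>
    induction t with
    | zero => simp
    | add x y hx hy => simp only [map_add, LinearMap.add_apply, hx, hy]
    | tmul b w => simp [mul_comm, hB.eq v w]

/-- A derivation that moves `e` within `L_{d+1} + Frob^* L_{d+1}` preserves the flag. -/
lemma derivation_mem (hB : B.IsSymm) (h2 : IsUnit (2 : R)) {ρ : A →+* R} {D : A →+ R}
    (hD : IsDerivationAlong ρ D)
    (ha : ∀ i, F.a i ∈ Submodule.span A (Set.range (snocFam F.a F.f)))
    (he : addSec V D F.e ∈ Submodule.span R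
      (Set.range (snocFam (snocFam (F.map ρ).a (F.map ρ).e) (F.map ρ).f))) :
    (∀ i, addSec V D (F.a i) ∈ Submodule.span R (Set.range (F.map ρ).a)) ∧
      addSec V D F.e ∈ Submodule.span R (Set.range (snocFam (F.map ρ).a (F.map ρ).e)) := by
  have hfe : IsUnit (B.baseChange R (F.map ρ).f (F.map ρ).e) := by
    rw [isSymm_baseChange hB]; exact (F.map ρ).form_ef
  -- `D e = t + c f` with `t` in `L_{d+1}`; the aim is `c = 0`.
  obtain ⟨t, ht, c, hc⟩ := mem_snocFam.1 he
  have hta : ∀ i, B.baseChange R ((F.map ρ).a i) t = 0 := by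
    intro i
    rw [isSymm_baseChange hB]
    refine form_span_left ?_ ht
    rintro (j | j)
    · exact (F.map ρ).form_aa j i
    · rw [isSymm_baseChange hB]; exact (F.map ρ).form_ae i
  have hte : B.baseChange R t (F.map ρ).e = 0 := by
    refine form_span_left ?_ ht
    rintro (j | j)
    · exact (F.map ρ).form_ae j
    · exact (F.map ρ).form_ee
  -- Differentiating `⟨a i, e⟩ = 0` leaves `-⟨a i, D e⟩`, which vanishes because `a i` is orthogonal
  -- to both `t` and `f`.
  have hDa : ∀ i, B.baseChange R (addSec V D (F.a i)) (F.map ρ).e = 0 := by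
    intro i
    have := hD.baseChange B (F.a i) F.e
    rw [F.form_ae, map_zero] at this
    have h0 : B.baseChange R (secMap V ρ (F.a i)) (addSec V D F.e) = 0 := by
      rw [hc, map_add, map_smul]
      have h₁ := hta i
      have h₂ := (F.map ρ).form_af i
      change B.baseChange R (secMap V ρ (F.a i)) t = 0 at h₁
      change B.baseChange R (secMap V ρ (F.a i)) (F.map ρ).f = 0 at h₂
      rw [h₁, h₂, smul_zero, add_zero]
    rw [h0, add_zero] at this
    exact this.symm
  refine ⟨fun i => ?_, ?_⟩
  -- Since `a i` lies in `Frob^* L_{d+1}`, so does `D (a i)`, and it is a member of `L_d` plus `c'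
  -- f`. Pairing with `e` kills the part in `L_d` and gives `c' ⟨f, e⟩ = 0`.
  · have h₁ : addSec V D (F.a i) ∈
        Submodule.span R (Set.range (snocFam (F.map ρ).a (F.map ρ).f)) := by
      have h₂ := hD.addSec_mem_of_frob (snocFam F.a F.e) (F.span_frob ▸ ha i)
      simp only [secMap_frob] at h₂
      rw [← (F.map ρ).span_frob]
      have h₃ : snocFam (F.map ρ).a (F.map ρ).e = fun i => secMap V ρ (snocFam F.a F.e i) :=
        (comp_snocFam (secMap V ρ) F.a F.e).symm
      rw [h₃]
      exact h₂
    obtain ⟨t', ht', c', hc'⟩ := mem_snocFam.1 h₁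
    have h0 := hDa i
    rw [hc', map_add, LinearMap.add_apply, map_smul, LinearMap.smul_apply,
      form_span_left (fun j => (F.map ρ).form_ae j) ht', zero_add, smul_eq_mul,
      hfe.mul_left_eq_zero] at h0
    rw [hc', h0, zero_smul, add_zero]
    exact ht'
  -- Differentiating `⟨e, e⟩ = 0` gives `2 ⟨D e, e⟩ = 2 c ⟨f, e⟩ = 0`; both `2` and `⟨f, e⟩` are
  -- units.
  · have h0 := hD.baseChange B F.e F.e
    rw [F.form_ee, map_zero, isSymm_baseChange hB (secMap V ρ F.e), ← two_mul, eq_comm,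
      h2.mul_right_eq_zero, hc, map_add, LinearMap.add_apply, map_smul, LinearMap.smul_apply] at h0
    change B.baseChange R t (F.map ρ).e + c • B.baseChange R (F.map ρ).f (F.map ρ).e = 0 at h0
    rw [hte, zero_add, smul_eq_mul, hfe.mul_left_eq_zero] at h0
    rw [hc, h0, zero_smul, add_zero]
    exact ht

/-! ### First-order deformations of a frame. -/

section Deformation

open TrivSqZeroExt

/-- The lift over the dual numbers of the frame `F` that moves `e` in the direction of `v`, modulo
`Frob^* L_{d+1}`. -/
structure Deformation (F : Frame p V B d A) (v : A ⊗[ZMod p] V) where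
  /-- the lifted basis -/
  basis : Module.Basis (((Fin d ⊕ Unit) ⊕ Unit) ⊕ Fin F.m) (TrivSqZeroExt A A)
    (TrivSqZeroExt A A ⊗[ZMod p] V)
  /-- the lift of the basis of `L_d` -/
  a : Fin d → TrivSqZeroExt A A ⊗[ZMod p] V
  /-- the lift of `e` -/
  e : TrivSqZeroExt A A ⊗[ZMod p] V
  /-- the lift of `f` -/
  f : TrivSqZeroExt A A ⊗[ZMod p] V
  basis_eq : ∀ i, basis (Sum.inl i) = snocFam (snocFam a e) f i
  fst_a : ∀ i, fstSec (a i) = F.a i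
  fst_e : fstSec e = F.e
  snd_e : ∃ c : A, sndSec e = v + c • F.f
  isotropic : ∀ i j, B.baseChange (TrivSqZeroExt A A) (snocFam a e i) (snocFam a e j) = 0
  a_mem : ∀ i, a i ∈ Submodule.span (TrivSqZeroExt A A) (Set.range fun i =>
    secMap V (frobHom p (TrivSqZeroExt A A)) (snocFam a e i))
  f_mem : f ∈ Submodule.span (TrivSqZeroExt A A) (Set.range fun i =>
    secMap V (frobHom p (TrivSqZeroExt A A)) (snocFam a e i))
  frob_mem : ∀ i, secMap V (frobHom p (TrivSqZeroExt A A)) (snocFam a e i) ∈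
    Submodule.span (TrivSqZeroExt A A) (Set.range (snocFam (snocFam a e) f))

/-- The lift is `a i + ε φ i f`, `e + ε v'`, `f`, where `v'` is `v` plus a multiple of `f`. Isotropy
holds once `⟨e, v'⟩ = 0` and `φ i ⟨f, e⟩ + ⟨a i, v'⟩ = 0`, and both can be solved because `⟨e, f⟩`
is a unit. The Frobenius pull-back of the new module is the constant extension of the span of the `a
i` and `f`, which contains every `a i + ε φ i f`. -/
lemma exists_deformation (hB : B.IsSymm) (v : A ⊗[ZMod p] V)  :
    Nonempty (F.Deformation v) := by
  obtain ⟨w, hw⟩ := F.form_ef.exists_right_inv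
  -- Here `w` is the inverse of `⟨e, f⟩`; the multiple of `f` is the one that makes `v'` orthogonal
  -- to `e`.
  let v' := v + (-(B.baseChange A F.e v * w)) • F.f
  have hev' : B.baseChange A F.e v' = 0 := by
    simp only [v', map_add, map_smul, smul_eq_mul]
    linear_combination (-B.baseChange A F.e v) * hw
  let φ : Fin d → A := fun i => -(B.baseChange A (F.a i) v' * w)
  obtain ⟨b, hb⟩ := exists_basis_mkSec F.basis
    (Sum.elim (snocFam (snocFam (fun i => φ i • F.f) v') 0) 0)
  rw [F.basis_eq] at hb
  let a' : Fin d → TrivSqZeroExt A A ⊗[ZMod p] V := fun i => mkSec (F.a i) (φ i • F.f)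
  have hfrob : ∀ i, secMap V (frobHom p (TrivSqZeroExt A A)) (snocFam a' (mkSec F.e v') i) =
      secMap V (inlHom A A) (secMap V (frobHom p A) (snocFam F.a F.e i)) := by
    rintro (i | i)
    · exact (frob_mkSec _ _).trans (by rw [mkSec, map_zero, add_zero]; rfl)
    · exact (frob_mkSec _ _).trans (by rw [mkSec, map_zero, add_zero]; rfl)
  have hspan := secMap_span_eq (inlHom A A) F.span_frob
  have hf : mkSec F.f 0 = secMap V (inlHom A A) F.f := by rw [mkSec, map_zero, add_zero]
  have hfs : secMap V (inlHom A A) F.f ∈ Submodule.span (TrivSqZeroExt A A)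
      (Set.range fun i => secMap V (inlHom A A) (snocFam F.a F.f i)) :=
    Submodule.subset_span ⟨Sum.inr (), rfl⟩
  have has : ∀ i, secMap V (inlHom A A) (F.a i) ∈ Submodule.span (TrivSqZeroExt A A)
      (Set.range fun i => secMap V (inlHom A A) (snocFam F.a F.f i)) := fun i =>
    Submodule.subset_span ⟨Sum.inl i, rfl⟩
  have ha' : ∀ i, a' i = secMap V (inlHom A A) (F.a i) +
      (inr (φ i) : TrivSqZeroExt A A) • secMap V (inlHom A A) F.f := by
    intro i
    have h : ∀ s : A ⊗[ZMod p] V, secMap V (inlHom A A) s = mkSec s 0 := fun s => by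
      rw [mkSec, map_zero, add_zero]
    rw [h, h]
    refine dualSec_ext ?_ ?_
    · rw [fstSec_add, fstSec_smul, fst_inr]
      simp [a']
    · rw [sndSec_add, sndSec_smul, fst_inr, snd_inr]
      simp [a']
  refine ⟨{
    basis := b
    a := a'
    e := mkSec F.e v'
    f := mkSec F.f 0
    basis_eq := ?_
    fst_a := fun i => fstSec_mkSec _ _
    fst_e := fstSec_mkSec _ _
    snd_e := ⟨-(B.baseChange A F.e v * w), sndSec_mkSec _ _⟩
    isotropic := ?_
    a_mem := ?_
    f_mem := ?_
    frob_mem := ?_ }⟩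
  · rintro ((i | i) | i) <;> exact hb _
  · have hae : ∀ i, B.baseChange (TrivSqZeroExt A A) (a' i) (mkSec F.e v') = 0 := by
      intro i
      rw [baseChange_mkSec, F.form_ae, map_smul, LinearMap.smul_apply,
        isSymm_baseChange hB F.f, smul_eq_mul]
      have : φ i * B.baseChange A F.e F.f + B.baseChange A (F.a i) v' = 0 := by
        simp only [φ]
        linear_combination (-B.baseChange A (F.a i) v') * hw
      rw [this, inl_zero, inr_zero, add_zero]
    rintro (i | i) (j | j)
    · change B.baseChange (TrivSqZeroExt A A) (mkSec _ _) (mkSec _ _) = 0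
      rw [baseChange_mkSec, F.form_aa, map_smul, LinearMap.smul_apply, map_smul,
        isSymm_baseChange hB F.f, F.form_af, F.form_af]
      simp
    · exact hae i
    · rw [isSymm_baseChange hB]
      exact hae j
    · change B.baseChange (TrivSqZeroExt A A) (mkSec _ _) (mkSec _ _) = 0
      rw [baseChange_mkSec, F.form_ee, isSymm_baseChange hB v', hev']
      simp
  · intro i
    simp only [hfrob]
    rw [hspan, ha']
    exact add_mem (has i) (Submodule.smul_mem _ _ hfs)
  · simp only [hfrob]
    rw [hspan, hf]
    exact hfs
  · intro i
    rw [hfrob]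
    have h₁ : secMap V (inlHom A A) (secMap V (frobHom p A) (snocFam F.a F.e i)) ∈
        Submodule.span (TrivSqZeroExt A A)
          (Set.range fun i => secMap V (inlHom A A) (snocFam F.a F.f i)) := by
      rw [← hspan]
      exact Submodule.subset_span ⟨i, rfl⟩
    refine Submodule.span_le.2 ?_ h₁
    have hfm : secMap V (inlHom A A) F.f ∈ Submodule.span (TrivSqZeroExt A A)
        (Set.range (snocFam (snocFam a' (mkSec F.e v')) (mkSec F.f 0))) := by
      rw [← hf]
      exact Submodule.subset_span ⟨Sum.inr (), rfl⟩
    -- The constant lift of `a j` is recovered as `(a j + ε φ j f) - ε φ j f`.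
    rintro _ ⟨j | j, rfl⟩
    · have := ha' j
      rw [← sub_eq_iff_eq_add] at this
      change secMap V (inlHom A A) (F.a j) ∈ _
      rw [← this]
      exact sub_mem (Submodule.subset_span ⟨Sum.inl (Sum.inl j), rfl⟩)
        (Submodule.smul_mem _ _ hfm)
    · exact hfm

/-- In an expansion of `s` in the `x i`, independence of the reductions forces every coefficient to
be a multiple of `ε`, and then only the reductions of the `x i` contribute to the `ε`-part. -/
lemma sndSec_mem {κ : Type*} [Fintype κ] {x : κ → TrivSqZeroExt A A ⊗[ZMod p] V}
    (hx : LinearIndependent A fun i => fstSec (x i)) {s : TrivSqZeroExt A A ⊗[ZMod p] V}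
    (hs : s ∈ Submodule.span (TrivSqZeroExt A A) (Set.range x)) (h0 : fstSec s = 0) :
    sndSec s ∈ Submodule.span A (Set.range fun i => fstSec (x i)) := by
  obtain ⟨c, rfl⟩ := (Submodule.mem_span_range_iff_exists_fun _).1 hs
  have h₁ : ∀ S : Finset κ, fstSec (∑ i ∈ S, c i • x i) = ∑ i ∈ S, (c i).fst • fstSec (x i) :=
    fun S => (map_sum (secMap V (fstHom A A A).toRingHom) _ S).trans
      (Finset.sum_congr rfl fun i _ => fstSec_smul _ _)
  have h₂ : ∀ S : Finset κ, sndSec (∑ i ∈ S, c i • x i) =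
      ∑ i ∈ S, ((c i).fst • sndSec (x i) + (c i).snd • fstSec (x i)) :=
    fun S => (map_sum (addSec V (sndHom A A).toAddMonoidHom) _ S).trans
      (Finset.sum_congr rfl fun i _ => sndSec_smul _ _)
  rw [h₁] at h0
  have h₃ := Fintype.linearIndependent_iff.1 hx _ h0
  rw [h₂]
  refine Submodule.sum_mem _ fun i _ => ?_
  rw [h₃ i, zero_smul, zero_add]
  exact Submodule.smul_mem _ _ (Submodule.subset_span ⟨i, rfl⟩)

variable {F} in
-- The deformed module determines the direction `v` modulo `L_{d+1} + Frob^* L_{d+1}`: two of its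
-- vectors above `e` differ by one that reduces to zero, whose `ε`-part lies in `L_{d+1}`, and the
-- chosen lift of `e` has `ε`-part `v` up to a multiple of `f`.
lemma Deformation.sndSec_sub_mem {v : A ⊗[ZMod p] V} (G : F.Deformation v)
    {s : TrivSqZeroExt A A ⊗[ZMod p] V}
    (hs : s ∈ Submodule.span (TrivSqZeroExt A A) (Set.range (snocFam G.a G.e)))
    (h : fstSec s = F.e) :
    sndSec s - v ∈ Submodule.span A (Set.range (snocFam (snocFam F.a F.e) F.f)) := by
  have e₁ : (fun i => fstSec (snocFam G.a G.e i)) = snocFam F.a F.e := by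
    rw [comp_snocFam fstSec, G.fst_e]
    simp only [G.fst_a]
  obtain ⟨c, hc⟩ := G.snd_e
  have h₁ := sndSec_mem (x := snocFam G.a G.e) (by rw [e₁]; exact F.linearIndependent_snocFam)
    (sub_mem hs (Submodule.subset_span ⟨Sum.inr (), rfl⟩)) (by
      have := map_sub (secMap V (fstHom A A A).toRingHom) s G.e
      refine this.trans ?_
      change fstSec s - fstSec G.e = 0
      rw [h, G.fst_e, sub_self])
  have h₂ : sndSec (s - snocFam G.a G.e (Sum.inr ())) = sndSec s - sndSec G.e :=
    map_sub (addSec V (sndHom A A).toAddMonoidHom) s G.e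
  rw [e₁, h₂, hc] at h₁
  refine mem_snocFam.2 ⟨_, h₁, c, ?_⟩
  abel

end Deformation

end Frame

end Frames

/-! ### Morphisms of sheaves of modules and their sections -/

section ModulesHom

variable {X : Scheme.{u}}

/-- A morphism of sheaves of modules from its maps on sections. -/
def modHom {N N' : X.Modules} (φ : ∀ U : X.Opens, Γ(N, U) →ₗ[Γ(X, U)] Γ(N', U))
    (hφ : ∀ {U W : X.Opens} (h : W ≤ U) (s : Γ(N, U)), φ W (mres N h s) = mres N' h (φ U s)) :
    N ⟶ N' :=
  SheafOfModules.Hom.mk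
    { app := fun U => ModuleCat.ofHom (X := N.val.obj U) (Y := N'.val.obj U) (φ U.unop)
      naturality := fun {U W} i => by
        ext s
        exact hφ i.unop.le s }

lemma app_mres {N N' : X.Modules} (φ : N ⟶ N') {U W : X.Opens} (h : W ≤ U) (s : Γ(N, U)) :
    φ.app W (mres N h s) = mres N' h (φ.app U s) := by
  have := φ.mapPresheaf.naturality (homOfLE h).op
  exact ConcreteCategory.congr_hom this s

lemma modHom_ext {N N' : X.Modules} {φ ψ : N ⟶ N'}
    (h : ∀ (U : X.Opens) (s : Γ(N, U)), φ.app U s = ψ.app U s) : φ = ψ :=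
  Scheme.Modules.hom_ext _ _ fun U => by
    ext s
    exact h U s

/-- A family of bijective linear maps on sections gives an isomorphism. -/
lemma nonempty_iso_of_bijective {N N' : X.Modules} (φ : ∀ U : X.Opens, Γ(N, U) →ₗ[Γ(X, U)] Γ(N', U))
    (hφ : ∀ {U W : X.Opens} (h : W ≤ U) (s : Γ(N, U)), φ W (mres N h s) = mres N' h (φ U s))
    (hb : ∀ U, Function.Bijective (φ U)) : Nonempty (N ≅ N') := by
  let ψ : ∀ U : X.Opens, Γ(N', U) →ₗ[Γ(X, U)] Γ(N, U) := fun U =>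
    (LinearEquiv.ofBijective (φ U) (hb U)).symm.toLinearMap
  have h₁ : ∀ U s, φ U (ψ U s) = s := fun U s =>
    (LinearEquiv.ofBijective (φ U) (hb U)).apply_symm_apply s
  have h₂ : ∀ U s, ψ U (φ U s) = s := fun U s =>
    (LinearEquiv.ofBijective (φ U) (hb U)).symm_apply_apply s
  refine ⟨⟨modHom φ hφ, modHom ψ fun {U W} h s => (hb W).1 ?_, ?_, ?_⟩⟩
  · rw [h₁, hφ, h₁]
  · exact modHom_ext fun U s => h₂ U s
  · exact modHom_ext fun U s => h₁ U s

lemma mres_glue' (N : X.Modules) (W : X.Opens) {ι : Type u} (Z : ι → X.Opens) (hZ : ∀ i, Z i ≤ W)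
    (hW : W ≤ iSup Z) (s : ∀ i, Γ(N, Z i))
    (hs : ∀ i j, mres N (inf_le_left : Z i ⊓ Z j ≤ Z i) (s i) =
      mres N (inf_le_right : Z i ⊓ Z j ≤ Z j) (s j)) :
    ∃ t : Γ(N, W), ∀ i, mres N (hZ i) t = s i := by
  obtain rfl : W = iSup Z := le_antisymm hW (iSup_le hZ)
  exact mres_glue N Z s hs

/-- The explicit data of a subsheaf of a sheaf of modules. -/
def subModData (N : X.Modules) (P : ∀ U : X.Opens, Submodule Γ(X, U) Γ(N, U))
    (hres : ∀ {U W : X.Opens} (h : W ≤ U) {s : Γ(N, U)}, s ∈ P U → mres N h s ∈ P W)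
    (hloc : ∀ {U : X.Opens} (s : Γ(N, U)),
      (∀ x ∈ U, ∃ (W : X.Opens) (h : W ≤ U), x ∈ W ∧ mres N h s ∈ P W) → s ∈ P U) :
    ModData X where
  obj U := P U
  res h :=
    { toFun := fun s => ⟨mres N h s.1, hres h s.2⟩
      map_zero' := Subtype.ext (map_zero _)
      map_add' := fun s t => Subtype.ext (map_add _ s.1 t.1) }
  res_self h s := Subtype.ext (mres_self N h s.1)
  res_res h h' s := Subtype.ext (mres_res N h h' s.1)
  res_smul h a s := Subtype.ext (mres_smul N h a s.1)
  sep {U} s hs := by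
    refine Subtype.ext (mres_sep N s.1 0 fun x hx => ?_)
    obtain ⟨W, h, hxW, e⟩ := hs x hx
    exact ⟨W, h, hxW, (congrArg Subtype.val e).trans (map_zero _).symm⟩
  glue {ι} U s hs := by
    obtain ⟨t, ht⟩ := mres_glue N U (fun i => (s i).1) fun i j => congrArg Subtype.val (hs i j)
    refine ⟨⟨t, hloc t fun x hx => ?_⟩, fun i => Subtype.ext (ht i)⟩
    obtain ⟨i, hi⟩ := Opens.mem_iSup.1 hx
    refine ⟨U i, le_iSup U i, hi, ?_⟩
    rw [ht i]
    exact (s i).2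

/-- The maps on sections of a morphism of sheaves of modules. -/
def appLin {N N' : X.Modules} (φ : N ⟶ N') (U : X.Opens) : Γ(N, U) →ₗ[Γ(X, U)] Γ(N', U) where
  toFun s := φ.app U s
  map_add' s t := map_add (φ.app U).hom s t
  map_smul' a s := Scheme.Modules.Hom.app_smul φ a s

lemma appLin_mres {N N' : X.Modules} (φ : N ⟶ N') {U W : X.Opens} (h : W ≤ U) (s : Γ(N, U)) :
    appLin φ W (mres N h s) = mres N' h (appLin φ U s) := app_mres φ h s

lemma appLin_comp {N N' N'' : X.Modules} (φ : N ⟶ N') (ψ : N' ⟶ N'') (U : X.Opens)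
    (s : Γ(N, U)) : appLin (φ ≫ ψ) U s = appLin ψ U (appLin φ U s) := rfl

/-- The inclusion of a subsheaf of a sheaf of modules. -/
def subModIncl (N : X.Modules) (P : ∀ U : X.Opens, Submodule Γ(X, U) Γ(N, U))
    (hres : ∀ {U W : X.Opens} (h : W ≤ U) {s : Γ(N, U)}, s ∈ P U → mres N h s ∈ P W)
    (hloc : ∀ {U : X.Opens} (s : Γ(N, U)),
      (∀ x ∈ U, ∃ (W : X.Opens) (h : W ≤ U), x ∈ W ∧ mres N h s ∈ P W) → s ∈ P U) :
    (subModData N P hres hloc).toModules ⟶ N :=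
  modHom (N := (subModData N P hres hloc).toModules) (fun U => (P U).subtype) (fun _ _ => rfl)

lemma mono_of_injective {N N' : X.Modules} (φ : N ⟶ N')
    (h : ∀ U, Function.Injective (appLin φ U)) : Mono φ :=
  ⟨fun α β e => modHom_ext fun U s => h U <| by
    have := congrArg (fun φ => appLin φ U s) e
    exact this⟩

/-- Epimorphisms of sheaves of modules are locally surjective. -/
lemma locally_surjective_of_epi {N Q : X.Modules} (π : N ⟶ Q) [Epi π] {U : X.Opens} (q : Γ(Q, U))
    {x : X} (hx : x ∈ U) :
    ∃ (W : X.Opens) (hW : W ≤ U) (_ : x ∈ W) (t : Γ(N, W)), appLin π W t = mres Q hW q := by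
  -- `P` is the image sheaf. Its inclusion into `Q` is mono, and it is epi because `π` factors
  -- through it; in an abelian category it is therefore an isomorphism.
  let P : ∀ U : X.Opens, Submodule Γ(X, U) Γ(Q, U) := fun U =>
    { carrier := {q | ∀ x ∈ U, ∃ (W : X.Opens) (hW : W ≤ U) (_ : x ∈ W) (t : Γ(N, W)),
          appLin π W t = mres Q hW q}
      add_mem' := by
        intro q q' hq hq' x hx
        obtain ⟨W, hW, hxW, t, ht⟩ := hq x hx
        obtain ⟨W', hW', hxW', t', ht'⟩ := hq' x hx
        refine ⟨W ⊓ W', inf_le_left.trans hW, ⟨hxW, hxW'⟩,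
          mres N inf_le_left t + mres N inf_le_right t', ?_⟩
        rw [map_add, appLin_mres, appLin_mres, ht, ht', mres_res, mres_res, map_add]
      zero_mem' := fun x hx => ⟨U, le_rfl, hx, 0, by rw [map_zero, map_zero]⟩
      smul_mem' := by
        intro a q hq x hx
        obtain ⟨W, hW, hxW, t, ht⟩ := hq x hx
        refine ⟨W, hW, hxW, ores _ hW a • t, ?_⟩
        rw [map_smul, ht, mres_smul]
        rfl }
  have hres : ∀ {U W : X.Opens} (h : W ≤ U) {s : Γ(Q, U)}, s ∈ P U → mres Q h s ∈ P W := by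
    intro U W hW q hq x hx
    obtain ⟨Z, hZ, hxZ, t, ht⟩ := hq x (hW hx)
    refine ⟨W ⊓ Z, inf_le_left, ⟨hx, hxZ⟩, mres N inf_le_right t, ?_⟩
    rw [appLin_mres, ht, mres_res, mres_res]
  have hloc : ∀ {U : X.Opens} (s : Γ(Q, U)),
      (∀ x ∈ U, ∃ (W : X.Opens) (h : W ≤ U), x ∈ W ∧ mres Q h s ∈ P W) → s ∈ P U := by
    intro U q hq x hx
    obtain ⟨W, hW, hxW, hq'⟩ := hq x hx
    obtain ⟨Z, hZ, hxZ, t, ht⟩ := hq' x hxW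
    exact ⟨Z, hZ.trans hW, hxZ, t, by rw [ht, mres_res]⟩
  let ι := subModIncl Q P hres hloc
  let π' : N ⟶ (subModData Q P hres hloc).toModules :=
    modHom (N := N) (N' := (subModData Q P hres hloc).toModules)
      (fun U => LinearMap.codRestrict (P U) (appLin π U)
        (fun s x hx => ⟨U, le_rfl, hx, s, (mres_self _ _ _).symm⟩))
      (fun h s => Subtype.ext (appLin_mres π h s))
  have hπ : π' ≫ ι = π := rfl
  have : Mono ι := mono_of_injective _ fun U => Subtype.val_injective
  have : Epi ι := by
    have : Epi (π' ≫ ι) := hπ ▸ inferInstance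
    exact epi_of_epi π' ι
  have : IsIso ι := isIso_of_mono_of_epi ι
  have h₁ : appLin ι U (appLin (inv ι) U q) = q := by
    rw [← appLin_comp, IsIso.inv_hom_id]
    rfl
  have h₂ : appLin ι U (appLin (inv ι) U q) ∈ P U := (show P U from appLin (inv ι) U q).2
  rw [h₁] at h₂
  exact h₂ x hx

/-- A monomorphism is the kernel of its cokernel, also on sections. -/
lemma exists_of_app_cokernel_eq_zero {L N : X.Modules} (i : L ⟶ N) [Mono i] {U : X.Opens}
    (s : Γ(N, U)) (hs : appLin (Limits.cokernel.π i) U s = 0) : ∃ t, appLin i U t = s := by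
  let π := Limits.cokernel.π i
  let P : ∀ U : X.Opens, Submodule Γ(X, U) Γ(N, U) := fun U => LinearMap.ker (appLin π U)
  have hres : ∀ {U W : X.Opens} (h : W ≤ U) {s : Γ(N, U)}, s ∈ P U → mres N h s ∈ P W := by
    intro U W h s hs
    change appLin π W _ = 0
    rw [appLin_mres, LinearMap.mem_ker.1 hs, map_zero]
  have hloc : ∀ {U : X.Opens} (s : Γ(N, U)),
      (∀ x ∈ U, ∃ (W : X.Opens) (h : W ≤ U), x ∈ W ∧ mres N h s ∈ P W) → s ∈ P U := by
    intro U s hs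
    refine mres_sep _ _ _ fun x hx => ?_
    obtain ⟨W, hW, hxW, e⟩ := hs x hx
    refine ⟨W, hW, hxW, ?_⟩
    rw [map_zero, ← appLin_mres]
    exact e
  -- The sectionwise kernel of the cokernel projection is a subsheaf of `N`. The universal property
  -- of `i` as kernel of its cokernel factors its inclusion through `i`.
  let ι := subModIncl N P hres hloc
  have hι : ι ≫ π = 0 := modHom_ext fun U s => (show P U from s).2
  let hk := Abelian.monoIsKernelOfCokernel _ (Limits.cokernelIsCokernel i)
  obtain ⟨l, hl⟩ := Limits.KernelFork.IsLimit.lift' hk ι hι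
  refine ⟨appLin l U (show P U from ⟨s, hs⟩), ?_⟩
  have h₁ : appLin (l ≫ i) U (show P U from ⟨s, hs⟩) = s := by
    have : l ≫ i = ι := hl
    rw [this]
    rfl
  exact h₁

end ModulesHom

/-! ### Sections of quotients of subsheaves of `V ⊗ 𝒪_X` -/

section Quotient

namespace Subsheaf

variable {p : ℕ} [Fact p.Prime] {k : Type u} [Field k] [Algebra (ZMod p) k]
variable {V : Type u} [AddCommGroup V] [Module (ZMod p) V] [Module.Finite (ZMod p) V]
variable {X : SchemeOver k} {L M : Subsheaf p V X} (h : L ≤ M)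

/-- The projection `M → M / L`. -/
def projHom : M.toModules ⟶ quotient h := Limits.cokernel.π (incl h)

instance : Epi (projHom h) := inferInstanceAs (Epi (Limits.cokernel.π (incl h)))

/-- The projection `M → M / L` on sections. -/
def proj (U : X.left.Opens) : M.obj U →ₗ[Γ(X.left, U)] Γ(quotient h, U) :=
  appLin (projHom h) U

lemma proj_res {U W : X.left.Opens} (hW : W ≤ U) (s : M.obj U) :
    proj h W ⟨res V X hW s.1, M.res_mem hW s.2⟩ = mres _ hW (proj h U s) :=
  appLin_mres (projHom h) hW s

lemma proj_eq_zero {U : X.left.Opens} (s : M.obj U) (hs : s.1 ∈ L.obj U) : proj h U s = 0 := by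
  have : incl h ≫ projHom h = 0 := Limits.cokernel.condition (incl h)
  have := congrArg (fun φ => appLin φ U (show Γ(L.toModules, U) from (⟨s.1, hs⟩ : L.obj U))) this
  exact this

instance mono_incl : Mono (incl h) :=
  mono_of_injective _ fun U s t e => Subtype.ext (congrArg (fun z : M.obj U => z.1) e)

lemma mem_of_proj_eq_zero {U : X.left.Opens} (s : M.obj U) (hs : proj h U s = 0) :
    s.1 ∈ L.obj U := by
  obtain ⟨t, ht⟩ := exists_of_app_cokernel_eq_zero (incl h) s hs
  have h₂ : (show L.obj U from t).1 = s.1 := congrArg (fun z : M.obj U => z.1) ht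
  exact h₂ ▸ (show L.obj U from t).2

lemma proj_locally_surjective {U : X.left.Opens} (q : Γ(quotient h, U)) {x : X.left} (hx : x ∈ U) :
    ∃ (W : X.left.Opens) (hW : W ≤ U) (_ : x ∈ W) (t : M.obj W), proj h W t = mres _ hW q :=
  locally_surjective_of_epi (projHom h) q hx

variable {N : X.left.Modules} {U : X.left.Opens}

/-- Two homomorphisms out of a quotient agree if they agree on the images of sections. -/
lemma homOn_quotient_ext {φ ψ : homOn (quotient h) N U}
    (e : ∀ (W : {W : X.left.Opens // W ≤ U}) (s : M.obj W.1),
      φ.1 W (proj h W.1 s) = ψ.1 W (proj h W.1 s)) : φ = ψ := by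
  ext W q
  refine mres_sep N _ _ fun x hx => ?_
  obtain ⟨W', hW', hxW', t, ht⟩ := proj_locally_surjective h q hx
  refine ⟨W', hW', hxW', ?_⟩
  rw [← φ.2 W ⟨W', hW'.trans W.2⟩ hW', ← ψ.2 W ⟨W', hW'.trans W.2⟩ hW', ← ht]
  exact e ⟨W', hW'.trans W.2⟩ t

/-- A compatible family of maps on `M` that kill `L` descends to `M / L`. -/
lemma exists_homOn_quotient
    (θ : ∀ W : {W : X.left.Opens // W ≤ U}, M.obj W.1 →ₗ[Γ(X.left, W.1)] Γ(N, W.1))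
    (hθ : ∀ (W W' : {W : X.left.Opens // W ≤ U}) (hW : W'.1 ≤ W.1) (s : M.obj W.1),
      θ W' ⟨res V X hW s.1, M.res_mem hW s.2⟩ = mres N hW (θ W s))
    (hL : ∀ W (s : M.obj W.1), s.1 ∈ L.obj W.1 → θ W s = 0) :
    ∃ φ : homOn (quotient h) N U, ∀ W s, φ.1 W (proj h W.1 s) = θ W s := by
  have hwd : ∀ (W : {W : X.left.Opens // W ≤ U}) (s t : M.obj W.1),
      proj h W.1 s = proj h W.1 t → θ W s = θ W t := by
    intro W s t hst
    rw [← sub_eq_zero, ← map_sub]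
    exact hL W _ (mem_of_proj_eq_zero h _ (by rw [map_sub, hst, sub_self]))
  -- The projection is surjective only locally, so the value at `q` is glued from `θ` of local lifts
  -- of `q`. Prescribing it for all local lifts makes it independent of choices.
  have ex : ∀ (W : {W : X.left.Opens // W ≤ U}) (q : Γ(quotient h, W.1)), ∃ r : Γ(N, W.1),
      ∀ (W' : X.left.Opens) (hW : W' ≤ W.1) (t : M.obj W'), proj h W' t = mres _ hW q →
        mres N hW r = θ ⟨W', hW.trans W.2⟩ t := by
    intro W q
    choose Z hZ hxZ t ht using fun x : W.1 => proj_locally_surjective h q x.2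
    have comp : ∀ (x : W.1) (W' : X.left.Opens) (hW : W' ≤ W.1) (t' : M.obj W')
        (_ : proj h W' t' = mres _ hW q) (Y : X.left.Opens) (hY : Y ≤ Z x) (hY' : Y ≤ W'),
        mres N hY (θ ⟨Z x, (hZ x).trans W.2⟩ (t x)) = mres N hY' (θ ⟨W', hW.trans W.2⟩ t') := by
      intro x W' hW t' ht' Y hY hY'
      rw [← hθ ⟨Z x, (hZ x).trans W.2⟩ ⟨Y, hY.trans ((hZ x).trans W.2)⟩ hY,
        ← hθ ⟨W', hW.trans W.2⟩ ⟨Y, hY.trans ((hZ x).trans W.2)⟩ hY']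
      refine hwd _ _ _ ?_
      rw [proj_res, proj_res, ht, ht', mres_res, mres_res]
    obtain ⟨r, hr⟩ := mres_glue' N W.1 Z hZ
      (fun x hx => Opens.mem_iSup.2 ⟨⟨x, hx⟩, hxZ ⟨x, hx⟩⟩)
      (fun x => θ ⟨Z x, (hZ x).trans W.2⟩ (t x))
      (fun x y => comp x (Z y) (hZ y) (t y) (ht y) _ _ _)
    refine ⟨r, fun W' hW t' ht' => mres_sep N _ _ fun x hx => ?_⟩
    refine ⟨W' ⊓ Z ⟨x, hW hx⟩, inf_le_left, ⟨hx, hxZ ⟨x, hW hx⟩⟩, ?_⟩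
    rw [← comp ⟨x, hW hx⟩ W' hW t' ht' (W' ⊓ Z ⟨x, hW hx⟩) inf_le_right inf_le_left, ← hr,
      mres_res, mres_res]
  choose r hr using ex
  have uniq : ∀ (W : {W : X.left.Opens // W ≤ U}) (q : Γ(quotient h, W.1)) (r' : Γ(N, W.1)),
      (∀ (W' : X.left.Opens) (hW : W' ≤ W.1) (t : M.obj W'), proj h W' t = mres _ hW q →
        mres N hW r' = θ ⟨W', hW.trans W.2⟩ t) → r W q = r' := by
    intro W q r' hr'
    refine mres_sep N _ _ fun x hx => ?_
    obtain ⟨W', hW', hxW', t, ht⟩ := proj_locally_surjective h q hx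
    exact ⟨W', hW', hxW', by rw [hr W q W' hW' t ht, hr' W' hW' t ht]⟩
  -- Identities that involve two sections of the quotient may be checked on open subsets where both
  -- lift to `M`.
  have loc : ∀ (W : {W : X.left.Opens // W ≤ U}) (r₁ r₂ : Γ(N, W.1)) (q q' : Γ(quotient h, W.1)),
      (∀ (W' : X.left.Opens) (hW : W' ≤ W.1) (t t' : M.obj W'), proj h W' t = mres _ hW q →
        proj h W' t' = mres _ hW q' → mres N hW r₁ = mres N hW r₂) → r₁ = r₂ := by
    intro W r₁ r₂ q q' hloc
    refine mres_sep N _ _ fun x hx => ?_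
    obtain ⟨W₁, hW₁, hx₁, t, ht⟩ := proj_locally_surjective h q hx
    obtain ⟨W₂, hW₂, hx₂, t', ht'⟩ := proj_locally_surjective h q' hx
    refine ⟨W₁ ⊓ W₂, inf_le_left.trans hW₁, ⟨hx₁, hx₂⟩,
      hloc _ _ ⟨_, M.res_mem inf_le_left t.2⟩ ⟨_, M.res_mem inf_le_right t'.2⟩ ?_ ?_⟩
    · rw [proj_res, ht, mres_res]
    · rw [proj_res, ht', mres_res]
  refine ⟨⟨fun W =>
    { toFun := r W
      map_add' := fun q q' => loc W _ _ q q' fun W' hW t t' ht ht' => ?_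
      map_smul' := fun a q => loc W _ _ q q fun W' hW t t' ht ht' => ?_ },
    fun W W' hW q => uniq W' _ _ fun W'' hW'' t ht => ?_⟩, fun W s => uniq W _ _ fun W' hW t ht => ?_⟩
  · rw [map_add, hr W q W' hW t ht, hr W q' W' hW t' ht', ← map_add]
    exact hr W (q + q') W' hW (t + t') (by rw [map_add, map_add, ht, ht'])
  · rw [RingHom.id_apply, mres_smul, hr W q W' hW t ht, ← map_smul]
    refine hr W (a • q) W' hW _ ?_
    rw [map_smul, mres_smul, ht]
  · rw [mres_res]
    exact hr W q W'' (hW''.trans hW) t (by rw [ht, mres_res])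
  · rw [← proj_res] at ht
    rw [← hθ W ⟨W', hW.trans W.2⟩ hW]
    exact (hwd ⟨W', hW.trans W.2⟩ _ _ ht).symm

end Subsheaf

end Quotient

/-! ### Subsheaves spanned by sections -/

section Spanned

variable {p : ℕ} [Fact p.Prime] {V : Type u} [AddCommGroup V] [Module (ZMod p) V]

/-- A family that can be completed to a finite basis. -/
def IsPartOfBasis {R M : Type*} [CommRing R] [AddCommGroup M] [Module R M] {κ : Type}
    (v : κ → M) : Prop :=
  ∃ (n : ℕ) (b : Module.Basis (κ ⊕ Fin n) R M), ∀ i, b (Sum.inl i) = v i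

lemma IsPartOfBasis.secMap {A R : Type u} [CommRing A] [CommRing R] [Algebra (ZMod p) A]
    [Algebra (ZMod p) R] {κ : Type} {v : κ → A ⊗[ZMod p] V} (hv : IsPartOfBasis (R := A) v)
    (φ : A →+* R) : IsPartOfBasis (R := R) fun i => DLTangent.secMap V φ (v i) := by
  obtain ⟨n, b, hb⟩ := hv
  obtain ⟨b', hb', -⟩ := exists_basis_secMap φ b
  exact ⟨n, b', fun i => by rw [hb', hb]⟩

lemma IsPartOfBasis.of_basis {R M : Type*} [CommRing R] [AddCommGroup M] [Module R M]
    {ι κ : Type} [Finite ι] (b : Module.Basis ι R M) (j : κ → ι) (hj : Function.Injective j) :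
    IsPartOfBasis (R := R) fun i => b (j i) := by
  classical
  let := Fintype.ofFinite ι
  let e₁ : κ ≃ Set.range j := Equiv.ofInjective j hj
  let e₂ := (Fintype.equivFin ↥((Set.range j)ᶜ)).symm
  let e : κ ⊕ Fin _ ≃ ι := (Equiv.sumCongr e₁ e₂).trans (Equiv.Set.sumCompl (Set.range j))
  exact ⟨_, b.reindex e.symm, fun i => by simp [e, e₁]⟩

lemma range_secMap_comp_equiv {κ κ' M : Type*} (e : κ ≃ κ') (v : κ' → M) :
    Set.range (fun i => v (e i)) = Set.range v := e.surjective.range_comp v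

variable {k : Type u} [Field k] [Algebra (ZMod p) k] {X Y : SchemeOver k}

/-- Pull-back of sections along a morphism of schemes, followed by restriction. -/
def pbLE (f : X.left ⟶ Y.left) {U : Y.left.Opens} {W : X.left.Opens} (h : W ≤ f ⁻¹ᵁ U) :
    Sec p V Y U →ₗ[ZMod p] Sec p V X W :=
  secMap V (f.appLE U W h).hom

lemma pbLE_eq (f : X.left ⟶ Y.left) {U : Y.left.Opens} {W : X.left.Opens} (h : W ≤ f ⁻¹ᵁ U)
    (s : Sec p V Y U) : pbLE f h s = res V X h (pb f U s) := by
  rw [pbLE, pb, res, secMap_comp]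
  rfl

namespace Subsheaf

/-- On the open subset `U`, the subsheaf `L` is spanned by the given sections. -/
def SpannedBy (L : Subsheaf p V X) (U : X.left.Opens) {κ : Type} (v : κ → Sec p V X U) : Prop :=
  ∀ (W : X.left.Opens) (h : W ≤ U),
    L.obj W = Submodule.span Γ(X.left, W) (Set.range fun i => res V X h (v i))

section

variable {L M : Subsheaf p V X} {U : X.left.Opens} {κ κ' : Type} {v : κ → Sec p V X U}

lemma SpannedBy.obj_eq (h : L.SpannedBy U v) :
    L.obj U = Submodule.span Γ(X.left, U) (Set.range v) := by
  rw [h U le_rfl]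
  simp only [res_self]

lemma SpannedBy.restrict (h : L.SpannedBy U v) {U' : X.left.Opens} (hU : U' ≤ U) :
    L.SpannedBy U' fun i => res V X hU (v i) := by
  intro W hW
  rw [h W (hW.trans hU)]
  simp only [res_res]

lemma SpannedBy.of_span_eq (h : L.SpannedBy U v) {v' : κ' → Sec p V X U}
    (e : Submodule.span Γ(X.left, U) (Set.range v) =
      Submodule.span Γ(X.left, U) (Set.range v')) : L.SpannedBy U v' := by
  intro W hW
  rw [h W hW]
  exact secMap_span_eq _ e

lemma SplitOn.exists_spannedBy {r : ℕ} (h : L.SplitOn U r) :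
    ∃ v : Fin r → Sec p V X U, IsPartOfBasis (R := Γ(X.left, U)) v ∧ L.SpannedBy U v := by
  obtain ⟨m, b, hb⟩ := h
  exact ⟨fun i => b (Sum.inl i), ⟨m, b, fun _ => rfl⟩, hb⟩

lemma SpannedBy.splitOn [Fintype κ] (h : L.SpannedBy U v)
    (hv : IsPartOfBasis (R := Γ(X.left, U)) v) : L.SplitOn U (Fintype.card κ) := by
  obtain ⟨n, b, hb⟩ := hv
  refine ⟨n, b.reindex ((Fintype.equivFin κ).sumCongr (Equiv.refl _)), fun W hW => ?_⟩
  rw [h W hW, ← range_secMap_comp_equiv (Fintype.equivFin κ).symm]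
  congr 2
  funext i
  rw [← hb]
  simp

/-- Lying in the span of part of a basis means that the complementary coordinates vanish, which is a
local condition. The resulting subsheaf imposes nothing outside `U`, so it can serve as an upper
bound for sums and pull-backs, which are defined as least subsheaves on all of `X`. -/
lemma exists_spanOn [Fintype κ] (hv : IsPartOfBasis (R := Γ(X.left, U)) v) :
    ∃ S : Subsheaf p V X, ∀ (U' : X.left.Opens) (s : Sec p V X U'), s ∈ S.obj U' ↔
      ∀ (W : X.left.Opens) (h : W ≤ U') (h' : W ≤ U),
        res V X h s ∈ Submodule.span Γ(X.left, W) (Set.range fun i => res V X h' (v i)) := by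
  obtain ⟨n, b, hb⟩ := hv
  let b' := b.reindex ((Fintype.equivFin κ).sumCongr (Equiv.refl _))
  refine ⟨spanOn b', fun U' s => forall_congr' fun W => forall_congr' fun h =>
    forall_congr' fun h' => ?_⟩
  rw [← range_secMap_comp_equiv (Fintype.equivFin κ).symm]
  have : (fun i => res V X h' (b' (Sum.inl i))) =
      fun i => res V X h' (v ((Fintype.equivFin κ).symm i)) := by
    funext i
    rw [← hb]
    simp [b']
  rw [this]

lemma exists_spannedBy [Fintype κ] (hv : IsPartOfBasis (R := Γ(X.left, U)) v) :
    ∃ S : Subsheaf p V X, S.SpannedBy U v := by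
  obtain ⟨S, hS⟩ := exists_spanOn hv
  refine ⟨S, fun W h => ?_⟩
  ext s
  rw [hS]
  constructor
  · intro hs
    simpa using hs W le_rfl h
  · intro hs W' h₁ h₂
    have := secMap_mem_span (X.left.presheaf.map (homOfLE h₁).op).hom _ hs
    change res V X h₁ s ∈ Submodule.span _ (Set.range fun i => res V X h₁ (res V X h (v i))) at this
    simpa only [res_res] using this

/-- Both summands lie in the subsheaf of `exists_spanOn` attached to `v`, hence so does their sum;
conversely each `v i` lies in one of the summands. That `v` is part of a basis ensures that its
spans already form a sheaf. -/
lemma SpannedBy.sup [Fintype κ] {κ₁ κ₂ : Type} {v₁ : κ₁ → Sec p V X U} {v₂ : κ₂ → Sec p V X U}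
    (h₁ : L.SpannedBy U v₁) (h₂ : M.SpannedBy U v₂) (hv : IsPartOfBasis (R := Γ(X.left, U)) v)
    (h₁v : ∀ i, v₁ i ∈ Submodule.span Γ(X.left, U) (Set.range v))
    (h₂v : ∀ i, v₂ i ∈ Submodule.span Γ(X.left, U) (Set.range v))
    (hvl : ∀ i, v i ∈ L.obj U ∨ v i ∈ M.obj U) : (L ⊔ M).SpannedBy U v := by
  obtain ⟨S, hS⟩ := exists_spanOn hv
  have hle : ∀ {K : Subsheaf p V X} {κ₃ : Type} {v₃ : κ₃ → Sec p V X U}, K.SpannedBy U v₃ →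
      (∀ i, v₃ i ∈ Submodule.span Γ(X.left, U) (Set.range v)) → K ≤ S := by
    intro K κ₃ v₃ h₃ hv₃ U' s hs
    refine (hS U' s).2 fun W h h' => ?_
    have := K.res_mem h hs
    rw [h₃ W h'] at this
    refine Submodule.span_le.2 ?_ this
    rintro _ ⟨i, rfl⟩
    exact secMap_mem_span _ _ (hv₃ i)
  intro W h
  refine le_antisymm (fun s hs => ?_) (Submodule.span_le.2 ?_)
  · have := (hS W s).1 ((sup_le (hle h₁ h₁v) (hle h₂ h₂v) : L ⊔ M ≤ S) W hs) W le_rfl h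
    simpa using this
  · rintro _ ⟨i, rfl⟩
    rcases hvl i with hi | hi
    · exact (le_sup_left : L ≤ L ⊔ M) W (L.res_mem h hi)
    · exact (le_sup_right : M ≤ L ⊔ M) W (M.res_mem h hi)

lemma eq_of_spannedBy_top {v : κ → Sec p V X ⊤} {v' : κ' → Sec p V X ⊤}
    (h : L.SpannedBy ⊤ v) (h' : M.SpannedBy ⊤ v')
    (e : Submodule.span Γ(X.left, ⊤) (Set.range v) =
      Submodule.span Γ(X.left, ⊤) (Set.range v')) : L = M := by
  ext1
  funext W
  rw [h.of_span_eq e W le_top, h' W le_top]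

lemma le_of_spannedBy_top {v : κ → Sec p V X ⊤} (h : L.SpannedBy ⊤ v)
    (hv : ∀ i, v i ∈ M.obj ⊤) : L ≤ M := by
  intro W
  rw [h W le_top, Submodule.span_le]
  rintro _ ⟨i, rfl⟩
  exact M.res_mem le_top (hv i)

lemma isIsotropic_of_spannedBy_top {B : LinearMap.BilinForm (ZMod p) V}
    {v : κ → Sec p V X ⊤} (h : L.SpannedBy ⊤ v)
    (hv : ∀ i j, B.baseChange Γ(X.left, ⊤) (v i) (v j) = 0) : L.IsIsotropic B := by
  intro W s hs t ht
  rw [h W le_top] at hs ht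
  have h₀ : ∀ i j, B.baseChange Γ(X.left, W) (res V X le_top (v i)) (res V X le_top (v j)) = 0 :=
    fun i j => by rw [res, secMap_baseChange, hv, map_zero]
  have h₁ : ∀ i, B.baseChange Γ(X.left, W) (res V X le_top (v i)) t = 0 := by
    intro i
    induction ht using Submodule.span_induction with
    | mem x hx => obtain ⟨j, rfl⟩ := hx; exact h₀ i j
    | zero => simp
    | add x y _ _ hx hy => rw [map_add, hx, hy, add_zero]
    | smul a x _ hx => rw [map_smul, hx, smul_zero]
  exact Frame.form_span_left h₁ hs

end

variable {L : Subsheaf p V Y} {U : Y.left.Opens} {κ : Type} [Fintype κ] {v : κ → Sec p V Y U}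

/-- The pull-back of a subsheaf that is spanned by part of a basis. -/
lemma SpannedBy.pull_obj (h : L.SpannedBy U v) (hv : IsPartOfBasis (R := Γ(Y.left, U)) v)
    (f : X.left ⟶ Y.left) {W : X.left.Opens} (hW : W ≤ f ⁻¹ᵁ U) :
    (L.pull f).obj W = Submodule.span Γ(X.left, W) (Set.range fun i => pbLE f hW (v i)) := by
  obtain ⟨S, hS⟩ := exists_spanOn (hv.secMap (f.app U).hom)
  have hle : L.pull f ≤ S := by
    refine (gc f _ _).2 ?_
    intro U' s hs
    refine (hS _ _).2 fun W h₁ h' => ?_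
    have h₂ := L.res_mem (inf_le_right : U ⊓ U' ≤ U') hs
    rw [h _ inf_le_left] at h₂
    have hW : W ≤ f ⁻¹ᵁ (U ⊓ U') := le_inf h' h₁
    have e : res V X h₁ (pb f U' s) = pbLE f hW (res V Y inf_le_right s) := by
      rw [pbLE_eq, pb_res, res_res]
    rw [e]
    have h₃ := secMap_mem_span (f.appLE _ W hW).hom _ h₂
    have e' : (fun i => res V X h' (secMap V (f.app U).hom (v i))) =
        fun i => secMap V (f.appLE _ W hW).hom (res V Y inf_le_left (v i)) := by
      funext i
      change res V X h' (pb f U (v i)) = pbLE f hW _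
      rw [pbLE_eq, pb_res, res_res]
    rw [e']
    exact h₃
  refine le_antisymm (fun s hs => ?_) (Submodule.span_le.2 ?_)
  · have := (hS W s).1 (hle W hs) W le_rfl hW
    rw [res_self] at this
    convert this using 3
    funext i
    exact pbLE_eq f hW (v i)
  · rintro _ ⟨i, rfl⟩
    dsimp only
    rw [pbLE_eq]
    refine (L.pull f).res_mem hW (pb_mem_pull f L ?_)
    rw [h.obj_eq]
    exact Submodule.subset_span ⟨i, rfl⟩

lemma SpannedBy.pull (h : L.SpannedBy U v) (hv : IsPartOfBasis (R := Γ(Y.left, U)) v)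
    (f : X.left ⟶ Y.left) {W : X.left.Opens} (hW : W ≤ f ⁻¹ᵁ U) :
    (L.pull f).SpannedBy W fun i => pbLE f hW (v i) := by
  intro W' hW'
  rw [h.pull_obj hv f (hW'.trans hW)]
  congr 2
  funext i
  dsimp only
  rw [pbLE_eq, pbLE_eq, res_res]

/-- The absolute Frobenius is the identity on open subsets, so `U` is its own preimage and only the
coefficients of the spanning sections change. -/
lemma SpannedBy.frobPull (h : L.SpannedBy U v) (hv : IsPartOfBasis (R := Γ(Y.left, U)) v) :
    L.frobPull.SpannedBy U fun i => secMap V (frobHom p Γ(Y.left, U)) (v i) := by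
  have := h.pull hv (frob p Y) (le_refl U : U ≤ frob p Y ⁻¹ᵁ U)
  intro W hW
  have h₁ := this W hW
  refine h₁.trans ?_
  congr 2
  funext i
  dsimp only
  refine congrArg (res V Y hW) ((pbLE_eq (frob p Y) _ (v i)).trans ?_)
  have e : res V Y (le_refl U : U ≤ frob p Y ⁻¹ᵁ U) (pb (frob p Y) U (v i)) =
    pb (frob p Y) U (v i) := res_self Y _ _
  exact e

end Subsheaf

end Spanned

/-! ### Existence of adapted frames -/

section Existence

variable {p : ℕ} [Fact p.Prime] {V : Type u} [AddCommGroup V] [Module (ZMod p) V]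
variable {B : LinearMap.BilinForm (ZMod p) V} {d : ℕ}

lemma LinearIndependent.snocFam {K M : Type*} [Field K] [AddCommGroup M] [Module K M] {κ : Type}
    {v : κ → M} (hv : LinearIndependent K v) {x : M} (hx : x ∉ Submodule.span K (Set.range v)) :
    LinearIndependent K (DLTangent.snocFam v x) := by
  have hx0 : x ≠ 0 := fun h => hx (h ▸ zero_mem _)
  refine LinearIndependent.sum_type hv ?_ ?_
  · exact linearIndependent_unique_iff.2 hx0
  · rw [Set.range_const, Submodule.disjoint_span_singleton' hx0]
    exact hx

lemma form_span_span {A : Type u} [CommRing A] [Algebra (ZMod p) A] {κ κ' : Type*}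
    {x : κ → A ⊗[ZMod p] V} {y : κ' → A ⊗[ZMod p] V}
    (h : ∀ i j, B.baseChange A (x i) (y j) = 0) {s t : A ⊗[ZMod p] V}
    (hs : s ∈ Submodule.span A (Set.range x)) (ht : t ∈ Submodule.span A (Set.range y)) :
    B.baseChange A s t = 0 := by
  refine Frame.form_span_left (fun i => ?_) hs
  have : Submodule.span A (Set.range y) ≤ LinearMap.ker (B.baseChange A (x i)) := by
    rw [Submodule.span_le]
    rintro _ ⟨j, rfl⟩
    exact h i j
  exact this ht

variable [Module.Finite (ZMod p) V]

/-- The choice of `e` and `f` over a field. -/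
lemma exists_independent_over_field {K : Type u} [Field K] [Algebra (ZMod p) K]
    (hB : B.Nondegenerate) (hV : Module.finrank (ZMod p) V = 2 * (d + 1))
    (hns : ∀ W : Submodule (ZMod p) V,
      (∀ x ∈ W, ∀ y ∈ W, B x y = 0) → Module.finrank (ZMod p) W ≠ d + 1)
    {a : Fin d → K ⊗[ZMod p] V} {b : Fin (d + 1) → K ⊗[ZMod p] V}
    (ha : LinearIndependent K a) (hb : LinearIndependent K b)
    (hab : ∀ i, a i ∈ Submodule.span K (Set.range b))
    (hbb : ∀ i j, B.baseChange K (b i) (b j) = 0)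
    (haf : ∀ i j, B.baseChange K (a i) (secMap V (frobHom p K) (b j)) = 0) :
    ∃ i j, LinearIndependent K (snocFam (snocFam a (b i)) (secMap V (frobHom p K) (b j))) ∧
      B.baseChange K (b i) (secMap V (frobHom p K) (b j)) ≠ 0 := by
  let E := Submodule.span K (Set.range b)
  have hE : Module.finrank K E = d + 1 := by rw [finrank_span_eq_card hb, Fintype.card_fin]
  have hiso : ∀ s ∈ E, ∀ t ∈ E, B.baseChange K s t = 0 := fun s hs t ht =>
    form_span_span hbb hs ht
  have h₁ : ∃ i, b i ∉ Submodule.span K (Set.range a) := by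
    by_contra! h
    have hle : E ≤ Submodule.span K (Set.range a) := by
      rw [Submodule.span_le]
      rintro _ ⟨i, rfl⟩
      exact h i
    have := Submodule.finrank_mono hle
    rw [hE, finrank_span_eq_card ha, Fintype.card_fin] at this
    omega
  obtain ⟨i, hi⟩ := h₁
  -- Nonsplitness: otherwise the Lagrangian `E` would be stable under Frobenius.
  have h₂ : ∃ j, secMap V (frobHom p K) (b j) ∉ E := by
    by_contra! h
    obtain ⟨s, hs, hs'⟩ := exists_frob_notMem hns E hiso hE
    refine hs' (Submodule.span_le.2 ?_ (secMap_mem_span (frobHom p K) b hs))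
    rintro _ ⟨j, rfl⟩
    exact h j
  obtain ⟨j, hj⟩ := h₂
  have hli := LinearIndependent.snocFam ha hi
  have hEs : Submodule.span K (Set.range (snocFam a (b i))) = E := by
    refine Submodule.eq_of_le_of_finrank_eq (Submodule.span_le.2 ?_) ?_
    · rintro _ ⟨l | l, rfl⟩
      · exact hab l
      · exact Submodule.subset_span ⟨i, rfl⟩
    · rw [finrank_span_eq_card hli, hE]
      simp
  -- The Frobenius image of `b j` is orthogonal to the `a l`. If it were orthogonal to `b i` as
  -- well, it would be orthogonal to `E`, hence in `E`, which is its own orthogonal.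
  refine ⟨i, j, LinearIndependent.snocFam hli (hEs ▸ hj), fun h0 => hj ?_⟩
  refine mem_of_orthogonal hB hV E hiso hE fun t ht => ?_
  rw [← hEs] at ht
  refine Frame.form_span_left ?_ ht
  rintro (l | l)
  · exact haf l j
  · exact h0

/-- Frames exist after inverting an element that does not vanish at a given point. -/
lemma exists_frame_of_isUnit {A K : Type u} [CommRing A] [Algebra (ZMod p) A] [Field K]
    [Algebra (ZMod p) K] (ev : A →+* K)
    (hB : B.Nondegenerate) (hV : Module.finrank (ZMod p) V = 2 * (d + 1))
    (hns : ∀ W : Submodule (ZMod p) V,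
      (∀ x ∈ W, ∀ y ∈ W, B x y = 0) → Module.finrank (ZMod p) W ≠ d + 1)
    {a : Fin d → A ⊗[ZMod p] V} {b : Fin (d + 1) → A ⊗[ZMod p] V}
    (ha : IsPartOfBasis (R := A) a) (hb : IsPartOfBasis (R := A) b)
    (hab : ∀ i, a i ∈ Submodule.span A (Set.range b))
    (haf : ∀ i, a i ∈ Submodule.span A (Set.range fun i => secMap V (frobHom p A) (b i)))
    (hbb : ∀ i j, B.baseChange A (b i) (b j) = 0) :
    ∃ (δ : A) (i : Fin (d + 1)), ev δ ≠ 0 ∧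
      ∀ {R : Type u} [CommRing R] [Nontrivial R] [Algebra (ZMod p) R] (r : A →+* R),
        IsUnit (r δ) → ∃ F : Frame p V B d R, F.a = (fun l => secMap V r (a l)) ∧
          F.e = secMap V r (b i) ∧ Submodule.span R (Set.range fun l => secMap V r (b l)) =
            Submodule.span R (Set.range (snocFam F.a F.e)) := by
  classical
  have hli : ∀ {κ : Type} {v : κ → A ⊗[ZMod p] V}, IsPartOfBasis (R := A) v →
      LinearIndependent K fun i => secMap V ev (v i) := by
    intro κ v hv
    obtain ⟨n, β, hβ⟩ := hv.secMap ev
    have := β.linearIndependent.comp Sum.inl Sum.inl_injective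
    have e : ⇑β ∘ Sum.inl = fun i => secMap V ev (v i) := funext hβ
    rwa [e] at this
  have hff : ∀ i j, B.baseChange A (secMap V (frobHom p A) (b i)) (secMap V (frobHom p A) (b j)) = 0 :=
    fun i j => by rw [secMap_baseChange, hbb, map_zero]
  have haf' : ∀ i j, B.baseChange A (a i) (secMap V (frobHom p A) (b j)) = 0 := fun i j =>
    Frame.form_span_left (fun l => hff l j) (haf i)
  have haa : ∀ i j, B.baseChange A (a i) (a j) = 0 := fun i j =>
    form_span_span hbb (hab i) (hab j)
  have hab' : ∀ i j, B.baseChange A (a i) (b j) = 0 := fun i j =>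
    Frame.form_span_left (fun l => hbb l j) (hab i)
  obtain ⟨i, j, hind, hne⟩ := exists_independent_over_field (K := K) hB hV hns (hli ha) (hli hb)
    (fun i => secMap_mem_span ev b (hab i))
    (fun i j => by rw [secMap_baseChange, hbb, map_zero])
    (fun i j => by rw [← secMap_frob, secMap_baseChange, haf', map_zero])
  -- The complement is chosen among the vectors `1 ⊗ v`, since these lift to `A ⊗ V`.
  have hT : Submodule.span K (Set.range fun v : V => (1 : K) ⊗ₜ[ZMod p] v) = ⊤ := by
    rw [eq_top_iff, ← ((Module.finBasis (ZMod p) V).baseChange K).span_eq]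
    refine Submodule.span_mono ?_
    rintro _ ⟨l, rfl⟩
    exact ⟨Module.finBasis (ZMod p) V l, by simp⟩
  obtain ⟨m, g, β, hg, hβ⟩ := exists_basis_sumElim hind hT
  choose g' hg' using hg
  let e := b i
  let f := secMap V (frobHom p A) (b j)
  let w : ((Fin d ⊕ Unit) ⊕ Unit) ⊕ Fin m → A ⊗[ZMod p] V :=
    Sum.elim (snocFam (snocFam a e) f) fun l => 1 ⊗ₜ g' l
  have hwβ : ∀ l, secMap V ev (w l) = β l := by
    intro l
    rw [hβ]
    rcases l with ((l | l) | l) | l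
    · rfl
    · rfl
    · exact secMap_frob ev (b j)
    · change secMap V ev (1 ⊗ₜ g' l) = g l
      rw [secMap_tmul, map_one]
      exact hg' l
  have hcard : Module.finrank (ZMod p) V =
      Fintype.card (((Fin d ⊕ Unit) ⊕ Unit) ⊕ Fin m) := by
    rw [← Module.finrank_baseChange (R := K), Module.finrank_eq_card_basis β]
  let c : Module.Basis (((Fin d ⊕ Unit) ⊕ Unit) ⊕ Fin m) (ZMod p) V :=
    (Module.finBasis (ZMod p) V).reindex (Fintype.equivOfCardEq (by rw [Fintype.card_fin, hcard]))
  have hdet : ∀ {R : Type u} [CommRing R] [Algebra (ZMod p) R] (r : A →+* R),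
      (c.baseChange R).det (fun l => secMap V r (w l)) = r ((c.baseChange A).det w) := by
    intro R _ _ r
    rw [Module.Basis.det_apply, Module.Basis.det_apply, RingHom.map_det]
    congr 1
    ext l l'
    rw [RingHom.mapMatrix_apply, Matrix.map_apply, Module.Basis.toMatrix_apply,
      Module.Basis.toMatrix_apply, Subsheaf.repr_secMap]
  -- Inverting the first factor turns the lifted family into a basis; inverting the second makes
  -- `⟨e, f⟩` a unit. Both are nonzero at the given point.
  refine ⟨(c.baseChange A).det w * B.baseChange A e f, i, ?_, ?_⟩
  · rw [map_mul]
    refine mul_ne_zero ?_ ?_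
    · rw [← hdet]
      simp only [hwβ]
      exact ((c.baseChange K).isUnit_det β).ne_zero
    · rw [← secMap_baseChange, secMap_frob]
      exact hne
  · intro R _ _ _ r hr
    rw [map_mul, IsUnit.mul_iff, ← hdet] at hr
    obtain ⟨β', hβ'⟩ := exists_basis_of_isUnit_det _ _ hr.1
    -- Over a nontrivial ring ranks are well defined, so every complement of a free summand of rank
    -- `d + 1` has rank `m + 1`.
    have hcb : ∀ {n : ℕ} (_ : Module.Basis (Fin (d + 1) ⊕ Fin n) R (R ⊗[ZMod p] V)),
        Fintype.card (Fin n) = Fintype.card (Unit ⊕ Fin m) := by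
      intro n γ
      have h₁ := Module.finrank_eq_card_basis γ
      rw [Module.finrank_eq_card_basis β'] at h₁
      simp only [Fintype.card_sum, Fintype.card_fin, Fintype.card_unit] at h₁ ⊢
      omega
    -- A free summand of rank `d + 1` that contains the `a l` and a further basis vector `x` is
    -- spanned by them, by comparison of coranks. This is applied to `L_{d+1}` with `x = e` and to
    -- `Frob^* L_{d+1}` with `x = f`.
    have key : ∀ (x y : R ⊗[ZMod p] V) (q : Fin (d + 1) → R ⊗[ZMod p] V)
        (_ : IsPartOfBasis (R := R) q)
        (β₁ : Module.Basis ((Fin d ⊕ Unit) ⊕ Unit ⊕ Fin m) R (R ⊗[ZMod p] V))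
        (_ : ∀ l, β₁ (Sum.inl l) = snocFam (fun l => secMap V r (a l)) x l)
        (_ : ∀ l, snocFam (fun l => secMap V r (a l)) x l ∈ Submodule.span R (Set.range q)),
        Submodule.span R (Set.range q) =
          Submodule.span R (Set.range (snocFam (fun l => secMap V r (a l)) x)) := by
      intro x y q hq β₁ hβ₁ hmem
      obtain ⟨n, γ, hγ⟩ := hq
      have := span_inl_eq_of_le γ β₁ (hcb γ) (by
        intro l
        simp only [hγ]
        rw [hβ₁]
        exact hmem l)
      simp only [hγ, hβ₁] at this
      exact this
    let s₁ : ((Fin d ⊕ Unit) ⊕ Unit) ⊕ Fin m ≃ (Fin d ⊕ Unit) ⊕ Unit ⊕ Fin m :=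
      Equiv.sumAssoc _ _ _
    -- This reordering exchanges `e` and `f`, so that `f` stands next to the `a l`.
    let s₂ : ((Fin d ⊕ Unit) ⊕ Unit) ⊕ Fin m ≃ (Fin d ⊕ Unit) ⊕ Unit ⊕ Fin m :=
      (Equiv.sumCongr ((Equiv.sumAssoc _ _ _).trans ((Equiv.sumCongr (Equiv.refl _)
        (Equiv.sumComm _ _)).trans (Equiv.sumAssoc _ _ _).symm)) (Equiv.refl _)).trans
        (Equiv.sumAssoc _ _ _)
    have hs₁ := key (secMap V r e) 0 _ (hb.secMap r) (β'.reindex s₁)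
      (by
        rintro (l | l)
        · rw [Module.Basis.reindex_apply, hβ']; rfl
        · rw [Module.Basis.reindex_apply, hβ']; rfl)
      (by
        rintro (l | l)
        · exact secMap_mem_span r b (hab l)
        · exact Submodule.subset_span ⟨i, rfl⟩)
    have hs₂ := key (secMap V r f) 0 _ ((hb.secMap r).secMap (frobHom p R)) (β'.reindex s₂)
      (by
        rintro (l | l)
        · rw [Module.Basis.reindex_apply, hβ']; rfl
        · rw [Module.Basis.reindex_apply, hβ']; rfl)
      (by
        have := fun l => secMap_mem_span r _ (haf l)
        simp only [secMap_frob] at this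
        rintro (l | l)
        · exact this l
        · exact Submodule.subset_span ⟨j, (secMap_frob r (b j)).symm⟩)
    have hs₃ := secMap_span_eq (frobHom p R) hs₁
    refine ⟨{
      m := m
      a := fun l => secMap V r (a l)
      e := secMap V r e
      f := secMap V r f
      g := fun l => secMap V r (1 ⊗ₜ g' l)
      basis := β'
      basis_eq := ?_
      form_aa := fun l l' => by rw [secMap_baseChange, haa, map_zero]
      form_ae := fun l => by rw [secMap_baseChange, hab', map_zero]
      form_af := fun l => by rw [secMap_baseChange, haf', map_zero]
      form_ee := by rw [secMap_baseChange, hbb, map_zero]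
      form_ef := by rw [secMap_baseChange]; exact hr.2
      span_frob := hs₃.symm.trans hs₂ }, rfl, rfl, hs₁⟩
    rw [hβ']
    funext l
    rcases l with ((l | l) | l) | l <;> rfl

variable {k : Type u} [Field k] [Algebra (ZMod p) k] {X : SchemeOver k}

/-- A frame over an open subset that is adapted to a point of the moduli problem. -/
structure AdaptedOn (x : DL B d X) (U : X.left.Opens) extends Frame p V B d Γ(X.left, U) where
  spanned₀ : x.L₀.SpannedBy U a
  spanned₁ : x.L₁.SpannedBy U (snocFam a e)

/-- The conditions on a frame are open. Near `y` both members of the flag have bases, the field case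
applies to their values in the residue field at `y`, and the resulting frame is defined wherever one
function `δ`, nonzero at `y`, is invertible. -/
lemma exists_adaptedOn (hB : B.Nondegenerate) (hV : Module.finrank (ZMod p) V = 2 * (d + 1))
    (hns : ∀ W : Submodule (ZMod p) V,
      (∀ x ∈ W, ∀ y ∈ W, B x y = 0) → Module.finrank (ZMod p) W ≠ d + 1)
    (x : DL B d X) {y : X.left} {U₀ : X.left.Opens} (hy : y ∈ U₀) :
    ∃ U ≤ U₀, y ∈ U ∧ IsAffineOpen U ∧ Nonempty (AdaptedOn x U) := by
  obtain ⟨U₁, hyU₁, hU₁⟩ := x.summand₀ y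
  obtain ⟨U₂, hyU₂, hU₂⟩ := x.summand₁ y
  obtain ⟨a, ha, hLa⟩ := hU₁.exists_spannedBy
  obtain ⟨b, hb, hLb⟩ := hU₂.exists_spannedBy
  obtain ⟨U, hU, hyU, hUU⟩ := exists_isAffineOpen_mem_and_subset
    (show y ∈ U₀ ⊓ (U₁ ⊓ U₂) from ⟨hy, hyU₁, hyU₂⟩)
  have hUU₁ : U ≤ U₁ := fun z hz => (hUU hz).2.1
  have hUU₂ : U ≤ U₂ := fun z hz => (hUU hz).2.2
  have ha' := ha.secMap (X.left.presheaf.map (homOfLE hUU₁).op).hom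
  have hb' := hb.secMap (X.left.presheaf.map (homOfLE hUU₂).op).hom
  have hLa' := hLa.restrict hUU₁
  have hLb' := hLb.restrict hUU₂
  let K : Type u := X.left.residueField y
  let ev : Γ(X.left, U) →+* K := (X.left.evaluation U y hyU).hom
  let : Algebra (ZMod p) K := (ev.comp (algebraMap (ZMod p) Γ(X.left, U))).toAlgebra
  have hmem : ∀ i, res V X hUU₂ (b i) ∈ x.L₁.obj U := fun i => by
    rw [hLb'.obj_eq]
    exact Submodule.subset_span ⟨i, rfl⟩
  have hmem₀ : ∀ i, res V X hUU₁ (a i) ∈ x.L₀.obj U := fun i => by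
    rw [hLa'.obj_eq]
    exact Submodule.subset_span ⟨i, rfl⟩
  obtain ⟨δ, i, hδ, hF⟩ := exists_frame_of_isUnit (A := Γ(X.left, U)) (K := K) ev hB hV hns
    ha' hb'
    (fun i => by
      have := x.le U (hmem₀ i)
      rw [hLb'.obj_eq] at this
      exact this)
    (fun i => by
      have := x.le_frob U (hmem₀ i)
      rw [(hLb'.frobPull hb').obj_eq] at this
      exact this)
    (fun i j => x.isotropic₁ U _ (hmem i) _ (hmem j))
  let U' := X.left.basicOpen δ
  have hU' : U' ≤ U := X.left.basicOpen_le δ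
  have hyU' : y ∈ U' := (X.left.evaluation_ne_zero_iff_mem_basicOpen y hyU δ).1 hδ
  -- Nonemptiness makes the ring of functions on `U'` nontrivial, as the rank comparison requires.
  have : Nonempty U' := ⟨⟨y, hyU'⟩⟩
  have hu : IsUnit ((X.left.presheaf.map (homOfLE hU').op).hom δ) :=
    RingedSpace.isUnit_res_basicOpen X.left.toRingedSpace δ
  obtain ⟨F, hFa, hFe, hFs⟩ := hF (X.left.presheaf.map (homOfLE hU').op).hom hu
  refine ⟨U', hU'.trans fun z hz => (hUU hz).1, hyU', hU.basicOpen δ, ⟨{ F with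
    spanned₀ := ?_
    spanned₁ := ?_ }⟩⟩
  · rw [hFa]
    exact hLa'.restrict hU'
  · exact (hLb'.restrict hU').of_span_eq hFs

end Existence

/-! ### Morphisms from affine schemes -/

section SpecMaps

variable {X : Scheme.{u}} {U : X.Opens} (hU : IsAffineOpen U) {Q : Type u} [CommRing Q]

/-- The morphism `Spec Q → X` given by a ring homomorphism `Γ(X, U) → Q`. -/
def specMap (σ : Γ(X, U) →+* Q) : Spec (CommRingCat.of Q) ⟶ X :=
  Spec.map (CommRingCat.ofHom σ) ≫ hU.fromSpec

/-- The functions on an open subset of `Spec Q` given by the elements of `Q`. -/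
def toΓ (Q : Type u) [CommRing Q] (W : (Spec (CommRingCat.of Q)).Opens) :
    Q →+* Γ(Spec (CommRingCat.of Q), W) :=
  ((Scheme.ΓSpecIso (CommRingCat.of Q)).inv ≫
    (Spec (CommRingCat.of Q)).presheaf.map (homOfLE (le_top : W ≤ ⊤)).op).hom

lemma toΓ_top_bijective : Function.Bijective (toΓ Q ⊤) := by
  have : toΓ Q ⊤ = (Scheme.ΓSpecIso (CommRingCat.of Q)).inv.hom := by
    rw [toΓ]
    congr 1
  rw [this]
  exact ConcreteCategory.bijective_of_isIso (Scheme.ΓSpecIso (CommRingCat.of Q)).inv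

lemma specMap_preimage (σ : Γ(X, U) →+* Q) : specMap hU σ ⁻¹ᵁ U = ⊤ := by
  rw [specMap, Scheme.Hom.comp_preimage, hU.fromSpec_preimage_self]
  rfl

lemma specMap_appLE (σ : Γ(X, U) →+* Q) {U' : X.Opens} (hUU' : U ≤ U')
    {W : (Spec (CommRingCat.of Q)).Opens} (h : W ≤ specMap hU σ ⁻¹ᵁ U') :
    ((specMap hU σ).appLE U' W h).hom =
      ((toΓ Q W).comp σ).comp (X.presheaf.map (homOfLE hUU').op).hom := by
  have h₁ : (⊤ : (Spec Γ(X, U)).Opens) ≤ hU.fromSpec ⁻¹ᵁ U' := by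
    rw [← hU.fromSpec_preimage_self]
    exact hU.fromSpec.preimage_mono hUU'
  have h₂ : hU.fromSpec.appLE U' ⊤ h₁ =
      X.presheaf.map (homOfLE hUU').op ≫ (Scheme.ΓSpecIso Γ(X, U)).inv := by
    rw [Scheme.Hom.appLE, hU.fromSpec_app_of_le _ hUU', Category.assoc, Category.assoc,
      ← Functor.map_comp]
    have : ∀ e : op (⊤ : (Spec Γ(X, U)).Opens) ⟶ op ⊤, (Spec Γ(X, U)).presheaf.map e = 𝟙 _ :=
      fun e => (Spec Γ(X, U)).presheaf.map_id _
    rw [this, Category.comp_id]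
  have h₃ : (specMap hU σ).appLE U' W h = X.presheaf.map (homOfLE hUU').op ≫
      (Scheme.ΓSpecIso Γ(X, U)).inv ≫ (Spec.map (CommRingCat.ofHom σ)).appLE ⊤ W le_top := by
    rw [← Category.assoc, ← h₂]
    exact (Scheme.Hom.appLE_comp_appLE (Spec.map (CommRingCat.ofHom σ)) hU.fromSpec U' ⊤ W
      h₁ le_top).symm
  have h₄ : (Scheme.ΓSpecIso Γ(X, U)).inv ≫ (Spec.map (CommRingCat.ofHom σ)).appLE ⊤ W le_top =
      CommRingCat.ofHom σ ≫ (Scheme.ΓSpecIso (CommRingCat.of Q)).inv ≫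
        (Spec (CommRingCat.of Q)).presheaf.map (homOfLE (le_top : W ≤ ⊤)).op := by
    rw [← Category.assoc (CommRingCat.ofHom σ), Scheme.ΓSpecIso_inv_naturality, Category.assoc]
    rfl
  rw [h₃, h₄]
  rfl

lemma specMap_injective {σ τ : Γ(X, U) →+* Q} (h : specMap hU σ = specMap hU τ) : σ = τ := by
  have := Spec.map_injective ((cancel_mono hU.fromSpec).1 h)
  exact congrArg CommRingCat.Hom.hom this

end SpecMaps

/-! ### Spectra over an affine open subset, as `k`-schemes. -/

section SpecOver

variable {p : ℕ} [Fact p.Prime] {k : Type u} [Field k] [Algebra (ZMod p) k]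
variable {V : Type u} [AddCommGroup V] [Module (ZMod p) V]
variable {X : SchemeOver k} {U : X.left.Opens} (hU : IsAffineOpen U)
variable {Q : Type u} [CommRing Q]

/-- `Spec Q` as a `k`-scheme, where `Q` is an algebra over the functions on an affine open subset
of a `k`-scheme. -/
def specOver (σ : Γ(X.left, U) →+* Q) : SchemeOver k := Over.mk (specMap hU σ ≫ X.hom)

/-- A morphism to the affine scheme `Spec k` is determined by its effect on global functions. This
lets two ring homomorphisms that agree on constants define `k`-morphisms with the same source. -/
lemma specMap_hom_ext {σ τ : Γ(X.left, U) →+* Q}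
    (h : ∀ c : k, σ (algebraMap k _ c) = τ (algebraMap k _ c)) :
    specMap hU σ ≫ X.hom = specMap hU τ ≫ X.hom := by
  refine ext_of_isAffine ?_
  have key : ∀ σ : Γ(X.left, U) →+* Q, (specMap hU σ ≫ X.hom).appTop =
      (Scheme.ΓSpecIso (CommRingCat.of k)).hom ≫
        CommRingCat.ofHom ((toΓ Q ⊤).comp (σ.comp (structMap X U))) := by
    intro σ
    have h₁ := specMap_appLE hU σ (le_top : U ≤ ⊤)
      (le_top : (⊤ : (Spec (CommRingCat.of Q)).Opens) ≤ specMap hU σ ⁻¹ᵁ ⊤)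
    have h₂ : (specMap hU σ).appTop = (specMap hU σ).appLE ⊤ ⊤ le_top :=
      Scheme.Hom.app_eq_appLE _
    rw [Scheme.Hom.comp_appTop, h₂, ← Iso.inv_comp_eq]
    ext c
    change ((specMap hU σ).appLE ⊤ ⊤ le_top).hom _ = _
    rw [h₁]
    rfl
  rw [key, key]
  congr 2
  ext c
  exact congrArg (toΓ Q ⊤) (h c)

/-- A morphism `Spec Q → X` of `k`-schemes. -/
def specOverMap (σ τ : Γ(X.left, U) →+* Q)
    (h : ∀ c : k, σ (algebraMap k _ c) = τ (algebraMap k _ c)) : specOver hU σ ⟶ X :=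
  Over.homMk (specMap hU τ) (specMap_hom_ext hU fun c => (h c).symm)

variable [Algebra (ZMod p) Q]

lemma pbLE_specOverMap (σ τ : Γ(X.left, U) →+* Q)
    (h : ∀ c : k, σ (algebraMap k _ c) = τ (algebraMap k _ c)) {W : (specOver hU σ).left.Opens}
    (hW : W ≤ (specOverMap hU σ τ h).left ⁻¹ᵁ U) (s : Sec p V X U) :
    pbLE (specOverMap hU σ τ h).left hW s =
      secMap V (A' := Γ((specOver hU σ).left, W)) (toΓ Q W) (secMap V τ s) := by
  have h₁ := specMap_appLE hU τ le_rfl hW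
  refine Eq.trans ?_ (secMap_comp (A'' := Γ((specOver hU σ).left, W)) V τ (toΓ Q W) s).symm
  have h₂ : (X.left.presheaf.map (homOfLE (le_refl U)).op).hom = RingHom.id _ := by
    have : X.left.presheaf.map (homOfLE (le_refl U)).op = 𝟙 _ := X.left.presheaf.map_id _
    rw [this]
    rfl
  rw [h₂, RingHom.comp_id] at h₁
  exact congrArg (fun φ : Γ(X.left, U) →+* Γ((specOver hU σ).left, W) => secMap V φ s) h₁

end SpecOver

/-! ### Vanishing of derivations -/

section Vanishing

variable {p : ℕ} [Fact p.Prime] {k : Type u} [Field k] [Algebra (ZMod p) k]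
variable {V : Type u} [AddCommGroup V] [Module (ZMod p) V]
variable {B : LinearMap.BilinForm (ZMod p) V} {d : ℕ} {X : SchemeOver k}

namespace Frame

variable {A : Type u} [CommRing A] [Algebra (ZMod p) A] (F : Frame p V B d A)

lemma isPart_a : IsPartOfBasis (R := A) F.a := by
  have := IsPartOfBasis.of_basis F.basis (fun i => Sum.inl (Sum.inl (Sum.inl i)))
    (Sum.inl_injective.comp (Sum.inl_injective.comp Sum.inl_injective))
  rw [F.basis_eq] at this
  exact this

lemma isPart_e : IsPartOfBasis (R := A) (snocFam F.a F.e) := by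
  have := IsPartOfBasis.of_basis F.basis (fun i => Sum.inl (Sum.inl i))
    (Sum.inl_injective.comp Sum.inl_injective)
  rw [F.basis_eq] at this
  exact this

lemma isPart_f : IsPartOfBasis (R := A) (snocFam (snocFam F.a F.e) F.f) := by
  have := IsPartOfBasis.of_basis F.basis (fun i => Sum.inl i) Sum.inl_injective
  rw [F.basis_eq] at this
  exact this

end Frame

namespace AdaptedOn

variable {x : DL B d X} {U : X.left.Opens} (F : AdaptedOn x U)

/-- Restriction of adapted frames. -/
def restrict {U' : X.left.Opens} (h : U' ≤ U) : AdaptedOn x U' where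
  toFrame := F.toFrame.map (X.left.presheaf.map (homOfLE h).op).hom
  spanned₀ := F.spanned₀.restrict h
  spanned₁ := by
    have := F.spanned₁.restrict h
    rw [comp_snocFam (res V X h)] at this
    exact this

lemma spanned_frob : x.L₁.frobPull.SpannedBy U (snocFam F.a F.f) :=
  (F.spanned₁.frobPull F.isPart_e).of_span_eq F.span_frob

lemma a_mem_frob (i : Fin d) :
    F.a i ∈ Submodule.span Γ(X.left, U) (Set.range (snocFam F.a F.f)) := by
  rw [← F.spanned_frob.obj_eq]
  refine x.le_frob U ?_
  rw [F.spanned₀.obj_eq]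
  exact Submodule.subset_span ⟨i, rfl⟩

lemma spanned_sup : (x.L₁ ⊔ x.L₁.frobPull).SpannedBy U (snocFam (snocFam F.a F.e) F.f) := by
  refine F.spanned₁.sup F.spanned_frob F.isPart_f ?_ ?_ ?_
  · exact fun i => Submodule.subset_span ⟨Sum.inl i, rfl⟩
  · rintro (i | i)
    · exact Submodule.subset_span ⟨Sum.inl (Sum.inl i), rfl⟩
    · exact Submodule.subset_span ⟨Sum.inr (), rfl⟩
  · rintro (i | i)
    · left
      rw [F.spanned₁.obj_eq]
      exact Submodule.subset_span ⟨i, rfl⟩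
    · right
      rw [F.spanned_frob.obj_eq]
      exact Submodule.subset_span ⟨Sum.inr (), rfl⟩

end AdaptedOn

/-- Points with values in a `k`-scheme are determined by the flags that they induce. -/
def IsSeparating (x : DL B d X) : Prop :=
  ∀ {T : SchemeOver k} (f g : T ⟶ X), x.pull f = x.pull g → f = g

open TrivSqZeroExt

/-- The homomorphism `a ↦ ρ a + ε D a` to the dual numbers. -/
def dualHom {A R : Type u} [CommRing A] [CommRing R] {ρ : A →+* R} {D : A →+ R}
    (hD : IsDerivationAlong ρ D) : A →+* TrivSqZeroExt R R where
  toFun a := inl (ρ a) + inr (D a)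
  map_one' := by
    rw [map_one, hD.map_one, inr_zero, add_zero, inl_one]
  map_mul' a b := by
    refine TrivSqZeroExt.ext ?_ ?_
    · simp
    · simp [hD a b, mul_comm]
  map_zero' := by simp
  map_add' a b := by
    refine TrivSqZeroExt.ext ?_ ?_ <;> simp

lemma two_isUnit (hp : p ≠ 2) (R : Type*) [CommRing R] [Algebra (ZMod p) R] :
    IsUnit (2 : R) := by
  have h : (2 : ZMod p) ≠ 0 := by
    have : ((2 : ℕ) : ZMod p) ≠ 0 := by
      rw [Ne, ZMod.natCast_eq_zero_iff]
      exact fun h => hp ((Nat.prime_dvd_prime_iff_eq Fact.out Nat.prime_two).1 h)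
    exact_mod_cast this
  have := (IsUnit.mk0 _ h).map (algebraMap (ZMod p) R)
  rwa [map_ofNat] at this

/-- A derivation that moves the last basis vector of the universal flag within
`L_{d+1} + Frob^* L_{d+1}` vanishes. -/
theorem derivation_eq_zero {x : DL B d X} (hx : IsSeparating x) (hB : B.IsSymm) (hp : p ≠ 2)
    {U : X.left.Opens} (hU : IsAffineOpen U) (F : AdaptedOn x U) {R : Type u} [CommRing R]
    [Algebra (ZMod p) R] {ρ : Γ(X.left, U) →+* R} {D : Γ(X.left, U) →+ R}
    (hD : IsDerivationAlong ρ D) (hk : ∀ c : k, D (algebraMap k _ c) = 0)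
    (he : addSec V D F.e ∈ Submodule.span R
      (Set.range (snocFam (snocFam (F.map ρ).a (F.map ρ).e) (F.map ρ).f))) : D = 0 := by
  obtain ⟨ha', he'⟩ := F.derivation_mem hB (two_isUnit hp R) hD F.a_mem_frob he
  -- Two points with values in the dual numbers: `σ` is the constant extension of `ρ`, and `τ` is `ρ
  -- + ε D`. They agree on `k` because `D` kills constants.
  let σ : Γ(X.left, U) →+* TrivSqZeroExt R R := (inlHom R R).comp ρ
  let τ : Γ(X.left, U) →+* TrivSqZeroExt R R := dualHom hD
  have hστ : ∀ c : k, σ (algebraMap k _ c) = τ (algebraMap k _ c) := fun c => by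
    change (inl (ρ _) : TrivSqZeroExt R R) = inl (ρ _) + inr (D _)
    rw [hk, inr_zero, add_zero]
  have hfσ : ∀ s : Sec p V X U, fstSec (secMap V σ s) = secMap V ρ s := fun s => by
    rw [fstSec_secMap]; rfl
  have hfτ : ∀ s : Sec p V X U, fstSec (secMap V τ s) = secMap V ρ s := fun s => by
    rw [fstSec_secMap]
    congr 1
    refine congrArg (secMap V) (RingHom.ext fun a => ?_)
    change (inl (ρ a) + inr (D a) : TrivSqZeroExt R R).fst = ρ a
    simp
  have hsσ : ∀ s : Sec p V X U, sndSec (secMap V σ s) = 0 := fun s => by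
    have : secMap V σ s = mkSec (secMap V ρ s) 0 := by
      rw [mkSec, map_zero, add_zero, secMap_comp]
    rw [this, sndSec_mkSec]
  have hsτ : ∀ s : Sec p V X U, sndSec (secMap V τ s) = addSec V D s := fun s => by
    rw [sndSec_secMap]
    congr 1
    refine congrArg (addSec V) (AddMonoidHom.ext fun a => ?_)
    change (inl (ρ a) + inr (D a) : TrivSqZeroExt R R).snd = D a
    simp
  -- The two lifts of `v i` have the same reduction, and their `ε`-parts differ by `D (v i)`, which
  -- lies in the span of the reductions. So both families span the same module over the dual
  -- numbers.
  have span : ∀ {κ : Type} (v : κ → Sec p V X U),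
      (∀ i, addSec V D (v i) ∈ Submodule.span R (Set.range fun i => secMap V ρ (v i))) →
      Submodule.span (TrivSqZeroExt R R) (Set.range fun i => secMap V σ (v i)) =
        Submodule.span (TrivSqZeroExt R R) (Set.range fun i => secMap V τ (v i)) := by
    intro κ v hv
    refine (dual_span_eq (fun i => ?_) fun i => ?_).symm
    · rw [hfσ, hfτ]
    · rw [hsσ, hsτ, sub_zero]
      simp only [hfσ]
      exact hv i
  have pulls : ∀ {L : Subsheaf p V X} {κ : Type} [Fintype κ] {v : κ → Sec p V X U}
      (_ : L.SpannedBy U v) (_ : IsPartOfBasis (R := Γ(X.left, U)) v)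
      (_ : ∀ i, addSec V D (v i) ∈ Submodule.span R (Set.range fun i => secMap V ρ (v i))),
      L.pull (specOverMap hU σ σ fun _ => rfl).left = L.pull (specOverMap hU σ τ hστ).left := by
    intro L κ _ v h₁ h₂ h₃
    refine Subsheaf.eq_of_spannedBy_top
      (h₁.pull h₂ _ (W := ⊤) (specMap_preimage hU σ).ge)
      (h₁.pull h₂ _ (W := ⊤) (specMap_preimage hU τ).ge) ?_
    have e₁ := funext fun i => pbLE_specOverMap hU σ σ (fun _ => rfl)
      (W := ⊤) (specMap_preimage hU σ).ge (v i)
    have e₂ := funext fun i => pbLE_specOverMap hU σ τ hστ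
      (W := ⊤) (specMap_preimage hU τ).ge (v i)
    rw [e₁, e₂]
    exact secMap_span_eq _ (span v h₃)
  -- Equal flags give equal points, so `σ = τ`; comparing `ε`-parts gives `D = 0`.
  have h := hx (specOverMap hU σ σ fun _ => rfl) (specOverMap hU σ τ hστ) (by
    refine DL.ext ?_ ?_
    · exact pulls F.spanned₀ F.isPart_a ha'
    · refine pulls F.spanned₁ F.isPart_e ?_
      rw [comp_snocFam (secMap V ρ)]
      rintro (i | i)
      · exact Submodule.span_mono (by rw [Set.Sum.elim_range]; exact Set.subset_union_left) (ha' i)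
      · exact he')
  have h' : σ = τ := specMap_injective hU (congrArg CommaMorphism.left h)
  ext a
  have := congrArg TrivSqZeroExt.snd (RingHom.congr_fun h' a)
  change (inl (ρ a) : TrivSqZeroExt R R).snd = (inl (ρ a) + inr (D a) : TrivSqZeroExt R R).snd at this
  simpa using this.symm

end Vanishing

/-! ### Constants and change of rings for morphisms of spectra. -/

section AlgebraMaps

variable {p : ℕ} [Fact p.Prime] {k : Type u} [Field k] [Algebra (ZMod p) k]

lemma appLE_algebraMap {X Y : SchemeOver k} (f : X ⟶ Y) {U : Y.left.Opens} {W : X.left.Opens}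
    (h : W ≤ f.left ⁻¹ᵁ U) (c : k) :
    (f.left.appLE U W h).hom (algebraMap k _ c) = algebraMap k Γ(X.left, W) c := by
  have h₁ : structMap X W = (f.left.appLE U W h).hom.comp (structMap Y U) := by
    have e : X.hom.appTop = Y.hom.appTop ≫ f.left.appTop := by
      rw [← Scheme.Hom.comp_appTop]
      congr 1
      exact (Over.w f).symm
    rw [structMap, structMap, ← CommRingCat.hom_comp, e]
    congr 1
    simp only [Category.assoc]
    congr 2
    rw [Scheme.Hom.map_appLE]
    rfl
  exact (RingHom.congr_fun h₁ c).symm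

variable {X : SchemeOver k} {U : X.left.Opens} (hU : IsAffineOpen U)
variable {Q : Type u} [CommRing Q]

lemma toΓ_algebraMap (σ : Γ(X.left, U) →+* Q) (W : (specOver hU σ).left.Opens) (c : k) :
    toΓ Q W (σ (algebraMap k _ c)) = algebraMap k Γ((specOver hU σ).left, W) c := by
  have hW : W ≤ (specOverMap hU σ σ fun _ => rfl).left ⁻¹ᵁ U :=
    le_top.trans (specMap_preimage hU σ).ge
  rw [← appLE_algebraMap (specOverMap hU σ σ fun _ => rfl) hW c]
  have h₁ := specMap_appLE hU σ le_rfl hW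
  have h₂ : (X.left.presheaf.map (homOfLE (le_refl U)).op).hom = RingHom.id _ := by
    have : X.left.presheaf.map (homOfLE (le_refl U)).op = 𝟙 _ := X.left.presheaf.map_id _
    rw [this]
    rfl
  rw [h₂, RingHom.comp_id] at h₁
  exact (RingHom.congr_fun h₁ _).symm

variable {Q' : Type u} [CommRing Q']

/-- The morphism between spectra, over `k`, that is induced by a ring homomorphism. -/
def specOverTrans (σ : Γ(X.left, U) →+* Q) (φ : Q →+* Q') :
    specOver hU (φ.comp σ) ⟶ specOver hU σ :=
  Over.homMk (Spec.map (CommRingCat.ofHom φ)) (by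
    change Spec.map _ ≫ (Spec.map _ ≫ _) ≫ _ = (Spec.map _ ≫ _) ≫ _
    rw [CommRingCat.ofHom_comp, Spec.map_comp]
    simp only [Category.assoc])

lemma appLE_toΓ (φ : Q →+* Q') {W : (Spec (CommRingCat.of Q)).Opens}
    {W' : (Spec (CommRingCat.of Q')).Opens} (h : W' ≤ Spec.map (CommRingCat.ofHom φ) ⁻¹ᵁ W) :
    ((Spec.map (CommRingCat.ofHom φ)).appLE W W' h).hom.comp (toΓ Q W) = (toΓ Q' W').comp φ := by
  rw [toΓ, toΓ, ← CommRingCat.hom_comp, Category.assoc, Scheme.Hom.map_appLE]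
  have : CommRingCat.ofHom φ ≫ (Scheme.ΓSpecIso (CommRingCat.of Q')).inv ≫
        (Spec (CommRingCat.of Q')).presheaf.map (homOfLE (le_top : W' ≤ ⊤)).op =
      (Scheme.ΓSpecIso (CommRingCat.of Q)).inv ≫
        (Spec.map (CommRingCat.ofHom φ)).appLE ⊤ W' le_top := by
    rw [← Category.assoc (CommRingCat.ofHom φ), Scheme.ΓSpecIso_inv_naturality, Category.assoc]
    rfl
  rw [← this]
  rfl

end AlgebraMaps

/-! ### From deformations over the dual numbers to derivations. -/

section Lifting

variable {p : ℕ} [Fact p.Prime] {k : Type u} [Field k] [Algebra (ZMod p) k]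
variable {V : Type u} [AddCommGroup V] [Module (ZMod p) V]
variable {B : LinearMap.BilinForm (ZMod p) V} {d : ℕ} {X : SchemeOver k}

lemma DL.pull_comp {S T R : SchemeOver k} (f : T ⟶ S) (g : R ⟶ T) (x : DL B d S) :
    x.pull (g ≫ f) = (x.pull f).pull g :=
  DL.ext (Subsheaf.pull_comp _ _ x.L₀) (Subsheaf.pull_comp _ _ x.L₁)

/-- A point of the moduli problem from a basis over the total space. -/
lemma exists_DL {T : SchemeOver k} {m : ℕ} {a : Fin d → Sec p V T ⊤} {e f : Sec p V T ⊤}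
    (b : Module.Basis (((Fin d ⊕ Unit) ⊕ Unit) ⊕ Fin m) Γ(T.left, ⊤) (Sec p V T ⊤))
    (hb : ∀ i, b (Sum.inl i) = snocFam (snocFam a e) f i)
    (isotropic : ∀ i j, B.baseChange Γ(T.left, ⊤) (snocFam a e i) (snocFam a e j) = 0)
    (a_mem : ∀ i, a i ∈ Submodule.span Γ(T.left, ⊤) (Set.range fun i =>
      secMap V (frobHom p Γ(T.left, ⊤)) (snocFam a e i)))
    (f_mem : f ∈ Submodule.span Γ(T.left, ⊤) (Set.range fun i =>
      secMap V (frobHom p Γ(T.left, ⊤)) (snocFam a e i)))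
    (frob_mem : ∀ i, secMap V (frobHom p Γ(T.left, ⊤)) (snocFam a e i) ∈
      Submodule.span Γ(T.left, ⊤) (Set.range (snocFam (snocFam a e) f))) :
    ∃ t : DL B d T, t.L₀.SpannedBy ⊤ a ∧ t.L₁.SpannedBy ⊤ (snocFam a e) := by
  have hf : IsPartOfBasis (R := Γ(T.left, ⊤)) (snocFam (snocFam a e) f) := by
    have := IsPartOfBasis.of_basis b Sum.inl Sum.inl_injective
    simpa only [hb] using this
  have he : IsPartOfBasis (R := Γ(T.left, ⊤)) (snocFam a e) := by
    have := IsPartOfBasis.of_basis b (fun i => Sum.inl (Sum.inl i))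
      (Sum.inl_injective.comp Sum.inl_injective)
    simp only [hb] at this
    exact this
  have ha : IsPartOfBasis (R := Γ(T.left, ⊤)) a := by
    have := IsPartOfBasis.of_basis b (fun i => Sum.inl (Sum.inl (Sum.inl i)))
      (Sum.inl_injective.comp (Sum.inl_injective.comp Sum.inl_injective))
    simp only [hb] at this
    exact this
  obtain ⟨L₀, h₀⟩ := Subsheaf.exists_spannedBy ha
  obtain ⟨L₁, h₁⟩ := Subsheaf.exists_spannedBy he
  have hF := h₁.frobPull he
  -- `f` lies in the Frobenius pull-back, and the generators of that pull-back lie in the span of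
  -- the `a i`, `e`, `f`. Hence the sum is spanned by part of a basis, which makes it a local direct
  -- summand.
  have hsup : (L₁ ⊔ L₁.frobPull).SpannedBy ⊤ (snocFam (snocFam a e) f) := by
    refine h₁.sup hF hf (fun i => Submodule.subset_span ⟨Sum.inl i, rfl⟩) frob_mem ?_
    rintro (i | i)
    · left
      rw [h₁.obj_eq]
      exact Submodule.subset_span ⟨i, rfl⟩
    · right
      rw [hF.obj_eq]
      exact f_mem
  refine ⟨{ L₀ := L₀, L₁ := L₁, le := ?_, summand₀ := ?_, summand₁ := ?_, isotropic₀ := ?_,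
            isotropic₁ := ?_, le_frob := ?_, summand_sup := ?_ }, h₀, h₁⟩
  · refine Subsheaf.le_of_spannedBy_top h₀ fun i => ?_
    rw [h₁.obj_eq]
    exact Submodule.subset_span ⟨Sum.inl i, rfl⟩
  · intro z
    refine ⟨⊤, trivial, ?_⟩
    simpa using h₀.splitOn ha
  · intro z
    refine ⟨⊤, trivial, ?_⟩
    simpa using h₁.splitOn he
  · exact Subsheaf.isIsotropic_of_spannedBy_top h₀ fun i j => isotropic (Sum.inl i) (Sum.inl j)
  · exact Subsheaf.isIsotropic_of_spannedBy_top h₁ isotropic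
  · refine Subsheaf.le_of_spannedBy_top h₀ fun i => ?_
    rw [hF.obj_eq]
    exact a_mem i
  · intro z
    exact ⟨⊤, trivial, _, hsup.splitOn hf⟩

/-- Points whose restriction along a surjective morphism comes from `x` come from `x`. -/
def IsLiftable (x : DL B d X) : Prop :=
  ∀ {T₀ T : SchemeOver k} (j : T₀ ⟶ T) (_ : ∀ y : T.left, ∃ z : T₀.left, j.left z = y)
    (t : DL B d T) (f₀ : T₀ ⟶ X), x.pull f₀ = t.pull j → ∃ f : T ⟶ X, x.pull f = t

open TrivSqZeroExt

/-- The multiples of `ε` have square zero, so they lie in every prime ideal. -/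
lemma exists_fst_preimage (A : Type u) [CommRing A]
    (y : Spec (CommRingCat.of (TrivSqZeroExt A A))) :
    ∃ z : Spec (CommRingCat.of A),
      Spec.map (CommRingCat.ofHom (fstHom A A A).toRingHom) z = y := by
  refine ⟨PrimeSpectrum.comap (inlHom A A) y, ?_⟩
  change PrimeSpectrum.comap (fstHom A A A).toRingHom (PrimeSpectrum.comap (inlHom A A) y) = y
  ext q
  change (inl q.fst : TrivSqZeroExt A A) ∈ y.asIdeal ↔ q ∈ y.asIdeal
  have h : (inr q.snd : TrivSqZeroExt A A) ∈ y.asIdeal := by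
    refine y.2.mem_of_pow_mem 2 ?_
    rw [pow_two, inr_mul_inr]
    exact zero_mem _
  conv_rhs => rw [← inl_fst_add_inr_snd_eq q]
  exact (Ideal.add_mem_iff_left _ h).symm

set_option maxHeartbeats 1000000 in
/-- The vector `e` of an adapted frame over an affine open subset can be moved by a derivation
in any direction. -/
theorem exists_derivation {x : DL B d X} (hx : IsSeparating x) (hx' : IsLiftable x)
    (hB : B.IsSymm) {U : X.left.Opens} (hU : IsAffineOpen U) (F : AdaptedOn x U)
    (v : Sec p V X U) :
    ∃ D : Γ(X.left, U) →+ Γ(X.left, U), IsDerivationAlong (RingHom.id _) D ∧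
      (∀ c : k, D (algebraMap k _ c) = 0) ∧
      addSec V D F.e - v ∈ Submodule.span Γ(X.left, U)
        (Set.range (snocFam (snocFam F.a F.e) F.f)) := by
  obtain ⟨G⟩ := F.exists_deformation hB v
  let A : Type u := Γ(X.left, U)
  let Q : Type u := TrivSqZeroExt A A
  let ι : A →+* Q := inlHom A A
  let π : Q →+* A := (fstHom A A A).toRingHom
  let T : SchemeOver k := specOver hU ι
  let τ : Q →+* Γ(T.left, ⊤) := toΓ Q ⊤
  let T₀ : SchemeOver k := specOver hU (π.comp ι)
  let j : T₀ ⟶ T := specOverTrans hU ι π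
  have hfst : ∀ s : Q ⊗[ZMod p] V, fstSec s = secMap V π s := fun _ => rfl
  have hπι : π.comp ι = RingHom.id A := RingHom.ext fun a => rfl
  obtain ⟨b, hb, -⟩ := exists_basis_secMap τ G.basis
  have hmem : ∀ {κ : Type} {v : κ → Q ⊗[ZMod p] V} {s : Q ⊗[ZMod p] V},
      s ∈ Submodule.span Q (Set.range v) →
      secMap V τ s ∈ Submodule.span Γ(T.left, ⊤) (Set.range fun i => secMap V τ (v i)) :=
    fun hs => secMap_mem_span τ _ hs
  have hsnoc : snocFam (fun i => secMap V τ (G.a i)) (secMap V τ G.e) =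
      fun i => secMap V τ (snocFam G.a G.e i) := (comp_snocFam (secMap V τ) G.a G.e).symm
  have hsnoc' : snocFam (snocFam (fun i => secMap V τ (G.a i)) (secMap V τ G.e))
      (secMap V τ G.f) = fun i => secMap V τ (snocFam (snocFam G.a G.e) G.f i) :=
    (congrArg (fun w => snocFam w (secMap V τ G.f)) hsnoc).trans
      (comp_snocFam (secMap V τ) (snocFam G.a G.e) G.f).symm
  have hF : (fun i => secMap V (frobHom p Γ(T.left, ⊤))
      (snocFam (fun i => secMap V τ (G.a i)) (secMap V τ G.e) i)) =
      fun i => secMap V τ (secMap V (frobHom p Q) (snocFam G.a G.e i)) := by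
    rw [hsnoc]
    funext i
    exact (secMap_frob τ _).symm
  -- The deformed frame defines a point `t` of the moduli problem over the spectrum of the dual
  -- numbers.
  obtain ⟨t, ht₀, ht₁⟩ := exists_DL (B := B) (T := T) (a := fun i => secMap V τ (G.a i))
    (e := secMap V τ G.e) (f := secMap V τ G.f) b
    (fun i => by rw [hb, G.basis_eq, hsnoc'])
    (fun i i' => by
      rw [hsnoc, secMap_baseChange, G.isotropic, map_zero])
    (fun i => by rw [hF]; exact hmem (G.a_mem i))
    (by rw [hF]; exact hmem G.f_mem)
    (fun i => by
      rw [congr_fun hF i, hsnoc']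
      exact hmem (G.frob_mem i))
  let f₀ : T₀ ⟶ X := specOverMap hU (π.comp ι) (π.comp ι) fun _ => rfl
  have hf₀ : (⊤ : T₀.left.Opens) ≤ f₀.left ⁻¹ᵁ U := (specMap_preimage hU _).ge
  -- Modulo `ε` the deformed frame is `F`, so on the reduction `t` induces the flag of `x` pulled
  -- back along `f₀`.
  have pulls : ∀ {L : Subsheaf p V X} {L' : Subsheaf p V T} {κ : Type} [Fintype κ]
      {v : κ → Sec p V X U} {w : κ → Q ⊗[ZMod p] V}
      (_ : L.SpannedBy U v) (_ : IsPartOfBasis (R := Γ(X.left, U)) v)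
      (_ : L'.SpannedBy ⊤ fun i => secMap V τ (w i))
      (_ : IsPartOfBasis (R := Γ(T.left, ⊤)) fun i => secMap V τ (w i))
      (_ : ∀ i, fstSec (w i) = v i), L.pull f₀.left = L'.pull j.left := by
    intro L L' κ _ v w h₁ h₂ h₃ h₄ h₅
    refine Subsheaf.eq_of_spannedBy_top (h₁.pull h₂ f₀.left (W := ⊤) hf₀)
      (h₃.pull h₄ j.left (W := ⊤) le_top) ?_
    congr 2
    funext i
    have e₁ := pbLE_specOverMap hU (π.comp ι) (π.comp ι) (fun _ => rfl) (W := ⊤) hf₀ (v i)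
    refine e₁.trans ?_
    have e₂ : pbLE j.left (W := ⊤) (U := ⊤) le_top (secMap V τ (w i)) =
        secMap V (A' := Γ(T₀.left, ⊤)) (toΓ A ⊤) (secMap V π (w i)) := by
      refine (secMap_comp _ _ _ _).trans (Eq.trans ?_ (secMap_comp _ _ _ _).symm)
      exact congrArg (fun φ : Q →+* Γ(T₀.left, ⊤) => secMap V φ (w i))
        (appLE_toΓ π (W := ⊤) (W' := ⊤) le_top)
    refine Eq.trans ?_ e₂.symm
    refine congrArg (secMap V (A' := Γ(T₀.left, ⊤)) (toΓ A ⊤))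
      (show secMap V (π.comp ι) (v i) = secMap V π (w i) from ?_)
    rw [hπι, secMap_id, ← h₅, hfst]
  have hG : ∀ i, fstSec (snocFam G.a G.e i) = snocFam F.a F.e i := by
    rintro (i | i)
    · exact G.fst_a i
    · exact G.fst_e
  rw [hsnoc] at ht₁
  have he : IsPartOfBasis (R := Γ(T.left, ⊤)) fun i => secMap V τ (snocFam G.a G.e i) := by
    have := IsPartOfBasis.of_basis b (fun i => Sum.inl (Sum.inl i))
      (Sum.inl_injective.comp Sum.inl_injective)
    simp only [hb, G.basis_eq] at this
    exact this
  have ha : IsPartOfBasis (R := Γ(T.left, ⊤)) fun i => secMap V τ (G.a i) := by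
    have := IsPartOfBasis.of_basis b (fun i => Sum.inl (Sum.inl (Sum.inl i)))
      (Sum.inl_injective.comp (Sum.inl_injective.comp Sum.inl_injective))
    simp only [hb, G.basis_eq] at this
    exact this
  obtain ⟨f, hf⟩ := hx' j (exists_fst_preimage A) t f₀
    (DL.ext (pulls F.spanned₀ F.isPart_a ht₀ ha G.fst_a) (pulls F.spanned₁ F.isPart_e ht₁ he hG))
  -- Liftability gives `f` but does not prescribe its restriction to the reduction; separation
  -- identifies that restriction with `f₀`.
  have hjf : j ≫ f = f₀ := hx _ _ (by
    rw [DL.pull_comp, hf]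
    exact (DL.ext (pulls F.spanned₀ F.isPart_a ht₀ ha G.fst_a)
      (pulls F.spanned₁ F.isPart_e ht₁ he hG)).symm)
  -- The reduction already contains all points, so `f` lands in `U` because `f₀` does.
  have hfU : (⊤ : T.left.Opens) ≤ f.left ⁻¹ᵁ U := by
    intro y _
    obtain ⟨z, rfl⟩ := exists_fst_preimage A y
    have : f₀.left z ∈ U := hf₀ (show z ∈ (⊤ : T₀.left.Opens) from trivial)
    rw [← hjf] at this
    exact this
  let τe : Q ≃+* Γ(T.left, ⊤) := RingEquiv.ofBijective τ toΓ_top_bijective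
  -- On functions `f` is a ring homomorphism `σ` from `A` to its dual numbers that reduces to the
  -- identity of `A`, so its `ε`-part is a derivation; it kills `k` because `f` is a `k`-morphism.
  let σ : A →+* Q := (τe.symm : Γ(T.left, ⊤) →+* Q).comp (f.left.appLE U ⊤ hfU).hom
  have hτσ : ∀ a, τ (σ a) = (f.left.appLE U ⊤ hfU).hom a := fun a => τe.apply_symm_apply _
  have hσ : ∀ a, (σ a).fst = a := by
    intro a
    have h₁ := RingHom.congr_fun (appLE_toΓ π (W := ⊤) (W' := ⊤) le_top) (σ a)
    refine (toΓ_top_bijective (Q := A)).1 (h₁.symm.trans ?_)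
    have hj : (⊤ : T₀.left.Opens) ≤ j.left ⁻¹ᵁ ⊤ := le_top
    have h₂ : f.left.appLE U ⊤ hfU ≫ j.left.appLE ⊤ ⊤ hj = f₀.left.appLE U ⊤ hf₀ := by
      refine (Scheme.Hom.appLE_comp_appLE j.left f.left U ⊤ ⊤ hfU hj).trans ?_
      simp only [← hjf]
      rfl
    have h₃ := RingHom.congr_fun (congrArg CommRingCat.Hom.hom h₂) a
    have h₄ := RingHom.congr_fun (specMap_appLE hU (π.comp ι) le_rfl hf₀) a
    have h₅ : (X.left.presheaf.map (homOfLE (le_refl U)).op).hom a = a := ores_self _ a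
    refine (congrArg (j.left.appLE ⊤ ⊤ hj).hom (hτσ a)).trans (h₃.trans (h₄.trans ?_))
    change toΓ A ⊤ ((X.left.presheaf.map (homOfLE (le_refl U)).op).hom a) = _
    rw [h₅]
  have hσk : ∀ c : k, (σ (algebraMap k _ c)).snd = 0 := by
    intro c
    have : σ (algebraMap k _ c) = ι (algebraMap k _ c) := by
      refine (toΓ_top_bijective (Q := Q)).1 ?_
      refine (hτσ _).trans ((appLE_algebraMap f hfU c).trans ?_)
      exact (toΓ_algebraMap hU ι ⊤ c).symm
    rw [this]
    exact snd_inl _ _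
  let D : A →+ A := (sndHom A A).toAddMonoidHom.comp σ.toAddMonoidHom
  refine ⟨D, fun a c => ?_, hσk, ?_⟩
  · change (σ (a * c)).snd = a * (σ c).snd + c * (σ a).snd
    rw [map_mul, snd_mul, hσ, hσ, op_smul_eq_smul]
    rfl
  -- `f` pulls `L_{d+1}` back to that of `t`, so `σ` carries `e` into the deformed module. Its
  -- `ε`-part `D e` is then `v` modulo `L_{d+1} + Frob^* L_{d+1}`.
  · have h₁ : secMap V σ F.e ∈ Submodule.span Q (Set.range (snocFam G.a G.e)) := by
      have h₂ := F.spanned₁.pull_obj F.isPart_e f.left hfU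
      have h₃ : (x.L₁.pull f.left) = t.L₁ := congrArg (fun y => y.L₁) hf
      rw [h₃, ht₁.obj_eq] at h₂
      have h₄ : pbLE f.left hfU F.e ∈ Submodule.span Γ(T.left, ⊤)
          (Set.range fun i => secMap V τ (snocFam G.a G.e i)) := by
        rw [h₂]
        exact Submodule.subset_span ⟨Sum.inr (), rfl⟩
      have h₅ := secMap_mem_span (τe.symm : Γ(T.left, ⊤) →+* Q) _ h₄
      have h₆ : ∀ s : Q ⊗[ZMod p] V, secMap V (τe.symm : Γ(T.left, ⊤) →+* Q) (secMap V τ s) = s := by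
        intro s
        rw [secMap_comp]
        have : (τe.symm : Γ(T.left, ⊤) →+* Q).comp τ = RingHom.id Q :=
          RingHom.ext fun q => τe.symm_apply_apply q
        rw [this, secMap_id]
      simp only [h₆] at h₅
      rw [pbLE, secMap_comp] at h₅
      exact h₅
    have h₇ := G.sndSec_sub_mem h₁ (by
      rw [fstSec_secMap]
      have : (fstHom A A A).toRingHom.comp σ = RingHom.id A := RingHom.ext hσ
      rw [this, secMap_id])
    rw [sndSec_secMap] at h₇
    exact h₇

end Lifting

/-! ### The Kodaira–Spencer map -/

section Gluing

variable {k : Type u} [Field k] {X : SchemeOver k}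

lemma ores_glue' (W : X.left.Opens) {ι : Type u} (Z : ι → X.left.Opens) (hZ : ∀ i, Z i ≤ W)
    (hW : W ≤ iSup Z) (s : ∀ i, Γ(X.left, Z i))
    (hs : ∀ i j, ores X.left (inf_le_left : Z i ⊓ Z j ≤ Z i) (s i) =
      ores X.left (inf_le_right : Z i ⊓ Z j ≤ Z j) (s j)) :
    ∃ t : Γ(X.left, W), ∀ i, ores X.left (hZ i) t = s i := by
  obtain rfl : W = iSup Z := le_antisymm hW (iSup_le hZ)
  exact ores_glue Z s hs

lemma exists_isAffineOpen_le {X : Scheme.{u}} {W : X.Opens} {y : X} (hy : y ∈ W) :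
    ∃ Z ≤ W, y ∈ Z ∧ IsAffineOpen Z := by
  obtain ⟨Z, hZ, hyZ, h⟩ := exists_isAffineOpen_mem_and_subset hy
  exact ⟨Z, h, hyZ, hZ⟩

/-- A compatible family of derivations on the affine open subsets extends to all open subsets. -/
lemma exists_derOn {U : X.left.Opens}
    (D : ∀ Z : X.left.Opens, Z ≤ U → IsAffineOpen Z → (Γ(X.left, Z) →+ Γ(X.left, Z)))
    (hD : ∀ Z hZ hZ', IsDerivationAlong (RingHom.id _) (D Z hZ hZ'))
    (hk : ∀ Z hZ hZ' (c : k), D Z hZ hZ' (algebraMap k _ c) = 0)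
    (hres : ∀ Z hZ hZ' W hW hW' (h : W ≤ Z) (s : Γ(X.left, Z)),
      D W hW hW' (ores X.left h s) = ores X.left h (D Z hZ hZ' s)) :
    ∃ E : derOn X U, ∀ Z hZ hZ' s, E.1 ⟨Z, hZ⟩ s = D Z hZ hZ' s := by
  -- The value on `W` is glued over all affine open subsets of `W`. Their intersections need not be
  -- affine, so the overlaps are compared on smaller affine open subsets.
  have ex : ∀ (W : {W : X.left.Opens // W ≤ U}) (s : Γ(X.left, W.1)), ∃ t : Γ(X.left, W.1),
      ∀ Z (hZ : Z ≤ W.1) hZ', ores X.left hZ t = D Z (hZ.trans W.2) hZ' (ores X.left hZ s) := by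
    intro W s
    let ι : Type u := {Z : X.left.Opens // Z ≤ W.1 ∧ IsAffineOpen Z}
    obtain ⟨t, ht⟩ := ores_glue' W.1 (fun Z : ι => Z.1) (fun Z => Z.2.1)
      (fun y hy => by
        obtain ⟨Z, hZ, hyZ, hZ'⟩ := exists_isAffineOpen_le hy
        exact Opens.mem_iSup.2 ⟨⟨Z, hZ, hZ'⟩, hyZ⟩)
      (fun Z => D Z.1 (Z.2.1.trans W.2) Z.2.2 (ores X.left Z.2.1 s))
      (fun Z Z' => by
        refine ores_sep _ _ fun y hy => ?_
        obtain ⟨Y, hY, hyY, hY'⟩ := exists_isAffineOpen_le hy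
        refine ⟨Y, hY, hyY, ?_⟩
        rw [ores_res, ores_res,
          ← hres _ _ _ Y (hY.trans (inf_le_left.trans (Z.2.1.trans W.2))) hY',
          ← hres _ _ _ Y (hY.trans (inf_le_left.trans (Z.2.1.trans W.2))) hY',
          ores_res, ores_res])
    exact ⟨t, fun Z hZ hZ' => ht ⟨Z, hZ, hZ'⟩⟩
  choose ψ hψ using ex
  have sep : ∀ (W : {W : X.left.Opens // W ≤ U}) (s t : Γ(X.left, W.1)),
      (∀ Z (hZ : Z ≤ W.1), IsAffineOpen Z → ores X.left hZ s = ores X.left hZ t) → s = t := by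
    intro W s t h
    refine ores_sep _ _ fun y hy => ?_
    obtain ⟨Z, hZ, hyZ, hZ'⟩ := exists_isAffineOpen_le hy
    exact ⟨Z, hZ, hyZ, h Z hZ hZ'⟩
  have hadd : ∀ W a b, ψ W (a + b) = ψ W a + ψ W b := by
    refine fun W a b => sep W _ _ fun Z hZ hZ' => ?_
    rw [map_add, hψ W _ Z hZ hZ', hψ W _ Z hZ hZ', hψ W _ Z hZ hZ', map_add, map_add]
  have hmul : ∀ W a b, ψ W (a * b) = a * ψ W b + b * ψ W a := by
    refine fun W a b => sep W _ _ fun Z hZ hZ' => ?_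
    rw [map_add, map_mul, map_mul, hψ W _ Z hZ hZ', hψ W _ Z hZ hZ', hψ W _ Z hZ hZ', map_mul,
      hD]
    rfl
  have halg : ∀ W (c : k), ψ W (algebraMap k _ c) = 0 := by
    refine fun W c => sep W _ _ fun Z hZ hZ' => ?_
    rw [hψ W _ Z hZ hZ', ores, structMap_res, hk, map_zero]
  refine ⟨⟨fun W => Derivation.mk'
    { toFun := ψ W
      map_add' := hadd W
      map_smul' := fun c a => ?_ } (hmul W), fun W W' h s => ?_⟩, fun Z hZ hZ' s => ?_⟩
  · rw [Algebra.smul_def, hmul, halg, mul_zero, add_zero, RingHom.id_apply, Algebra.smul_def]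
  · refine sep W' _ _ fun Z hZ hZ' => ?_
    change ores X.left hZ (ψ W' _) = ores X.left hZ (ores X.left h (ψ W s))
    rw [hψ W' _ Z hZ hZ', ores_res, ores_res, hψ W _ Z (hZ.trans h) hZ']
  · have := hψ ⟨Z, hZ⟩ s Z le_rfl hZ'
    rwa [ores_self, ores_self] at this

end Gluing

/-! ### The map induced by a derivation, and its bijectivity. -/

section KodairaSpencer

lemma addSec_mulLeft {p : ℕ} [Fact p.Prime] {V : Type u} [AddCommGroup V] [Module (ZMod p) V]
    {A R : Type u} [CommRing A] [CommRing R] [Algebra (ZMod p) A] [Algebra (ZMod p) R] (c : R)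
    (f : A →+ R) (s : A ⊗[ZMod p] V) :
    addSec V ((AddMonoidHom.mulLeft c).comp f) s = c • addSec V f s := by
  induction s with
  | zero => simp
  | add t t' h h' => rw [map_add, map_add, smul_add, h, h']
  | tmul b v => rfl

variable {p : ℕ} [Fact p.Prime] {k : Type u} [Field k] [Algebra (ZMod p) k]
variable {V : Type u} [AddCommGroup V] [Module (ZMod p) V] {X : SchemeOver k}

/-- The lattice structure is built from infima, so `⊤` is compared with the explicit subsheaf of all
sections. -/
lemma Subsheaf.mem_top_obj {U : X.left.Opens} (s : Sec p V X U) :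
    s ∈ (⊤ : Subsheaf p V X).obj U := by
  let S : Subsheaf p V X :=
    { obj := fun _ => ⊤, res_mem := fun _ _ _ => trivial, local_mem := fun _ _ => trivial }
  exact (le_top : S ≤ ⊤) U (show s ∈ (⊤ : Submodule _ _) from trivial)

/-- The additive maps underlying a derivation of sheaves. -/
def derAdd {U : X.left.Opens} (D : derOn X U) (W : {W : X.left.Opens // W ≤ U}) :
    Γ(X.left, W.1) →+ Γ(X.left, W.1) := (D.1 W).toLinearMap.toAddMonoidHom

lemma isDerivationAlong_derAdd {U : X.left.Opens} (D : derOn X U)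
    (W : {W : X.left.Opens // W ≤ U}) : IsDerivationAlong (RingHom.id _) (derAdd D W) :=
  fun a b => (D.1 W).leibniz a b

variable (V) in
/-- The action of a derivation on the sections of `V ⊗ 𝒪_X`. -/
def derSec {U : X.left.Opens} (D : derOn X U) (W : {W : X.left.Opens // W ≤ U}) :
    Sec p V X W.1 →ₗ[ZMod p] Sec p V X W.1 := addSec V (derAdd D W)

lemma derSec_smul {U : X.left.Opens} (D : derOn X U) (W : {W : X.left.Opens // W ≤ U})
    (a : Γ(X.left, W.1)) (s : Sec p V X W.1) :
    derSec V D W (a • s) = a • derSec V D W s + D.1 W a • s := by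
  have := (isDerivationAlong_derAdd D W).addSec_smul a s
  rw [secMap_id] at this
  exact this

lemma derSec_res {U : X.left.Opens} (D : derOn X U) {W W' : {W : X.left.Opens // W ≤ U}}
    (h : W'.1 ≤ W.1) (s : Sec p V X W.1) :
    derSec V D W' (res V X h s) = res V X h (derSec V D W s) := by
  rw [derSec, derSec, res, secMap_eq_addSec, secMap_eq_addSec, addSec_comp, addSec_comp]
  exact congrArg (fun φ => addSec V φ s) (AddMonoidHom.ext fun a => D.2 W W' h a)

variable {B : LinearMap.BilinForm (ZMod p) V} {d : ℕ} (x : DL B d X)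

/-- Derivations preserve `Frob^* L_{d+1}`. -/
lemma derSec_mem_frobPull {U : X.left.Opens} (D : derOn X U) (W : {W : X.left.Opens // W ≤ U})
    {s : Sec p V X W.1} (hs : s ∈ x.L₁.frobPull.obj W.1) :
    derSec V D W s ∈ x.L₁.frobPull.obj W.1 := by
  -- The claim is local. Where `L_{d+1}` has a basis, its Frobenius pull-back is spanned by vectors
  -- that `D` kills.
  refine x.L₁.frobPull.local_mem _ fun y hy => ?_
  obtain ⟨W₁, hyW₁, hW₁⟩ := x.summand₁ y
  obtain ⟨b, hb, hLb⟩ := hW₁.exists_spannedBy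
  refine ⟨W.1 ⊓ W₁, inf_le_left, ⟨hy, hyW₁⟩, ?_⟩
  have hb' := hb.secMap (X.left.presheaf.map (homOfLE (inf_le_right : W.1 ⊓ W₁ ≤ W₁)).op).hom
  have hLb' := ((hLb.restrict (inf_le_right : W.1 ⊓ W₁ ≤ W₁)).frobPull hb').obj_eq
  have h₁ := x.L₁.frobPull.res_mem (inf_le_left : W.1 ⊓ W₁ ≤ W.1) hs
  rw [← derSec_res D (W' := ⟨W.1 ⊓ W₁, inf_le_left.trans W.2⟩)]
  rw [hLb'] at h₁ ⊢
  have := (isDerivationAlong_derAdd D ⟨W.1 ⊓ W₁, inf_le_left.trans W.2⟩).addSec_mem_of_frob _ h₁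
  simp only [secMap_id] at this
  exact this

variable [Module.Finite (ZMod p) V]

namespace DL

/-- The projection from `V ⊗ 𝒪` to its quotient by `L_{d+1} + Frob^* L_{d+1}` on sections. -/
def toCokernel (U : X.left.Opens) : Sec p V X U →ₗ[Γ(X.left, U)] Γ(x.cokernelBundle, U) :=
  (Subsheaf.proj (le_top : x.L₁ ⊔ x.L₁.frobPull ≤ ⊤) U).comp
    (LinearMap.codRestrict _ LinearMap.id Subsheaf.mem_top_obj)

lemma toCokernel_res {U W : X.left.Opens} (h : W ≤ U) (s : Sec p V X U) :
    x.toCokernel W (res V X h s) = mres x.cokernelBundle h (x.toCokernel U s) :=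
  Subsheaf.proj_res le_top h ⟨s, Subsheaf.mem_top_obj s⟩

lemma toCokernel_eq_zero_iff {U : X.left.Opens} {s : Sec p V X U} :
    x.toCokernel U s = 0 ↔ s ∈ (x.L₁ ⊔ x.L₁.frobPull).obj U :=
  ⟨fun h => Subsheaf.mem_of_proj_eq_zero le_top ⟨s, Subsheaf.mem_top_obj s⟩ h,
    fun h => Subsheaf.proj_eq_zero le_top ⟨s, Subsheaf.mem_top_obj s⟩ h⟩

lemma toCokernel_locally_surjective {U : X.left.Opens} (q : Γ(x.cokernelBundle, U)) {y : X.left}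
    (hy : y ∈ U) : ∃ (W : X.left.Opens) (hW : W ≤ U) (_ : y ∈ W) (t : Sec p V X W),
      x.toCokernel W t = mres _ hW q := by
  obtain ⟨W, hW, hyW, t, ht⟩ := Subsheaf.proj_locally_surjective
    (le_top : x.L₁ ⊔ x.L₁.frobPull ≤ ⊤) q hy
  exact ⟨W, hW, hyW, t.1, ht⟩

/-- The projection from `L_{d+1}` to `L_{d+1} / L_d` on sections. -/
def toLine (U : X.left.Opens) : x.L₁.obj U →ₗ[Γ(X.left, U)] Γ(x.lineBundle, U) :=
  Subsheaf.proj x.le U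

lemma toLine_res {U W : X.left.Opens} (h : W ≤ U) (s : x.L₁.obj U) :
    x.toLine W ⟨res V X h s.1, x.L₁.res_mem h s.2⟩ = mres x.lineBundle h (x.toLine U s) :=
  Subsheaf.proj_res x.le h s

lemma toLine_eq_zero {U : X.left.Opens} (s : x.L₁.obj U) (hs : s.1 ∈ x.L₀.obj U) :
    x.toLine U s = 0 := Subsheaf.proj_eq_zero x.le s hs

variable {x} in
lemma homOn_lineBundle_ext {N : X.left.Modules} {U : X.left.Opens} {φ ψ : homOn x.lineBundle N U}
    (e : ∀ (W : {W : X.left.Opens // W ≤ U}) (s : x.L₁.obj W.1),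
      φ.1 W (x.toLine W.1 s) = ψ.1 W (x.toLine W.1 s)) : φ = ψ :=
  Subsheaf.homOn_quotient_ext x.le e

/-- The map `L_{d+1} → V ⊗ 𝒪 / (L_{d+1} + Frob^* L_{d+1})` that is induced by a derivation. -/
def secondForm {U : X.left.Opens} (D : derOn X U) (W : {W : X.left.Opens // W ≤ U}) :
    x.L₁.obj W.1 →ₗ[Γ(X.left, W.1)] Γ(x.cokernelBundle, W.1) where
  toFun s := x.toCokernel W.1 (derSec V D W s.1)
  map_add' s t := by
    rw [Submodule.coe_add, map_add, map_add]
  map_smul' a s := by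
    -- The Leibniz term `D(a) s` dies in the quotient because `s` lies in `L_{d+1}`.
    have : x.toCokernel W.1 s.1 = 0 :=
      x.toCokernel_eq_zero_iff.2 ((le_sup_left : x.L₁ ≤ x.L₁ ⊔ x.L₁.frobPull) W.1 s.2)
    rw [Submodule.coe_smul, derSec_smul, map_add, map_smul, map_smul, this, smul_zero, add_zero,
      RingHom.id_apply]

/-- This is where `L_d ⊆ Frob^* L_{d+1}` enters: derivations preserve the right-hand side, so `D s`
is zero in the quotient. -/
lemma secondForm_eq_zero {U : X.left.Opens} (D : derOn X U) (W : {W : X.left.Opens // W ≤ U})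
    (s : x.L₁.obj W.1) (hs : s.1 ∈ x.L₀.obj W.1) : x.secondForm D W s = 0 :=
  x.toCokernel_eq_zero_iff.2 ((le_sup_right : x.L₁.frobPull ≤ x.L₁ ⊔ x.L₁.frobPull) W.1
    (derSec_mem_frobPull x D W (x.le_frob W.1 hs)))

lemma exists_kodairaSpencer {U : X.left.Opens} (D : derOn X U) :
    ∃ φ : homOn x.lineBundle x.cokernelBundle U,
      ∀ W s, φ.1 W (x.toLine W.1 s) = x.secondForm D W s :=
  Subsheaf.exists_homOn_quotient x.le (x.secondForm D)
    (fun W W' h s => by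
      change x.toCokernel W'.1 (derSec V D W' (res V X h s.1)) = _
      rw [derSec_res, toCokernel_res]
      rfl)
    (x.secondForm_eq_zero D)

/-- The Kodaira–Spencer map. -/
def kodairaSpencer (U : X.left.Opens) :
    derOn X U →ₗ[Γ(X.left, U)] homOn x.lineBundle x.cokernelBundle U where
  toFun D := (x.exists_kodairaSpencer D).choose
  map_add' D E := by
    refine homOn_lineBundle_ext fun W s => ?_
    rw [(x.exists_kodairaSpencer (D + E)).choose_spec]
    refine Eq.trans ?_ (congrArg₂ (· + ·) ((x.exists_kodairaSpencer D).choose_spec W s).symm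
      ((x.exists_kodairaSpencer E).choose_spec W s).symm)
    change x.toCokernel W.1 _ = x.toCokernel W.1 _ + x.toCokernel W.1 _
    rw [← map_add, derSec, derSec, derSec, ← addSec_add]
    rfl
  map_smul' a D := by
    refine homOn_lineBundle_ext fun W s => ?_
    rw [(x.exists_kodairaSpencer (a • D)).choose_spec]
    refine Eq.trans ?_ (congrArg (fun z => ores X.left W.2 a • z)
      ((x.exists_kodairaSpencer D).choose_spec W s).symm)
    change x.toCokernel W.1 _ = ores X.left W.2 a • x.toCokernel W.1 _
    rw [← map_smul]
    exact congrArg (x.toCokernel W.1) (addSec_mulLeft (ores X.left W.2 a) (derAdd D W) s.1)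

lemma kodairaSpencer_proj {U : X.left.Opens} (D : derOn X U)
    (W : {W : X.left.Opens // W ≤ U}) (s : x.L₁.obj W.1) :
    (x.kodairaSpencer U D).1 W (x.toLine W.1 s) = x.secondForm D W s :=
  (x.exists_kodairaSpencer D).choose_spec W s

lemma kodairaSpencer_res {U U' : X.left.Opens} (h : U' ≤ U) (D : derOn X U) :
    x.kodairaSpencer U' (derRes X h D) = homRes _ _ h (x.kodairaSpencer U D) := by
  refine homOn_lineBundle_ext fun W s => ?_
  rw [kodairaSpencer_proj]
  exact (x.kodairaSpencer_proj D ⟨W.1, W.2.trans h⟩ s).symm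

/-- Every point has arbitrarily small affine neighbourhoods with an adapted frame. -/
def HasFrames : Prop :=
  ∀ {y : X.left} {U₀ : X.left.Opens}, y ∈ U₀ →
    ∃ U ≤ U₀, y ∈ U ∧ IsAffineOpen U ∧ Nonempty (AdaptedOn x U)

variable {x}

/-- If the image of `D` is zero, then in every adapted frame `D e` lies in `L_{d+1} + Frob^*
L_{d+1}`, and `derivation_eq_zero` applies. -/
lemma kodairaSpencer_injective (hx : IsSeparating x) (hF : x.HasFrames) (hB : B.IsSymm)
    (hp : p ≠ 2) (U : X.left.Opens) : Function.Injective (x.kodairaSpencer U) := by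
  rw [injective_iff_map_eq_zero]
  intro D hD
  ext W a
  refine ores_sep _ _ fun y hy => ?_
  obtain ⟨Z, hZ, hyZ, hZ', ⟨F⟩⟩ := hF hy
  refine ⟨Z, hZ, hyZ, ?_⟩
  have he : F.e ∈ x.L₁.obj Z := by
    rw [F.spanned₁.obj_eq]
    exact Submodule.subset_span ⟨Sum.inr (), rfl⟩
  have h₁ := x.kodairaSpencer_proj D ⟨Z, hZ.trans W.2⟩ ⟨F.e, he⟩
  rw [hD] at h₁
  have h₂ := x.toCokernel_eq_zero_iff.1 h₁.symm
  rw [F.spanned_sup.obj_eq] at h₂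
  have h₃ := derivation_eq_zero hx hB hp hZ' F
    (isDerivationAlong_derAdd D ⟨Z, hZ.trans W.2⟩)
    (fun c => (D.1 ⟨Z, hZ.trans W.2⟩).map_algebraMap c) (by
      have : snocFam (snocFam (F.map (RingHom.id _)).a (F.map (RingHom.id _)).e)
          (F.map (RingHom.id _)).f = snocFam (snocFam F.a F.e) F.f := by
        funext i
        rcases i with (i | i) | i <;> exact secMap_id V _
      rw [this]
      exact h₂)
  have h₄ := D.2 W ⟨Z, hZ.trans W.2⟩ hZ a
  rw [← h₄]
  exact (DFunLike.congr_fun h₃ _).trans (map_zero _).symm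

-- Near `y` the homomorphism `ψ` is determined by its value on the class of `e`, which lifts to some
-- `v` in `V ⊗ 𝒪`. Each affine open subset has a derivation with `D e ≡ v`, and rigidity makes these
-- derivations compatible.
set_option maxHeartbeats 1000000 in
lemma exists_local_preimage (hx : IsSeparating x) (hx' : IsLiftable x) (hF : x.HasFrames)
    (hB : B.IsSymm) (hp : p ≠ 2) {U : X.left.Opens}
    (ψ : homOn x.lineBundle x.cokernelBundle U) {y : X.left} (hy : y ∈ U) :
    ∃ (W : X.left.Opens) (hW : W ≤ U) (_ : y ∈ W) (D : derOn X W),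
      x.kodairaSpencer W D = homRes _ _ hW ψ := by
  obtain ⟨W₁, hW₁, hyW₁, -, ⟨F⟩⟩ := hF hy
  have he : F.e ∈ x.L₁.obj W₁ := by
    rw [F.spanned₁.obj_eq]
    exact Submodule.subset_span ⟨Sum.inr (), rfl⟩
  obtain ⟨W, hW, hyW, v, hv⟩ := x.toCokernel_locally_surjective
    (U := W₁) (ψ.1 ⟨W₁, hW₁⟩ (x.toLine W₁ ⟨F.e, he⟩)) hyW₁
  choose D hD hk hDe using fun (Z : X.left.Opens) (hZ : Z ≤ W) (hZ' : IsAffineOpen Z) =>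
    exists_derivation hx hx' hB hZ' (F.restrict (hZ.trans hW)) (res V X hZ v)
  obtain ⟨E, hE⟩ := exists_derOn D hD hk (by
    intro Z hZ hZ' Z₁ hZ₁ hZ₁' h s
    let ρ : Γ(X.left, Z) →+* Γ(X.left, Z₁) := ores X.left h
    -- The failure of compatibility is a derivation along the restriction map. It moves `e` within
    -- `L_{d+1} + Frob^* L_{d+1}`, since both choices are congruent to `v`, hence it vanishes.
    let Δ : Γ(X.left, Z) →+ Γ(X.left, Z₁) :=
      (D Z₁ hZ₁ hZ₁').comp ρ.toAddMonoidHom - ρ.toAddMonoidHom.comp (D Z hZ hZ')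
    have hΔ : IsDerivationAlong ρ Δ := by
      intro a b
      change D Z₁ hZ₁ hZ₁' (ρ (a * b)) - ρ (D Z hZ hZ' (a * b)) =
        ρ a * (D Z₁ hZ₁ hZ₁' (ρ b) - ρ (D Z hZ hZ' b)) +
        ρ b * (D Z₁ hZ₁ hZ₁' (ρ a) - ρ (D Z hZ hZ' a))
      rw [map_mul, hD, hD, map_add, map_mul, map_mul]
      simp only [RingHom.id_apply]
      ring
    have h0 : Δ = 0 := by
      refine derivation_eq_zero hx hB hp hZ' (F.restrict (hZ.trans hW)) hΔ (fun c => ?_) ?_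
      · change D Z₁ hZ₁ hZ₁' (ores X.left h (algebraMap k _ c)) -
          ores X.left h (D Z hZ hZ' (algebraMap k _ c)) = 0
        rw [ores, structMap_res, hk, hk, map_zero, sub_zero]
      · have e₁ : addSec V Δ (F.restrict (hZ.trans hW)).e =
            (addSec V (D Z₁ hZ₁ hZ₁') (F.restrict (hZ₁.trans hW)).e - res V X hZ₁ v) -
            secMap V ρ (addSec V (D Z hZ hZ') (F.restrict (hZ.trans hW)).e - res V X hZ v) := by
          have h₁ : Δ + ρ.toAddMonoidHom.comp (D Z hZ hZ') =
              (D Z₁ hZ₁ hZ₁').comp ρ.toAddMonoidHom := sub_add_cancel _ _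
          have h₂ := congrArg (fun φ => addSec V φ (F.restrict (hZ.trans hW)).e) h₁
          rw [addSec_add, ← addSec_comp, ← addSec_comp, ← secMap_eq_addSec,
            ← secMap_eq_addSec] at h₂
          have h₃ : secMap V ρ (F.restrict (hZ.trans hW)).e = (F.restrict (hZ₁.trans hW)).e :=
            res_res X (hZ.trans hW) h F.e
          have h₄ : secMap V ρ (res V X hZ v) = res V X hZ₁ v := res_res X hZ h v
          rw [h₃] at h₂
          rw [map_sub, h₄, ← h₂]
          abel
        have e₂ : snocFam (snocFam (F.restrict (hZ₁.trans hW)).a (F.restrict (hZ₁.trans hW)).e)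
            (F.restrict (hZ₁.trans hW)).f =
          snocFam (snocFam ((F.restrict (hZ.trans hW)).map ρ).a
            ((F.restrict (hZ.trans hW)).map ρ).e) ((F.restrict (hZ.trans hW)).map ρ).f := by
          funext i
          rcases i with (i | i) | i <;> exact (res_res X (hZ.trans hW) h _).symm
        rw [e₁]
        refine sub_mem ?_ ?_
        · rw [← e₂]
          exact hDe Z₁ hZ₁ hZ₁'
        · have := secMap_mem_span ρ _ (hDe Z hZ hZ')
          rw [comp_snocFam (secMap V ρ), comp_snocFam (secMap V ρ)] at this
          exact this
    exact sub_eq_zero.1 (DFunLike.congr_fun h0 s))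
  refine ⟨W, hW.trans hW₁, hyW, E, homOn_lineBundle_ext fun W' s => ?_⟩
  rw [kodairaSpencer_proj]
  refine mres_sep _ _ _ fun z hz => ?_
  obtain ⟨Z, hZ, hzZ, hZ'⟩ := exists_isAffineOpen_le hz
  refine ⟨Z, hZ, hzZ, ?_⟩
  let FZ := F.restrict ((hZ.trans W'.2).trans hW)
  let θ : x.L₁.obj Z →ₗ[Γ(X.left, Z)] Γ(x.cokernelBundle, Z) :=
    (ψ.1 ⟨Z, ((hZ.trans W'.2).trans hW).trans hW₁⟩).comp (x.toLine Z)
  -- Both sides are linear, so it suffices to compare generators: both kill the `a i`, which lie in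
  -- `L_d`, and on `e` both give the class of `v`.
  have key : ∀ t : x.L₁.obj Z, x.secondForm E ⟨Z, hZ.trans W'.2⟩ t = θ t := by
    intro t
    have ht : t.1 ∈ Submodule.span Γ(X.left, Z) (Set.range (snocFam FZ.a FZ.e)) := by
      rw [← FZ.spanned₁.obj_eq]
      exact t.2
    have hle : Submodule.span Γ(X.left, Z) (Set.range (snocFam FZ.a FZ.e)) ≤
        (LinearMap.eqLocus (x.secondForm E ⟨Z, hZ.trans W'.2⟩) θ).map (x.L₁.obj Z).subtype := by
      rw [Submodule.span_le]
      rintro _ ⟨i | i, rfl⟩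
      · have h₀ : FZ.a i ∈ x.L₀.obj Z := by
          rw [FZ.spanned₀.obj_eq]
          exact Submodule.subset_span ⟨i, rfl⟩
        refine ⟨⟨FZ.a i, x.le Z h₀⟩, ?_, rfl⟩
        have e₀ : θ ⟨FZ.a i, x.le Z h₀⟩ = 0 := by
          rw [LinearMap.comp_apply, x.toLine_eq_zero _ h₀, map_zero]
        exact (x.secondForm_eq_zero E ⟨Z, hZ.trans W'.2⟩ ⟨FZ.a i, x.le Z h₀⟩ h₀).trans e₀.symm
      · have h₁ : FZ.e ∈ x.L₁.obj Z := x.L₁.res_mem _ he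
        refine ⟨⟨FZ.e, h₁⟩, ?_, rfl⟩
        have e₁ : θ ⟨FZ.e, h₁⟩ = x.toCokernel Z (res V X (hZ.trans W'.2) v) := by
          rw [x.toCokernel_res, hv, mres_res, ← ψ.2 ⟨W₁, hW₁⟩
            ⟨Z, ((hZ.trans W'.2).trans hW).trans hW₁⟩ ((hZ.trans W'.2).trans hW),
            ← x.toLine_res]
          rfl
        change x.secondForm E ⟨Z, hZ.trans W'.2⟩ _ = θ _
        rw [e₁, ← sub_eq_zero]
        change x.toCokernel Z (addSec V (derAdd E ⟨Z, hZ.trans W'.2⟩) FZ.e) - _ = 0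
        rw [← map_sub, x.toCokernel_eq_zero_iff, FZ.spanned_sup.obj_eq]
        have e₂ : derAdd E ⟨Z, hZ.trans W'.2⟩ = D Z (hZ.trans W'.2) hZ' :=
          AddMonoidHom.ext (hE Z (hZ.trans W'.2) hZ')
        rw [e₂]
        exact hDe Z (hZ.trans W'.2) hZ'
    obtain ⟨t', h, e⟩ := hle ht
    obtain rfl : t' = t := Subtype.ext e
    exact h
  have h₁ : mres x.cokernelBundle hZ (x.secondForm E W' s) =
      x.secondForm E ⟨Z, hZ.trans W'.2⟩ ⟨res V X hZ s.1, x.L₁.res_mem hZ s.2⟩ := by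
    change mres x.cokernelBundle hZ (x.toCokernel W'.1 _) = x.toCokernel Z _
    rw [← x.toCokernel_res]
    exact congrArg (x.toCokernel Z) (derSec_res E (W' := ⟨Z, hZ.trans W'.2⟩) hZ s.1).symm
  rw [h₁, key]
  change ψ.1 ⟨Z, _⟩ (x.toLine Z _) =
    mres _ hZ (ψ.1 ⟨W'.1, W'.2.trans (hW.trans hW₁)⟩ (x.toLine W'.1 s))
  rw [x.toLine_res]
  exact ψ.2 ⟨W'.1, W'.2.trans (hW.trans hW₁)⟩ ⟨Z, ((hZ.trans W'.2).trans hW).trans hW₁⟩ hZ _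

-- Injectivity on overlaps makes the local preimages agree, so they glue.
set_option maxHeartbeats 1000000 in
lemma kodairaSpencer_surjective (hx : IsSeparating x) (hx' : IsLiftable x) (hF : x.HasFrames)
    (hB : B.IsSymm) (hp : p ≠ 2) (U : X.left.Opens) :
    Function.Surjective (x.kodairaSpencer U) := by
  intro ψ
  choose W hW hyW D hD using fun y : U => exists_local_preimage hx hx' hF hB hp ψ y.2
  have glue : ∀ {U' : X.left.Opens} (_ : U' = iSup W) (hWU : ∀ y, W y ≤ U'),
      ∃ E : derOn X U', ∀ y, derRes X (hWU y) E = D y := by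
    rintro _ rfl _
    refine der_glue X W D fun y z => kodairaSpencer_injective hx hF hB hp _ ?_
    rw [kodairaSpencer_res, kodairaSpencer_res, hD, hD]
    rfl
  obtain ⟨E, hE⟩ := glue (le_antisymm (fun y hy => Opens.mem_iSup.2 ⟨⟨y, hy⟩, hyW ⟨y, hy⟩⟩)
    (iSup_le hW)) hW
  refine ⟨E, sub_eq_zero.1 (hom_sep _ _ _ fun y hy => ⟨W ⟨y, hy⟩, hW ⟨y, hy⟩, hyW ⟨y, hy⟩, ?_⟩)⟩
  rw [map_sub, ← kodairaSpencer_res, hE, hD, sub_self]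

/-- The Kodaira–Spencer isomorphism. -/
theorem nonempty_tangentSheaf_iso (hx : IsSeparating x) (hx' : IsLiftable x) (hF : x.HasFrames)
    (hB : B.IsSymm) (hp : p ≠ 2) :
    Nonempty (tangentSheaf X ≅ sheafHom x.lineBundle x.cokernelBundle) :=
  nonempty_iso_of_bijective (N := tangentSheaf X)
    (N' := sheafHom x.lineBundle x.cokernelBundle) (fun U => x.kodairaSpencer U)
    (fun h D => x.kodairaSpencer_res h D)
    fun U => ⟨kodairaSpencer_injective hx hF hB hp U,
      kodairaSpencer_surjective hx hx' hF hB hp U⟩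

end DL

end KodairaSpencer

/-! ### The universal flag over `Y_V` -/

section Universal

variable {p : ℕ} [Fact p.Prime] {k : Type u} [Field k] [Algebra (ZMod p) k]
variable {V : Type u} [AddCommGroup V] [Module (ZMod p) V]
variable {B : LinearMap.BilinForm (ZMod p) V} {d : ℕ} {O Y : SchemeOver k}

namespace DLVariety

variable (hO : (OGrFunctor B d k).RepresentableBy O) (hY : (DLFunctor B d k).RepresentableBy Y)
  (C : O.left.Opens)

lemma univ_pull {T : SchemeOver k} (f : T ⟶ DLVariety hO hY C) :
    (univ hO hY C).pull f =
      hY.homEquiv (f ≫ openSubInclusion Y ((forgetMor hO hY).left ⁻¹ᵁ C)) :=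
  (hY.homEquiv_comp f _).symm

/-- Representability separates morphisms to `𝒴_V`, and an open immersion is a monomorphism. -/
lemma isSeparating_univ : IsSeparating (univ hO hY C) := by
  intro T f g h
  rw [univ_pull, univ_pull] at h
  have h₁ := congrArg CommaMorphism.left (hY.homEquiv.injective h)
  exact Over.OverMorphism.ext
    ((cancel_mono ((forgetMor hO hY).left ⁻¹ᵁ C).ι).1 h₁)

lemma isLiftable_univ : IsLiftable (univ hO hY C) := by
  intro T₀ T j hj t f₀ h
  let W : Y.left.Opens := (forgetMor hO hY).left ⁻¹ᵁ C
  let g : T ⟶ Y := hY.homEquiv.symm t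
  have hg : hY.homEquiv g = t := hY.homEquiv.apply_symm_apply t
  have h₁ : j ≫ g = f₀ ≫ openSubInclusion Y W := by
    refine hY.homEquiv.injective ?_
    rw [← univ_pull hO hY C, h, hY.homEquiv_comp, hg]
    rfl
  -- `g` factors through the open subscheme as soon as its points do. Every point of `T` comes from
  -- `T₀`, where `g` agrees with `f₀`.
  have h₂ : Set.range g.left ⊆ Set.range W.ι := by
    rintro _ ⟨y, rfl⟩
    obtain ⟨z, rfl⟩ := hj y
    refine ⟨f₀.left z, ?_⟩
    have h₃ := congrArg CommaMorphism.left h₁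
    exact (congrArg (fun φ : T₀.left ⟶ Y.left => φ z) h₃).symm
  let l : T.left ⟶ Scheme.Opens.toScheme (X := Y.left) W :=
    IsOpenImmersion.lift (Scheme.Opens.ι (X := Y.left) W) g.left h₂
  have h₄ : l ≫ Scheme.Opens.ι (X := Y.left) W = g.left := IsOpenImmersion.lift_fac _ _ _
  let f : T ⟶ DLVariety hO hY C := Over.homMk l (by
    change l ≫ Scheme.Opens.ι (X := Y.left) W ≫ Y.hom = _
    rw [← Category.assoc, h₄]
    exact Over.w g)
  refine ⟨f, ?_⟩
  have h₅ : f ≫ openSubInclusion Y W = g := Over.OverMorphism.ext h₄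
  rw [univ_pull, h₅, hg]

end DLVariety

end Universal

end DLTangent

end

theorem proposition2p5 (p : ℕ) [Fact p.Prime] (hp : p ≠ 2)
    (k : Type u) [Field k] [Algebra (ZMod p) k] (hk : Nat.card k = p ^ 2)
    (d : ℕ) (V : Type u) [AddCommGroup V] [Module (ZMod p) V] [Module.Finite (ZMod p) V]
    (hV : Module.finrank (ZMod p) V = 2 * (d + 1))
    (B : LinearMap.BilinForm (ZMod p) V) (hsymm : B.IsSymm) (hnondeg : B.Nondegenerate)
    (hnonsplit : ∀ W : Submodule (ZMod p) V,
      (∀ x ∈ W, ∀ y ∈ W, B x y = 0) → Module.finrank (ZMod p) W ≠ d + 1)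
    (O : DLTangent.SchemeOver k) (hO : (DLTangent.OGrFunctor B d k).RepresentableBy O)
    (Y : DLTangent.SchemeOver k) (hY : (DLTangent.DLFunctor B d k).RepresentableBy Y)
    (C : O.left.Opens) (hC : ∃ x : O.left, (C : Set O.left) = connectedComponent x) :
    Nonempty
      (DLTangent.tangentSheaf (DLTangent.DLVariety hO hY C) ≅
        DLTangent.sheafHom (DLTangent.DLVariety.univ hO hY C).lineBundle
          (DLTangent.DLVariety.univ hO hY C).cokernelBundle) :=
  DLTangent.DL.nonempty_tangentSheaf_iso (DLTangent.DLVariety.isSeparating_univ hO hY C)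
    (DLTangent.DLVariety.isLiftable_univ hO hY C)
    (fun hy => DLTangent.exists_adaptedOn hnondeg hV hnonsplit _ hy) hsymm hp
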